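/- Let $\mathcal B_1^+(\mathbb R_{\ge 0})$ be the set of positive Borel measures $F$ on $\mathbb R_{\ge 0}$ with $\int(1+x)\,dF(x)<\infty$, and put $N(F)=\int dF$, $E(F)=\int x\,dF(x)$. **Kernel.** Let $B(\mathbf v-\mathbf v_*,\omega)=\frac1{(4\pi)^2}|(\mathbf v-\mathbf v_*)\cdot\omega|\,\Phi(|\mathbf v-\mathbf v'|,|\mathbf v-\mathbf v_*'|)$ for $\mathbf v,\mathbf v_*\in\mathbb R^3$, $\omega\in\mathbb S^2$, where $\mathbf v'=\mathbf v-((\mathbf v-\mathbf v_*)\cdot\omega)\omega$, $\mathbf v_*'=\mathbf v_*+((\mathbf v-\mathbf v_*)\cdot\omega)\omega$, and $\Phi\ge 0$ is bounded, continuous and symmetric on $\mathbb R_{\ge0}^2$, $\rho\mapsto\Phi(r,\rho)$ is non-decreasing for every $r\ge0$, and $$b_0\min\{1,(r^2+\rho^2)^\eta\}\le\Phi(r,\rho)\le 1\qquad\forall\,r,\rho\ge0$$ with constants $0<b_0<1$ and $0\le\eta<1$. **Solutions.** For $\varphi\in C_b^2(\mathbb R_{\ge0})$ (twice continuously differentiable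 on $\mathbb R_{\ge 0}$ with $\varphi,\varphi',\varphi''$ bounded) and $x,y,z\ge0$ let $x_*=(y+z-x)_+$, $$\mathcal K[\varphi](x,y,z)=W(x,y,z)\big(\varphi(x)+\varphi(x_*)-\varphi(y)-\varphi(z)\big),\qquad \mathcal J[\varphi](y,z)=\tfrac12\int_0^{y+z}\mathcal K[\varphi](x,y,z)\sqrt x\,dx,$$ where, if $x_*xyz>0$, $$W(x,y,z)=\frac1{4\pi\sqrt{xyz}}\int_{\max\{|\sqrt x-\sqrt y|,\,|\sqrt{x_*}-\sqrt z|\}}^{\min\{\sqrt x+\sqrt y,\,\sqrt{x_*}+\sqrt z\}}\!ds\int_0^{2\pi}\Phi(\sqrt2\,s,\sqrt2\,Y_*)\,d\theta,$$ $$Y_*=\Big|\sqrt{\big(z-\tfrac{(x-y+s^2)^2}{4s^2}\big)_+}+e^{i\theta}\sqrt{\big(x-\tfrac{(x-y+s^2)^2}{4s^2}\big)_+}\Big|\ (s>0),\qquad Y_*=0\ (s=0);$$ $W(0,y,z)=\frac{\Phi(\sqrt{2y},\sqrt{2z})}{\sqrt{yz}}$ for $y,z>0$; $W(x,0,z)=\frac{\Phi(\sqrt{2x},\sqrt{2(z-x)})}{\sqrt{xz}}$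 for $z>x>0$; $W(x,y,0)=\frac{\Phi(\sqrt{2(y-x)},\sqrt{2x})}{\sqrt{xy}}$ for $y>x>0$; and $W=0$ in all other cases. A conservative measure-valued isotropic solution on $[0,\infty)$ with initial datum $F_0\in\mathcal B_1^+(\mathbb R_{\ge0})$ is a family $\{F_t\}_{t\ge0}\subset\mathcal B_1^+(\mathbb R_{\ge0})$ with $F_t|_{t=0}=F_0$ such that $N(F_t)=N(F_0)$ and $E(F_t)=E(F_0)$ for all $t\ge0$ and, for every $\varphi\in C_b^2(\mathbb R_{\ge0})$, the function $t\mapsto\int\varphi\,dF_t$ belongs to $C^1([0,\infty))$ and $$\frac{d}{dt}\int\varphi\,dF_t=\int_{\mathbb R_{\ge0}^2}\mathcal J[\varphi](y,z)\,dF_t(y)dF_t(z)+\int_{\mathbb R_{\ge0}^3}\mathcal K[\varphi](x,y,z)\,dF_t(x)dF_t(y)dF_t(z)\qquad\forall\,t\ge0.$$ **Temperatures.** For particle mass $m>0$ and Boltzmann constant $k_B>0$, and $N,E>0$, let $$\overline T=\frac{2m}{3k_B}\frac EN,\qquad \overline T_c=\frac{\zeta(5/2)}{(2\pi)^{1/3}\zeta(3/2)^{5/3}}\,\frac{2m}{k_B}N^{2/3},\qquad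 \zeta(s)=\sum_{n\ge1}n^{-s}.$$ **Statement.** Let $B$ be as above, and let $F_0\in\mathcal B_1^+(\mathbb R_{\ge0})$ with $N=N(F_0)>0$ and $E=E(F_0)>0$. Let $0\le\alpha<1-\eta$, $\beta=\frac12(1-\eta-\alpha)$, $p=\frac32+\alpha$, and suppose $$\frac EN\le\frac1{4p},\qquad \inf_{0<\varepsilon\le1/2}\frac{F_0([0,\varepsilon])}{\varepsilon^\alpha}\ \ge\ \frac{2^{9.5+\alpha}(4p)^{2\beta}}{(\log 2)\,b_0}\Big(\frac p\beta\Big)^{2p}\Big(\frac EN\Big)^{\frac12+2\beta}.$$ Then $$\frac{\overline T}{\overline T_c}<8\cdot10^{-4}\,b_0^{2/3}(1-\eta)^2,$$ and every conservative measure-valued isotropic solution $F_t$ on $[0,\infty)$ with initial datum $F_0$ satisfies $$F_t(\{0\})\ge\frac N8\qquad\forall\,t\ge\frac{\log 2}{2\sqrt{NE}}.$$ -/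

import Mathlib

open scoped NNReal

noncomputable section

namespace BoseBoltzmann

/-- Velocity space. -/
abbrev Vel : Type := EuclideanSpace ℝ (Fin 3)

/-! ### Collision kernel -/

/-- Post-collisional velocity `v' = v - ((v - v_*) · ω) ω`. -/
def postVel (v vs ω : Vel) : Vel := v - (inner ℝ (v - vs) ω) • ω

/-- Post-collisional velocity `v_*' = v_* + ((v - v_*) · ω) ω`. -/
def postVelStar (v vs ω : Vel) : Vel := vs + (inner ℝ (v - vs) ω) • ω

/-- `B(v - v_*, ω) = (4π)⁻² |(v - v_*) · ω| Φ(|v - v'|, |v - v_*'|)` with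
`0 ≤ Φ ∈ C_b(ℝ≥0 × ℝ≥0)` symmetric. Only the values of `Φ` on the closed quadrant are used. -/
structure IsCollisionKernel (B : Vel → Vel → ℝ) (Φ : ℝ → ℝ → ℝ) : Prop where
  kernel_eq : ∀ v vs ω : Vel, ‖ω‖ = 1 →
    B (v - vs) ω = 1 / (4 * Real.pi) ^ 2 * |inner ℝ (v - vs) ω| *
      Φ ‖v - postVel v vs ω‖ ‖v - postVelStar v vs ω‖
  nonneg : ∀ r ρ : ℝ, 0 ≤ r → 0 ≤ ρ → 0 ≤ Φ r ρ
  continuousOn : ContinuousOn (fun q : ℝ × ℝ => Φ q.1 q.2) (Set.Ici 0 ×ˢ Set.Ici 0)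
  bounded : ∃ C : ℝ, ∀ r ρ : ℝ, 0 ≤ r → 0 ≤ ρ → Φ r ρ ≤ C
  symm : ∀ r ρ : ℝ, 0 ≤ r → 0 ≤ ρ → Φ r ρ = Φ ρ r

/-- The kernel assumption: `ρ ↦ Φ(r, ρ)` is non-decreasing and
`b₀ min {1, (r² + ρ²)^η} ≤ Φ(r, ρ) ≤ 1`, with `0 < b₀ < 1` and `η ≥ 0`. -/
structure KernelAssumption (B : Vel → Vel → ℝ) (Φ : ℝ → ℝ → ℝ) (b₀ η : ℝ) : Prop
    extends IsCollisionKernel B Φ where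
  b₀_pos : 0 < b₀
  b₀_lt_one : b₀ < 1
  η_nonneg : 0 ≤ η
  mono : ∀ r ρ₁ ρ₂ : ℝ, 0 ≤ r → 0 ≤ ρ₁ → ρ₁ ≤ ρ₂ → Φ r ρ₁ ≤ Φ r ρ₂
  lower : ∀ r ρ : ℝ, 0 ≤ r → 0 ≤ ρ → b₀ * min 1 ((r ^ 2 + ρ ^ 2) ^ η) ≤ Φ r ρ
  upper : ∀ r ρ : ℝ, 0 ≤ r → 0 ≤ ρ → Φ r ρ ≤ 1

/-! ### The collision operators in the energy variable -/

/-- `x_* = (y + z - x)_+`. -/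
def xStar (x y z : ℝ) : ℝ := max (y + z - x) 0

/-- The quantity `Y_*(x, y, z, s, θ)`. -/
def YStar (x y z s θ : ℝ) : ℝ :=
  if 0 < s then
    ‖((Real.sqrt (max (z - (x - y + s ^ 2) ^ 2 / (4 * s ^ 2)) 0) : ℝ) : ℂ) +
      Complex.exp (Complex.I * (θ : ℂ)) *
        ((Real.sqrt (max (x - (x - y + s ^ 2) ^ 2 / (4 * s ^ 2)) 0) : ℝ) : ℂ)‖
  else 0

/-- The weight `W(x, y, z)`, `x, y, z ≥ 0`. -/
def W (Φ : ℝ → ℝ → ℝ) (x y z : ℝ) : ℝ :=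
  if 0 < xStar x y z * x * y * z then
    1 / (4 * Real.pi * Real.sqrt (x * y * z)) *
      ∫ s in (max |Real.sqrt x - Real.sqrt y| |Real.sqrt (xStar x y z) - Real.sqrt z|)..
          (min (Real.sqrt x + Real.sqrt y) (Real.sqrt (xStar x y z) + Real.sqrt z)),
        ∫ θ in (0 : ℝ)..(2 * Real.pi), Φ (Real.sqrt 2 * s) (Real.sqrt 2 * YStar x y z s θ)
  else if x = 0 ∧ 0 < y ∧ 0 < z then
    1 / Real.sqrt (y * z) * Φ (Real.sqrt (2 * y)) (Real.sqrt (2 * z))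
  else if y = 0 ∧ 0 < x ∧ x < z then
    1 / Real.sqrt (x * z) * Φ (Real.sqrt (2 * x)) (Real.sqrt (2 * (z - x)))
  else if z = 0 ∧ 0 < x ∧ x < y then
    1 / Real.sqrt (x * y) * Φ (Real.sqrt (2 * (y - x))) (Real.sqrt (2 * x))
  else 0

/-- `Δφ(x, y, z) = φ(x) + φ(x_*) - φ(y) - φ(z)`. -/
def Delta (φ : ℝ → ℝ) (x y z : ℝ) : ℝ := φ x + φ (xStar x y z) - φ y - φ z

/-- `K[φ](x, y, z) = W(x, y, z) Δφ(x, y, z)`. -/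
def opK (Φ : ℝ → ℝ → ℝ) (φ : ℝ → ℝ) (x y z : ℝ) : ℝ := W Φ x y z * Delta φ x y z

/-- `J[φ](y, z) = (1/2) ∫_0^{y+z} K[φ](x, y, z) √x dx`. -/
def opJ (Φ : ℝ → ℝ → ℝ) (φ : ℝ → ℝ) (y z : ℝ) : ℝ :=
  1 / 2 * ∫ x in (0 : ℝ)..(y + z), opK Φ φ x y z * Real.sqrt x

/-! ### Measures and solutions -/

/-- `F ∈ B_1^+(ℝ≥0)`: a positive Borel measure with `∫ (1 + x) dF(x) < ∞`. -/
def MemB1 (F : MeasureTheory.Measure ℝ≥0) : Prop :=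
  ∫⁻ x, (1 + (x : ENNReal)) ∂F < ⊤

/-- The mass `N(F) = ∫ dF`. -/
def mass (F : MeasureTheory.Measure ℝ≥0) : ℝ := F.real Set.univ

/-- The energy `E(F) = ∫ x dF(x)`. -/
def energy (F : MeasureTheory.Measure ℝ≥0) : ℝ := ∫ x, (x : ℝ) ∂F

/-- `φ ∈ C_b²(ℝ≥0)`: `φ` is `C²` on `[0, ∞)` (one-sided derivatives at `0`), and `φ, φ', φ''` are
bounded there. Only the values of `φ` on `[0, ∞)` are used. -/
def IsTestFunction (φ : ℝ → ℝ) : Prop :=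
  ContDiffOn ℝ 2 φ (Set.Ici 0) ∧
    ∀ k : ℕ, k ≤ 2 → ∃ C : ℝ, ∀ x : ℝ, 0 ≤ x → |iteratedDerivWithin k φ (Set.Ici 0) x| ≤ C

/-- The family `F_t`, `t ≥ 0`, is a conservative measure-valued isotropic solution on `[0, ∞)` with
initial datum `F₀`. The values of `F` at negative times are irrelevant. -/
structure IsConservativeSolution (Φ : ℝ → ℝ → ℝ) (F₀ : MeasureTheory.Measure ℝ≥0)
    (F : ℝ → MeasureTheory.Measure ℝ≥0) : Prop where
  initial : F 0 = F₀
  memB1 : ∀ t : ℝ, 0 ≤ t → MemB1 (F t)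
  mass_eq : ∀ t : ℝ, 0 ≤ t → mass (F t) = mass F₀
  energy_eq : ∀ t : ℝ, 0 ≤ t → energy (F t) = energy F₀
  contDiffOn : ∀ φ : ℝ → ℝ, IsTestFunction φ →
    ContDiffOn ℝ 1 (fun t : ℝ => ∫ x : ℝ≥0, φ x ∂(F t)) (Set.Ici 0)
  weak_eq : ∀ φ : ℝ → ℝ, IsTestFunction φ → ∀ t : ℝ, 0 ≤ t →
    HasDerivWithinAt (fun τ : ℝ => ∫ x : ℝ≥0, φ x ∂(F τ))
      ((∫ q : ℝ≥0 × ℝ≥0, opJ Φ φ q.1 q.2 ∂((F t).prod (F t))) +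
        ∫ q : ℝ≥0 × ℝ≥0 × ℝ≥0, opK Φ φ q.1 q.2.1 q.2.2 ∂((F t).prod ((F t).prod (F t))))
      (Set.Ici 0) t

/-! ### Temperatures and the local condition -/

/-- `ζ(s) = ∑_{n ≥ 1} n^{-s}` for real `s > 1`. -/
def zetaReal (s : ℝ) : ℝ := ∑' n : ℕ, ((n : ℝ) + 1) ^ (-s)

/-- Kinetic temperature, for particle mass `m`, Boltzmann constant `kB`. -/
def kineticTemp (m kB : ℝ) (F : MeasureTheory.Measure ℝ≥0) : ℝ :=
  2 * m / (3 * kB) * (energy F / mass F)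

/-- Kinetic critical temperature, for particle mass `m`, Boltzmann constant `kB`. -/
def criticalTemp (m kB : ℝ) (F : MeasureTheory.Measure ℝ≥0) : ℝ :=
  zetaReal (5 / 2) / ((2 * Real.pi) ^ (1 / 3 : ℝ) * zetaReal (3 / 2) ^ (5 / 3 : ℝ)) *
    (2 * m / kB) * mass F ^ (2 / 3 : ℝ)

/-- The local condition on the initial datum, with `β = (1 - η - α) / 2` and `p = 3/2 + α`. -/
def LocalCondition (b₀ η α : ℝ) (F₀ : MeasureTheory.Measure ℝ≥0) : Prop :=
  let β : ℝ := (1 - η - α) / 2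
  let p : ℝ := 3 / 2 + α
  energy F₀ / mass F₀ ≤ 1 / (4 * p) ∧
    (2 : ℝ) ^ (9.5 + α) * (4 * p) ^ (2 * β) / (Real.log 2 * b₀) * (p / β) ^ (2 * p) *
        (energy F₀ / mass F₀) ^ (1 / 2 + 2 * β) ≤
      ⨅ ε : Set.Ioc (0 : ℝ) (1 / 2), F₀.real {x : ℝ≥0 | (x : ℝ) ≤ ε} / (ε : ℝ) ^ α

end BoseBoltzmann

end

/-!
The proof tests the equation against the convex decreasing functions `cap ε x = (1 - x/ε)₊³` and
follows the mass near the origin through the scales `ε`.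

*Collision terms.* Write the three energies of the cubic term as `a ≤ b ≤ c`. Of the three choices
of the first argument only the middle one contributes negatively for a convex test function, and
`W(b, a, c) ≤ W(a, b, c)` since `Φ` is non-decreasing in its second argument (`W_swap_le`). What
remains is a second difference about `c` (`le_symK`), nonnegative in general and at least a multiple
of `ε^(η-1)` when `a ≤ ε/8` and `b, c ∈ (ε/2, ε]` (`gainRate_le_symK`). The reduction to
ordered triples uses `W(x, y, z) = W(x, z, y)`, which is not visible in the definition: it
follows by taking the lengths of both momentum transfers as integration variables
(`scatter_eq_transfer`). The quadratic term is at least `-√(NE) ∫ cap ε dF_t` (`le_integral_opJ`).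
With `λ = √(NE)` this gives
`d/dt ∫ cap ε dF_t ≥ -λ ∫ cap ε dF_t + κ_ε F_t[0, ε/8] F_t(ε/2, ε]²`.

*Descent.* In particular `e^{λt} ∫ cap ε dF_t` is non-decreasing, so the local condition, up to a
constant factor, survives on the time interval `[0, 2τ]`, where `λτ = (log 2)/2`. While it holds,
`κ_ε F_t[0, ε/8]` is at least a constant times `ε^(-2β)`. The inequality is summed over the
scales `ε 2^(-k)`, from `ε = 4pE/N` on, with weights `2^(-βk)`, and the Cauchy–Schwarz inequality
shows that at some time in any window of length `τ` the dyadic bands together carry at most `N/2`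
(`exists_sum_band_le`). By Chebyshev's inequality `F_t[0, ε] ≥ 5N/6`, so `N/3` lies below
arbitrarily small energies, and after the factor `e^{-λτ} = 1/√2` at least `N/(3√2)` sits at the
origin at the end of the window. This in turn restores the local lower bound on the next window, and
an induction over windows reaches all later times (`le_real_singleton_zero_of_window`).

*Temperature.* At `ε = 1/2` the local condition bounds `N` from below by a power of `E/N`
(`mass_sq_ge`); the bound on the temperature ratio is then numerical, from `ζ(3/2) ≤ 2.6331` and
`ζ(5/2) ≥ 1.272`.
-/

open scoped NNReal

noncomputable section

namespace BoseBoltzmann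

open MeasureTheory Set

/-! ### The triangle substitution -/

/-- For `a, b > 0`, the third side of a triangle with sides `a`, `b` and exterior angle `θ` is
`t = √(a² + b² + 2ab cos θ)`; this is the substitution `θ ↦ t`, in which `dθ` becomes `dt` divided
by the distance of a vertex from the opposite side. -/
theorem lintegral_chord {a b : ℝ} (ha : 0 < a) (hb : 0 < b) (g : ℝ → ENNReal) :
    ∫⁻ θ in Ioo 0 Real.pi, g (Real.sqrt (a ^ 2 + b ^ 2 + 2 * a * b * Real.cos θ)) =
      ∫⁻ t in Ioo |a - b| (a + b),
        ENNReal.ofReal (1 / Real.sqrt (b ^ 2 - ((b ^ 2 - a ^ 2 + t ^ 2) / (2 * t)) ^ 2)) * g t := by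
  set f : ℝ → ℝ := fun θ => Real.sqrt (a ^ 2 + b ^ 2 + 2 * a * b * Real.cos θ) with hf
  have hab : 0 < a * b := mul_pos ha hb
  have hcos : ∀ θ ∈ Ioo (0 : ℝ) Real.pi, -1 < Real.cos θ ∧ Real.cos θ < 1 := by
    intro θ hθ
    have hs := Real.sin_pos_of_mem_Ioo hθ
    have := Real.sin_sq_add_cos_sq θ
    constructor <;> nlinarith
  have hpos : ∀ θ ∈ Ioo (0 : ℝ) Real.pi, (a - b) ^ 2 < a ^ 2 + b ^ 2 + 2 * a * b * Real.cos θ := by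
    intro θ hθ
    nlinarith [mul_pos hab (by linarith [(hcos θ hθ).1] : 0 < 1 + Real.cos θ)]
  have hlt : ∀ θ ∈ Ioo (0 : ℝ) Real.pi, a ^ 2 + b ^ 2 + 2 * a * b * Real.cos θ < (a + b) ^ 2 := by
    intro θ hθ
    nlinarith [mul_pos hab (by linarith [(hcos θ hθ).2] : 0 < 1 - Real.cos θ)]
  have hfpos : ∀ θ ∈ Ioo (0 : ℝ) Real.pi, 0 < f θ := fun θ hθ =>
    Real.sqrt_pos.2 (lt_of_le_of_lt (sq_nonneg _) (hpos θ hθ))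
  have hfsq : ∀ θ ∈ Ioo (0 : ℝ) Real.pi, f θ ^ 2 = a ^ 2 + b ^ 2 + 2 * a * b * Real.cos θ :=
    fun θ hθ => Real.sq_sqrt (lt_of_le_of_lt (sq_nonneg _) (hpos θ hθ)).le
  have himg : f '' Ioo 0 Real.pi = Ioo |a - b| (a + b) := by
    ext t
    constructor
    · rintro ⟨θ, hθ, rfl⟩
      refine ⟨?_, ?_⟩
      · rw [← Real.sqrt_sq_eq_abs]
        exact Real.sqrt_lt_sqrt (sq_nonneg _) (hpos θ hθ)
      · rw [hf, Real.sqrt_lt' (by positivity)]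
        exact hlt θ hθ
    · rintro ⟨h1, h2⟩
      have ht : 0 < t := lt_of_le_of_lt (abs_nonneg _) h1
      have h1' : (a - b) ^ 2 < t ^ 2 := by
        rw [← sq_abs]; exact pow_lt_pow_left₀ h1 (abs_nonneg _) two_ne_zero
      have h2' : t ^ 2 < (a + b) ^ 2 := pow_lt_pow_left₀ h2 ht.le two_ne_zero
      have k1 : -1 < (t ^ 2 - a ^ 2 - b ^ 2) / (2 * a * b) := by
        rw [lt_div_iff₀ (by positivity)]; nlinarith
      have k2 : (t ^ 2 - a ^ 2 - b ^ 2) / (2 * a * b) < 1 := by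
        rw [div_lt_iff₀ (by positivity)]; nlinarith
      refine ⟨Real.arccos ((t ^ 2 - a ^ 2 - b ^ 2) / (2 * a * b)),
        ⟨Real.arccos_pos.2 k2, ?_⟩, ?_⟩
      · refine lt_of_le_of_ne (Real.arccos_le_pi _) fun h => ?_
        rw [Real.arccos_eq_pi] at h
        linarith
      · simp only [hf]
        rw [Real.cos_arccos k1.le k2.le]
        have : a ^ 2 + b ^ 2 + 2 * a * b * ((t ^ 2 - a ^ 2 - b ^ 2) / (2 * a * b)) = t ^ 2 := by
          field_simp; ring
        rw [this, Real.sqrt_sq ht.le]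
  have hderiv : ∀ θ ∈ Ioo (0 : ℝ) Real.pi,
      HasDerivWithinAt f (-(a * b * Real.sin θ / f θ)) (Ioo 0 Real.pi) θ := by
    intro θ hθ
    have h1 : HasDerivAt (fun θ => a ^ 2 + b ^ 2 + 2 * a * b * Real.cos θ)
        (2 * a * b * (-Real.sin θ)) θ :=
      ((Real.hasDerivAt_cos θ).const_mul (2 * a * b)).const_add _
    have h2 := h1.sqrt (lt_of_le_of_lt (sq_nonneg _) (hpos θ hθ)).ne'
    refine (h2.congr_deriv ?_).hasDerivWithinAt
    have := (hfpos θ hθ).ne'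
    change 2 * a * b * -Real.sin θ / (2 * f θ) = _
    field_simp
  have hinj : InjOn f (Ioo 0 Real.pi) := by
    intro θ₁ h₁ θ₂ h₂ h
    have h' : f θ₁ ^ 2 = f θ₂ ^ 2 := by rw [h]
    rw [hfsq _ h₁, hfsq _ h₂] at h'
    have : Real.cos θ₁ = Real.cos θ₂ := by
      have : a * b * (Real.cos θ₁ - Real.cos θ₂) = 0 := by linarith
      rcases mul_eq_zero.1 this with h | h
      · exact absurd h hab.ne'
      · linarith
    exact Real.injOn_cos ⟨h₁.1.le, h₁.2.le⟩ ⟨h₂.1.le, h₂.2.le⟩ this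
  rw [← himg, lintegral_image_eq_lintegral_abs_deriv_mul measurableSet_Ioo hderiv hinj]
  refine setLIntegral_congr_fun measurableSet_Ioo fun θ hθ => ?_
  have hs := Real.sin_pos_of_mem_Ioo hθ
  have h0 := hfpos θ hθ
  have key : b ^ 2 - ((b ^ 2 - a ^ 2 + f θ ^ 2) / (2 * f θ)) ^ 2 = (a * b * Real.sin θ / f θ) ^ 2 := by
    have e1 := hfsq θ hθ
    field_simp
    rw [e1, Real.sin_sq]; ring
  rw [key, Real.sqrt_sq (by positivity), abs_neg, abs_of_pos (by positivity), ← mul_assoc,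
    ← ENNReal.ofReal_mul (by positivity)]
  rw [mul_one_div_cancel (by positivity)]
  simp [hf]

/-- A triangle with sides `√u`, `√v`, `s` is nondegenerate iff the projection of the side `√u` on
the line of `s` is shorter than `√u`. -/
theorem abs_sub_lt_lt_add_iff {s u v : ℝ} (hs : 0 < s) (hu : 0 ≤ u) (hv : 0 ≤ v) :
    (|Real.sqrt u - Real.sqrt v| < s ∧ s < Real.sqrt u + Real.sqrt v) ↔
      (u - v + s ^ 2) ^ 2 / (4 * s ^ 2) < u := by
  obtain ⟨a, ha, rfl⟩ : ∃ a : ℝ, 0 ≤ a ∧ u = a ^ 2 := ⟨_, Real.sqrt_nonneg u, (Real.sq_sqrt hu).symm⟩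
  obtain ⟨b, hb, rfl⟩ : ∃ b : ℝ, 0 ≤ b ∧ v = b ^ 2 := ⟨_, Real.sqrt_nonneg v, (Real.sq_sqrt hv).symm⟩
  rw [Real.sqrt_sq ha, Real.sqrt_sq hb, div_lt_iff₀ (by positivity), abs_lt]
  have : (a ^ 2 - b ^ 2 + s ^ 2) ^ 2 < a ^ 2 * (4 * s ^ 2) ↔ |a ^ 2 - b ^ 2 + s ^ 2| < 2 * a * s := by
    rw [← sq_lt_sq₀ (abs_nonneg (a ^ 2 - b ^ 2 + s ^ 2)) (by positivity : 0 ≤ 2 * a * s), sq_abs]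
    ring_nf
  rw [this, abs_lt]
  constructor
  · rintro ⟨⟨h1, h2⟩, h3⟩
    constructor <;> nlinarith
  · rintro ⟨h1, h2⟩
    have k1 : b < s + a := by
      refine lt_of_pow_lt_pow_left₀ 2 (by positivity) ?_
      nlinarith
    have k2 : |s - a| < b := by
      refine lt_of_pow_lt_pow_left₀ 2 hb ?_
      rw [sq_abs]
      nlinarith
    rw [abs_lt] at k2
    refine ⟨⟨?_, ?_⟩, ?_⟩ <;> linarith [k2.1, k2.2]

theorem lintegral_Ioc_two_pi_cos (g : ℝ → ENNReal) :
    ∫⁻ θ in Ioc 0 (2 * Real.pi), g (Real.cos θ) = 2 * ∫⁻ θ in Ioo 0 Real.pi, g (Real.cos θ) := by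
  have hpi := Real.pi_pos
  have e : Ioc (0 : ℝ) (2 * Real.pi) = Ioc 0 Real.pi ∪ Ioc Real.pi (2 * Real.pi) :=
    (Ioc_union_Ioc_eq_Ioc hpi.le (by linarith)).symm
  rw [e, lintegral_union measurableSet_Ioc (by
    rw [Set.disjoint_left]; intro x hx hx'; exact absurd hx.2 (not_le.2 hx'.1))]
  have h2 : ∫⁻ θ in Ioc Real.pi (2 * Real.pi), g (Real.cos θ) =
      ∫⁻ θ in Ioo 0 Real.pi, g (Real.cos θ) := by
    rw [setLIntegral_congr Ioo_ae_eq_Ioc.symm, ← lintegral_indicator measurableSet_Ioo,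
      ← lintegral_indicator measurableSet_Ioo, ← lintegral_sub_left_eq_self _ (2 * Real.pi)]
    congr 1
    ext θ
    simp only [indicator, mem_Ioo]
    have : (Real.pi < 2 * Real.pi - θ ∧ 2 * Real.pi - θ < 2 * Real.pi) ↔ (0 < θ ∧ θ < Real.pi) := by
      constructor <;> rintro ⟨h1, h2⟩ <;> constructor <;> linarith
    simp only [this, Real.cos_two_pi_sub]
  rw [h2, setLIntegral_congr Ioo_ae_eq_Ioc.symm, two_mul]

/-! ### The weight in terms of the two momentum transfers, and its symmetry -/

/-- The square of the component of the incoming velocity along the momentum transfer, whose length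
is `s`. -/
def alongSq (x y s : ℝ) : ℝ := (x - y + s ^ 2) ^ 2 / (4 * s ^ 2)

theorem YStar_eq {s : ℝ} (hs : 0 < s) (x y z θ : ℝ) :
    YStar x y z s θ =
      Real.sqrt (Real.sqrt (max (z - alongSq x y s) 0) ^ 2 + Real.sqrt (max (x - alongSq x y s) 0) ^ 2 +
        2 * Real.sqrt (max (z - alongSq x y s) 0) * Real.sqrt (max (x - alongSq x y s) 0) *
          Real.cos θ) := by
  unfold YStar alongSq
  rw [if_pos hs]
  generalize Real.sqrt (max (z - (x - y + s ^ 2) ^ 2 / (4 * s ^ 2)) 0) = a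
  generalize Real.sqrt (max (x - (x - y + s ^ 2) ^ 2 / (4 * s ^ 2)) 0) = b
  rw [Complex.norm_def, Complex.normSq_apply, mul_comm Complex.I, Complex.exp_mul_I,
    ← Complex.ofReal_cos, ← Complex.ofReal_sin]
  congr 1
  simp [-Complex.ofReal_cos, -Complex.ofReal_sin]
  linear_combination b ^ 2 * Real.sin_sq_add_cos_sq θ

theorem YStar_nonneg (x y z s θ : ℝ) : 0 ≤ YStar x y z s θ := by
  unfold YStar; split_ifs <;> positivity

/-- The kernel factor extended from the closed quadrant to the plane by projection. -/
def extendKernel (Φ : ℝ → ℝ → ℝ) (q : ℝ × ℝ) : ℝ := Φ (max q.1 0) (max q.2 0)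

theorem extendKernel_eq (Φ : ℝ → ℝ → ℝ) {r ρ : ℝ} (hr : 0 ≤ r) (hρ : 0 ≤ ρ) :
    extendKernel Φ (r, ρ) = Φ r ρ := by
  simp [extendKernel, hr, hρ]

theorem IsCollisionKernel.continuous_extendKernel {B : Vel → Vel → ℝ} {Φ : ℝ → ℝ → ℝ}
    (hB : IsCollisionKernel B Φ) : Continuous (extendKernel Φ) := by
  have : Continuous fun q : ℝ × ℝ => (max q.1 0, max q.2 0) := by fun_prop
  refine hB.continuousOn.comp_continuous this fun q => ?_
  simp

/-- Lower end of the range of `s` in the definition of `W`. -/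
def sMin (x y z : ℝ) : ℝ :=
  max |Real.sqrt x - Real.sqrt y| |Real.sqrt (xStar x y z) - Real.sqrt z|

/-- Upper end of the range of `s` in the definition of `W`. -/
def sMax (x y z : ℝ) : ℝ :=
  min (Real.sqrt x + Real.sqrt y) (Real.sqrt (xStar x y z) + Real.sqrt z)

/-- The double integral in the definition of `W`, with values in `[0, ∞]`. -/
def scatter (Φ : ℝ → ℝ → ℝ) (x y z : ℝ) : ENNReal :=
  ∫⁻ s in Ioc (sMin x y z) (sMax x y z), ∫⁻ θ in Ioc 0 (2 * Real.pi),
    ENNReal.ofReal (Φ (Real.sqrt 2 * s) (Real.sqrt 2 * YStar x y z s θ))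

theorem sMin_nonneg (x y z : ℝ) : 0 ≤ sMin x y z := le_max_of_le_left (abs_nonneg _)

theorem xStar_of_pos {x y z : ℝ} (h : 0 < xStar x y z) : xStar x y z = y + z - x := by
  unfold xStar at *
  rcases lt_max_iff.1 h with h | h
  · exact max_eq_left h.le
  · exact absurd h (lt_irrefl _)

/-- The scattering integral over the lengths `s`, `t` of the two momentum transfers, which are
orthogonal; in these variables it does not distinguish them. -/
def transferIntegrand (Φ : ℝ → ℝ → ℝ) (x y z s t : ℝ) : ENNReal :=
  if alongSq x y s + alongSq x z t < x then
    ENNReal.ofReal (1 / Real.sqrt (x - alongSq x y s - alongSq x z t)) *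
      ENNReal.ofReal (extendKernel Φ (Real.sqrt 2 * s, Real.sqrt 2 * t))
  else 0

theorem alongSq_nonneg (x y s : ℝ) : 0 ≤ alongSq x y s := by unfold alongSq; positivity

theorem scatter_eq_transfer (Φ : ℝ → ℝ → ℝ) {x y z : ℝ} (hx : 0 < x) (hy : 0 < y) (hz : 0 < z)
    (hst : 0 < xStar x y z) :
    scatter Φ x y z = 2 * ∫⁻ s in Ioi 0, ∫⁻ t in Ioi 0, transferIntegrand Φ x y z s t := by
  have hxs := xStar_of_pos hst
  have hmem : ∀ s : ℝ, 0 < s →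
      (s ∈ Ioo (sMin x y z) (sMax x y z) ↔ alongSq x y s < x ∧ alongSq x y s < z) := by
    intro s hs
    unfold alongSq
    have h1 := abs_sub_lt_lt_add_iff hs hx.le hy.le
    have h2 := abs_sub_lt_lt_add_iff hs hz.le hst.le
    have e : z - xStar x y z = x - y := by rw [hxs]; ring
    rw [e] at h2
    rw [← h1, ← h2, abs_sub_comm (Real.sqrt z), add_comm (Real.sqrt z)]
    simp only [sMin, sMax, mem_Ioo, max_lt_iff, lt_min_iff]
    tauto
  have hsub : Ioo (sMin x y z) (sMax x y z) ⊆ Ioi 0 :=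
    fun s hs => lt_of_le_of_lt (sMin_nonneg x y z) hs.1
  unfold scatter
  rw [setLIntegral_congr Ioo_ae_eq_Ioc.symm, ← lintegral_const_mul' _ _ (by simp),
    ← lintegral_indicator measurableSet_Ioo, ← lintegral_indicator measurableSet_Ioi]
  congr 1
  ext s
  by_cases hs : 0 < s
  swap
  · rw [indicator_of_notMem (fun h => hs (hsub h)), indicator_of_notMem (show s ∉ Ioi (0 : ℝ) from hs)]
  rw [indicator_of_mem (show s ∈ Ioi (0 : ℝ) from hs)]
  by_cases hm : s ∈ Ioo (sMin x y z) (sMax x y z)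
  · rw [indicator_of_mem hm]
    obtain ⟨hA, hB⟩ := (hmem s hs).1 hm
    set A := z - alongSq x y s with hAdef
    set C := x - alongSq x y s with hCdef
    have hA0 : 0 < A := by linarith
    have hC0 : 0 < C := by linarith
    have hY : ∀ θ, YStar x y z s θ =
        Real.sqrt (Real.sqrt A ^ 2 + Real.sqrt C ^ 2 +
          2 * Real.sqrt A * Real.sqrt C * Real.cos θ) := by
      intro θ
      rw [YStar_eq hs, max_eq_left hA0.le, max_eq_left hC0.le]
    simp only [hY]
    rw [lintegral_Ioc_two_pi_cos (fun k => ENNReal.ofReal (Φ (Real.sqrt 2 * s)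
      (Real.sqrt 2 * Real.sqrt (Real.sqrt A ^ 2 + Real.sqrt C ^ 2 +
          2 * Real.sqrt A * Real.sqrt C * k)))),
      lintegral_chord (Real.sqrt_pos.2 hA0) (Real.sqrt_pos.2 hC0)
        (fun t => ENNReal.ofReal (Φ (Real.sqrt 2 * s) (Real.sqrt 2 * t))),
      ← lintegral_indicator measurableSet_Ioo, ← lintegral_indicator measurableSet_Ioi]
    congr 2
    ext t
    by_cases ht : 0 < t
    swap
    · rw [indicator_of_notMem (fun h => ht (lt_of_le_of_lt (abs_nonneg _) h.1)),
        indicator_of_notMem (show t ∉ Ioi (0 : ℝ) from ht)]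
    rw [indicator_of_mem (show t ∈ Ioi (0 : ℝ) from ht)]
    have h1 := abs_sub_lt_lt_add_iff ht hC0.le hA0.le
    have e : C - A = x - z := by rw [hAdef, hCdef]; ring
    have e' : x - z + t ^ 2 = Real.sqrt C ^ 2 - Real.sqrt A ^ 2 + t ^ 2 := by
      rw [Real.sq_sqrt hC0.le, Real.sq_sqrt hA0.le, e]
    rw [e, abs_sub_comm, add_comm (Real.sqrt C)] at h1
    unfold transferIntegrand
    by_cases htm : t ∈ Ioo |Real.sqrt A - Real.sqrt C| (Real.sqrt A + Real.sqrt C)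
    · have h2 : alongSq x z t < C := h1.1 htm
      rw [indicator_of_mem htm, if_pos (by linarith), extendKernel_eq _ (by positivity)
        (by positivity), ← hCdef, ← e', Real.sq_sqrt hC0.le]
      congr 5
      unfold alongSq
      rw [div_pow]; ring
    · have h2 : ¬ alongSq x z t < C := fun h => htm (h1.2 h)
      rw [indicator_of_notMem htm, if_neg (by intro h; apply h2; linarith)]
  · rw [indicator_of_notMem hm]
    symm
    rw [mul_eq_zero]
    right
    rw [lintegral_eq_zero_of_ae_eq_zero]
    rw [Filter.EventuallyEq, ae_restrict_iff' measurableSet_Ioi]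
    refine Filter.Eventually.of_forall fun t ht => ?_
    unfold transferIntegrand
    rw [if_neg, Pi.zero_apply]
    intro h
    apply hm
    rw [hmem s hs]
    refine ⟨by linarith [alongSq_nonneg x z t], ?_⟩
    have ht : (0 : ℝ) < t := ht
    -- `x - (x - z + t²)² / (4t²) = z - (z - x + t²)² / (4t²)`
    have : x - alongSq x z t = z - alongSq z x t := by
      unfold alongSq; field_simp; ring
    linarith [alongSq_nonneg z x t]

theorem xStar_symm (x y z : ℝ) : xStar x y z = xStar x z y := by unfold xStar; rw [add_comm y]

theorem IsCollisionKernel.measurable_transferIntegrand {B : Vel → Vel → ℝ} {Φ : ℝ → ℝ → ℝ}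
    (hB : IsCollisionKernel B Φ) (x y z : ℝ) :
    Measurable (Function.uncurry (transferIntegrand Φ x y z)) := by
  have h1 : Measurable fun q : ℝ × ℝ => alongSq x y q.1 := by unfold alongSq; fun_prop
  have h2 : Measurable fun q : ℝ × ℝ => alongSq x z q.2 := by unfold alongSq; fun_prop
  refine Measurable.ite (measurableSet_lt (h1.add h2) measurable_const) ?_ measurable_const
  have h3 := hB.continuous_extendKernel.measurable
  have h4 : Measurable fun q : ℝ × ℝ => (Real.sqrt 2 * q.1, Real.sqrt 2 * q.2) := by fun_prop
  refine Measurable.mul ?_ ((h3.comp h4).ennreal_ofReal)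
  exact (measurable_const.div ((measurable_const.sub h1).sub h2).sqrt).ennreal_ofReal

theorem IsCollisionKernel.scatter_symm {B : Vel → Vel → ℝ} {Φ : ℝ → ℝ → ℝ}
    (hB : IsCollisionKernel B Φ) {x y z : ℝ} (hx : 0 < x) (hy : 0 < y) (hz : 0 < z)
    (hst : 0 < xStar x y z) : scatter Φ x y z = scatter Φ x z y := by
  rw [scatter_eq_transfer Φ hx hy hz hst,
    scatter_eq_transfer Φ hx hz hy (by rwa [xStar_symm]),
    lintegral_lintegral_swap (hB.measurable_transferIntegrand x y z).aemeasurable]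
  congr 1
  refine setLIntegral_congr_fun measurableSet_Ioi fun t ht => ?_
  refine setLIntegral_congr_fun measurableSet_Ioi fun s hs => ?_
  have ht : (0 : ℝ) < t := ht
  have hs : (0 : ℝ) < s := hs
  simp only [transferIntegrand]
  rw [extendKernel_eq _ (by positivity) (by positivity),
    extendKernel_eq _ (by positivity) (by positivity), hB.symm _ _ (by positivity) (by positivity),
    add_comm, sub_right_comm]

/-! ### Measurability and the cases of the weight -/

theorem measurable_YStar :
    Measurable fun q : (ℝ × ℝ × ℝ) × ℝ × ℝ => YStar q.1.1 q.1.2.1 q.1.2.2 q.2.1 q.2.2 := by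
  unfold YStar
  refine Measurable.ite (measurableSet_lt measurable_const (by fun_prop)) ?_ measurable_const
  fun_prop

variable {B : Vel → Vel → ℝ} {Φ : ℝ → ℝ → ℝ} {b₀ η : ℝ}

theorem IsCollisionKernel.measurable_integrand (hB : IsCollisionKernel B Φ) :
    Measurable fun q : (ℝ × ℝ × ℝ) × ℝ × ℝ => extendKernel Φ
      (Real.sqrt 2 * q.2.1, Real.sqrt 2 * YStar q.1.1 q.1.2.1 q.1.2.2 q.2.1 q.2.2) := by
  have h1 := measurable_YStar
  exact hB.continuous_extendKernel.measurable.comp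
    ((by fun_prop : Measurable fun q : (ℝ × ℝ × ℝ) × ℝ × ℝ => Real.sqrt 2 * q.2.1).prodMk
      (h1.const_mul _))

/-- On the range of integration both arguments of `Φ` are nonnegative. -/
theorem scatter_eq_extendKernel (Φ : ℝ → ℝ → ℝ) (x y z : ℝ) :
    scatter Φ x y z = ∫⁻ s in Ioc (sMin x y z) (sMax x y z), ∫⁻ θ in Ioc 0 (2 * Real.pi),
      ENNReal.ofReal (extendKernel Φ (Real.sqrt 2 * s, Real.sqrt 2 * YStar x y z s θ)) := by
  refine setLIntegral_congr_fun measurableSet_Ioc fun s hs => ?_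
  have : 0 < s := lt_of_le_of_lt (sMin_nonneg x y z) hs.1
  refine lintegral_congr fun θ => ?_
  rw [extendKernel_eq _ (by positivity) (mul_nonneg (by positivity) (YStar_nonneg ..))]

theorem measurable_xStar : Measurable fun p : ℝ × ℝ × ℝ => xStar p.1 p.2.1 p.2.2 := by
  unfold xStar; fun_prop

theorem IsCollisionKernel.measurable_scatter (hB : IsCollisionKernel B Φ) :
    Measurable fun p : ℝ × ℝ × ℝ => scatter Φ p.1 p.2.1 p.2.2 := by
  have hx := measurable_xStar
  have hmin : Measurable fun p : ℝ × ℝ × ℝ => sMin p.1 p.2.1 p.2.2 := by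
    unfold sMin
    have h1 : Measurable fun p : ℝ × ℝ × ℝ => |Real.sqrt p.1 - Real.sqrt p.2.1| :=
      measurable_norm.comp (by fun_prop : Measurable fun p : ℝ × ℝ × ℝ =>
        Real.sqrt p.1 - Real.sqrt p.2.1)
    have h2 : Measurable fun p : ℝ × ℝ × ℝ =>
        |Real.sqrt (xStar p.1 p.2.1 p.2.2) - Real.sqrt p.2.2| :=
      measurable_norm.comp (hx.sqrt.sub (by fun_prop))
    exact h1.max h2
  have hmax : Measurable fun p : ℝ × ℝ × ℝ => sMax p.1 p.2.1 p.2.2 := by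
    unfold sMax
    exact Measurable.min (by fun_prop) (hx.sqrt.add (by fun_prop))
  have e : (fun p : ℝ × ℝ × ℝ => scatter Φ p.1 p.2.1 p.2.2) = fun p => ∫⁻ s,
      if sMin p.1 p.2.1 p.2.2 < s ∧ s ≤ sMax p.1 p.2.1 p.2.2 then
        ∫⁻ θ in Ioc 0 (2 * Real.pi), ENNReal.ofReal (extendKernel Φ
          (Real.sqrt 2 * s, Real.sqrt 2 * YStar p.1 p.2.1 p.2.2 s θ)) else 0 := by
    ext p
    rw [scatter_eq_extendKernel, ← lintegral_indicator measurableSet_Ioc]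
    simp only [indicator, mem_Ioc]
  rw [e]
  refine Measurable.lintegral_prod_right' (f := fun q : (ℝ × ℝ × ℝ) × ℝ =>
    if sMin q.1.1 q.1.2.1 q.1.2.2 < q.2 ∧ q.2 ≤ sMax q.1.1 q.1.2.1 q.1.2.2 then
        ∫⁻ θ in Ioc 0 (2 * Real.pi), ENNReal.ofReal (extendKernel Φ
          (Real.sqrt 2 * q.2, Real.sqrt 2 * YStar q.1.1 q.1.2.1 q.1.2.2 q.2 θ)) else 0) ?_
  refine Measurable.ite ?_ ?_ measurable_const
  · exact (measurableSet_lt (hmin.comp measurable_fst) measurable_snd).inter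
      (measurableSet_le measurable_snd (hmax.comp measurable_fst))
  · refine Measurable.lintegral_prod_right' (f := fun q : ((ℝ × ℝ × ℝ) × ℝ) × ℝ =>
      ENNReal.ofReal (extendKernel Φ
          (Real.sqrt 2 * q.1.2, Real.sqrt 2 * YStar q.1.1.1 q.1.1.2.1 q.1.1.2.2 q.1.2 q.2))) ?_
    exact (hB.measurable_integrand.comp (by fun_prop : Measurable
      fun q : ((ℝ × ℝ × ℝ) × ℝ) × ℝ => (q.1.1, q.1.2, q.2))).ennreal_ofReal

theorem sMin_le_sMax {x y z : ℝ} (hx : 0 ≤ x) (hy : 0 ≤ y) (hz : 0 ≤ z)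
    (hst : 0 < xStar x y z) : sMin x y z ≤ sMax x y z := by
  have hxs := xStar_of_pos hst
  have e1 := Real.sq_sqrt hx
  have e2 := Real.sq_sqrt hy
  have e3 := Real.sq_sqrt hz
  have e4 := Real.sq_sqrt hst.le
  have p1 := Real.sqrt_nonneg x
  have p2 := Real.sqrt_nonneg y
  have p3 := Real.sqrt_nonneg z
  have p4 := Real.sqrt_nonneg (xStar x y z)
  unfold sMin sMax
  rw [max_le_iff, le_min_iff, le_min_iff, abs_le, abs_le, abs_le, abs_le]
  refine ⟨⟨⟨by linarith, by linarith⟩, ⟨?_, ?_⟩⟩, ⟨⟨?_, ?_⟩, ⟨by linarith, by linarith⟩⟩⟩ <;>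
  · by_contra! h
    nlinarith

theorem sMax_sub_sMin_le {x y z : ℝ} :
    sMax x y z - sMin x y z ≤ 2 * Real.sqrt x ∧ sMax x y z - sMin x y z ≤ 2 * Real.sqrt y ∧
      sMax x y z - sMin x y z ≤ 2 * Real.sqrt z := by
  have h1 : |Real.sqrt x - Real.sqrt y| ≤ sMin x y z := le_max_left _ _
  have h2 : |Real.sqrt (xStar x y z) - Real.sqrt z| ≤ sMin x y z := le_max_right _ _
  have h3 : sMax x y z ≤ _ := min_le_left _ _
  have h4 : sMax x y z ≤ _ := min_le_right _ _
  rw [abs_le] at h1 h2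
  refine ⟨?_, ?_, ?_⟩ <;> linarith [h1.1, h1.2, h2.1, h2.2]

theorem IsCollisionKernel.scatter_toReal_eq (hB : IsCollisionKernel B Φ) {x y z : ℝ}
    (hx : 0 ≤ x) (hy : 0 ≤ y) (hz : 0 ≤ z) (hst : 0 < xStar x y z) :
    ∫ s in (sMin x y z)..(sMax x y z), ∫ θ in (0 : ℝ)..(2 * Real.pi),
      Φ (Real.sqrt 2 * s) (Real.sqrt 2 * YStar x y z s θ) = (scatter Φ x y z).toReal := by
  have hm := hB.measurable_integrand
  obtain ⟨C, hC⟩ := hB.bounded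
  set f : ℝ → ℝ → ℝ := fun s θ =>
    extendKernel Φ (Real.sqrt 2 * s, Real.sqrt 2 * YStar x y z s θ) with hf
  have hf0 : ∀ s θ, 0 ≤ f s θ := fun s θ => hB.nonneg _ _ (le_max_right _ _) (le_max_right _ _)
  have hfC : ∀ s θ, f s θ ≤ C := fun s θ => hC _ _ (le_max_right _ _) (le_max_right _ _)
  have hfm : Measurable (Function.uncurry f) :=
    hm.comp (by fun_prop : Measurable fun q : ℝ × ℝ => (((x, y, z) : ℝ × ℝ × ℝ), q.1, q.2))
  have hint : ∀ s, Integrable (f s) (volume.restrict (Ioc 0 (2 * Real.pi))) := by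
    intro s
    refine Integrable.of_bound (hfm.comp measurable_prodMk_left).aestronglyMeasurable C
      (Filter.Eventually.of_forall fun θ => ?_)
    rw [Real.norm_of_nonneg (hf0 s θ)]
    exact hfC s θ
  rw [scatter_eq_extendKernel, intervalIntegral.integral_of_le (sMin_le_sMax hx hy hz hst)]
  have h1 : ∫ s in Ioc (sMin x y z) (sMax x y z), ∫ θ in (0 : ℝ)..(2 * Real.pi),
      Φ (Real.sqrt 2 * s) (Real.sqrt 2 * YStar x y z s θ) =
      ∫ s in Ioc (sMin x y z) (sMax x y z), ∫ θ in Ioc (0 : ℝ) (2 * Real.pi), f s θ := by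
    refine setIntegral_congr_fun measurableSet_Ioc fun s hs => ?_
    have : 0 < s := lt_of_le_of_lt (sMin_nonneg x y z) hs.1
    rw [intervalIntegral.integral_of_le (by positivity)]
    refine integral_congr_ae (Filter.Eventually.of_forall fun θ => ?_)
    simp only [hf]
    rw [extendKernel_eq _ (by positivity) (mul_nonneg (by positivity) (YStar_nonneg ..))]
  rw [h1, integral_eq_lintegral_of_nonneg_ae
    (Filter.Eventually.of_forall fun s => integral_nonneg (hf0 s))
    (hfm.stronglyMeasurable.integral_prod_right').aestronglyMeasurable]
  congr 1
  refine lintegral_congr fun s => ?_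
  rw [ofReal_integral_eq_lintegral_ofReal (hint s) (Filter.Eventually.of_forall (hf0 s))]

theorem IsCollisionKernel.W_of_pos (hB : IsCollisionKernel B Φ) {x y z : ℝ}
    (hx : 0 < x) (hy : 0 < y) (hz : 0 < z) (hst : 0 < xStar x y z) :
    W Φ x y z = 1 / (4 * Real.pi * Real.sqrt (x * y * z)) * (scatter Φ x y z).toReal := by
  rw [← hB.scatter_toReal_eq hx.le hy.le hz.le hst]
  unfold W
  rw [if_pos (by positivity)]
  rfl

/-- The cases in the definition of `W` for nonnegative arguments. -/
theorem IsCollisionKernel.W_cases (hB : IsCollisionKernel B Φ) {x y z : ℝ}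
    (hx : 0 ≤ x) (hy : 0 ≤ y) (hz : 0 ≤ z) :
    (0 < x ∧ 0 < y ∧ 0 < z ∧ 0 < xStar x y z ∧
      W Φ x y z = 1 / (4 * Real.pi * Real.sqrt (x * y * z)) * (scatter Φ x y z).toReal) ∨
    (x = 0 ∧ 0 < y ∧ 0 < z ∧
      W Φ x y z = 1 / Real.sqrt (y * z) * Φ (Real.sqrt (2 * y)) (Real.sqrt (2 * z))) ∨
    (y = 0 ∧ 0 < x ∧ x < z ∧
      W Φ x y z = 1 / Real.sqrt (x * z) * Φ (Real.sqrt (2 * x)) (Real.sqrt (2 * (z - x)))) ∨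
    (z = 0 ∧ 0 < x ∧ x < y ∧
      W Φ x y z = 1 / Real.sqrt (x * y) * Φ (Real.sqrt (2 * (y - x))) (Real.sqrt (2 * x))) ∨
    (W Φ x y z = 0 ∧ ¬ (0 < x ∧ 0 < y ∧ 0 < z ∧ 0 < xStar x y z) ∧ ¬ (x = 0 ∧ 0 < y ∧ 0 < z) ∧
      ¬ (y = 0 ∧ 0 < x ∧ x < z) ∧ ¬ (z = 0 ∧ 0 < x ∧ x < y)) := by
  by_cases h1 : 0 < x ∧ 0 < y ∧ 0 < z ∧ 0 < xStar x y z
  · exact Or.inl ⟨h1.1, h1.2.1, h1.2.2.1, h1.2.2.2, hB.W_of_pos h1.1 h1.2.1 h1.2.2.1 h1.2.2.2⟩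
  right
  have hneg : ¬ 0 < xStar x y z * x * y * z := by
    intro h
    apply h1
    have hs : 0 ≤ xStar x y z := le_max_right _ _
    refine ⟨lt_of_le_of_ne hx ?_, lt_of_le_of_ne hy ?_, lt_of_le_of_ne hz ?_,
      lt_of_le_of_ne hs ?_⟩ <;>
    · intro h0
      rw [← h0] at h
      simp at h
  unfold W
  rw [if_neg hneg]
  by_cases h2 : x = 0 ∧ 0 < y ∧ 0 < z
  · exact Or.inl ⟨h2.1, h2.2.1, h2.2.2, if_pos h2⟩
  right
  rw [if_neg h2]
  by_cases h3 : y = 0 ∧ 0 < x ∧ x < z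
  · exact Or.inl ⟨h3.1, h3.2.1, h3.2.2, if_pos h3⟩
  right
  rw [if_neg h3]
  by_cases h4 : z = 0 ∧ 0 < x ∧ x < y
  · exact Or.inl ⟨h4.1, h4.2.1, h4.2.2, if_pos h4⟩
  right
  exact ⟨if_neg h4, h1, h2, h3, h4⟩

theorem IsCollisionKernel.W_nonneg (hB : IsCollisionKernel B Φ) {x y z : ℝ}
    (hx : 0 ≤ x) (hy : 0 ≤ y) (hz : 0 ≤ z) : 0 ≤ W Φ x y z := by
  have hΦ : ∀ r ρ, 0 ≤ Φ (Real.sqrt r) (Real.sqrt ρ) := fun r ρ =>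
    hB.nonneg _ _ (Real.sqrt_nonneg _) (Real.sqrt_nonneg _)
  rcases hB.W_cases hx hy hz with h | h | h | h | h
  · rw [h.2.2.2.2]; have := Real.pi_pos; positivity
  · rw [h.2.2.2]; exact mul_nonneg (by positivity) (hΦ _ _)
  · rw [h.2.2.2]; exact mul_nonneg (by positivity) (hΦ _ _)
  · rw [h.2.2.2]; exact mul_nonneg (by positivity) (hΦ _ _)
  · rw [h.1]

theorem IsCollisionKernel.W_symm (hB : IsCollisionKernel B Φ) {x y z : ℝ}
    (hx : 0 ≤ x) (hy : 0 ≤ y) (hz : 0 ≤ z) : W Φ x y z = W Φ x z y := by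
  have hs := xStar_symm x y z
  have hΦ : ∀ r ρ, Φ (Real.sqrt r) (Real.sqrt ρ) = Φ (Real.sqrt ρ) (Real.sqrt r) := fun r ρ =>
    hB.symm _ _ (Real.sqrt_nonneg _) (Real.sqrt_nonneg _)
  rcases hB.W_cases hx hy hz with h | h | h | h | h
  · rw [h.2.2.2.2, hB.W_of_pos h.1 h.2.2.1 h.2.1 (hs ▸ h.2.2.2.1),
      hB.scatter_symm h.1 h.2.1 h.2.2.1 h.2.2.2.1, mul_right_comm x]
  · obtain ⟨rfl, h1, h2, h3⟩ := h
    rw [h3, W, if_neg (by simp), if_pos ⟨rfl, h2, h1⟩, hΦ, mul_comm y]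
  · obtain ⟨rfl, h1, h2, h3⟩ := h
    rw [h3, W, if_neg (by simp), if_neg (by simp), if_neg (fun h => by linarith [h.1]),
      if_pos ⟨rfl, h1, h2⟩, hΦ]
  · obtain ⟨rfl, h1, h2, h3⟩ := h
    rw [h3, W, if_neg (by simp), if_neg (by simp), if_pos ⟨rfl, h1, h2⟩, hΦ]
  · obtain ⟨h0, h1, h2, h3, h4⟩ := h
    rcases hB.W_cases hx hz hy with h' | h' | h' | h' | h'
    · exact absurd ⟨h'.1, h'.2.2.1, h'.2.1, hs ▸ h'.2.2.2.1⟩ h1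
    · exact absurd ⟨h'.1, h'.2.2.1, h'.2.1⟩ h2
    · exact absurd ⟨h'.1, h'.2.1, h'.2.2.1⟩ h4
    · exact absurd ⟨h'.1, h'.2.1, h'.2.2.1⟩ h3
    · rw [h0, h'.1]

theorem IsCollisionKernel.measurable_W (hB : IsCollisionKernel B Φ) :
    Measurable fun p : ℝ≥0 × ℝ≥0 × ℝ≥0 => W Φ p.1 p.2.1 p.2.2 := by
  have hc : Measurable fun p : ℝ≥0 × ℝ≥0 × ℝ≥0 => ((p.1 : ℝ), (p.2.1 : ℝ), (p.2.2 : ℝ)) := by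
    fun_prop
  have hx : Measurable fun p : ℝ≥0 × ℝ≥0 × ℝ≥0 => xStar p.1 p.2.1 p.2.2 := measurable_xStar.comp hc
  have hsc : Measurable fun p : ℝ≥0 × ℝ≥0 × ℝ≥0 => scatter Φ p.1 p.2.1 p.2.2 :=
    hB.measurable_scatter.comp hc
  have hΦ : ∀ {f g : ℝ≥0 × ℝ≥0 × ℝ≥0 → ℝ}, Measurable f → Measurable g →
      Measurable fun p => Φ (Real.sqrt (f p)) (Real.sqrt (g p)) := by
    intro f g hf hg
    have : (fun p => Φ (Real.sqrt (f p)) (Real.sqrt (g p))) =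
        fun p => extendKernel Φ (Real.sqrt (f p), Real.sqrt (g p)) := by
      ext p; rw [extendKernel_eq _ (Real.sqrt_nonneg _) (Real.sqrt_nonneg _)]
    rw [this]
    exact hB.continuous_extendKernel.measurable.comp (hf.sqrt.prodMk hg.sqrt)
  have e : (fun p : ℝ≥0 × ℝ≥0 × ℝ≥0 => W Φ p.1 p.2.1 p.2.2) = fun p =>
      if 0 < xStar p.1 p.2.1 p.2.2 * p.1 * p.2.1 * p.2.2 then
        1 / (4 * Real.pi * Real.sqrt ((p.1 : ℝ) * p.2.1 * p.2.2)) *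
          (scatter Φ p.1 p.2.1 p.2.2).toReal
      else if (p.1 : ℝ) = 0 ∧ (0 : ℝ) < p.2.1 ∧ (0 : ℝ) < p.2.2 then
        1 / Real.sqrt ((p.2.1 : ℝ) * p.2.2) * Φ (Real.sqrt (2 * p.2.1)) (Real.sqrt (2 * p.2.2))
      else if (p.2.1 : ℝ) = 0 ∧ (0 : ℝ) < p.1 ∧ (p.1 : ℝ) < p.2.2 then
        1 / Real.sqrt ((p.1 : ℝ) * p.2.2) * Φ (Real.sqrt (2 * p.1)) (Real.sqrt (2 * (p.2.2 - p.1)))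
      else if (p.2.2 : ℝ) = 0 ∧ (0 : ℝ) < p.1 ∧ (p.1 : ℝ) < p.2.1 then
        1 / Real.sqrt ((p.1 : ℝ) * p.2.1) * Φ (Real.sqrt (2 * (p.2.1 - p.1))) (Real.sqrt (2 * p.1))
      else 0 := by
    ext p
    by_cases h : 0 < xStar p.1 p.2.1 p.2.2 * p.1 * p.2.1 * p.2.2
    · rw [if_pos h]
      have hp : ∀ u : ℝ≥0, (u : ℝ) ≠ 0 → (0 : ℝ) < u := fun u hu => lt_of_le_of_ne u.2 hu.symm
      have h4 := right_ne_zero_of_mul h.ne'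
      have h3 := right_ne_zero_of_mul (left_ne_zero_of_mul h.ne')
      have h2 := right_ne_zero_of_mul (left_ne_zero_of_mul (left_ne_zero_of_mul h.ne'))
      have h1 := left_ne_zero_of_mul (left_ne_zero_of_mul (left_ne_zero_of_mul h.ne'))
      exact hB.W_of_pos (hp _ h2) (hp _ h3) (hp _ h4)
        (lt_of_le_of_ne (le_max_right _ _) (Ne.symm h1))
    · rw [if_neg h]
      unfold W
      rw [if_neg h]
  rw [e]
  have m1 : Measurable fun p : ℝ≥0 × ℝ≥0 × ℝ≥0 => (p.1 : ℝ) := by fun_prop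
  have m2 : Measurable fun p : ℝ≥0 × ℝ≥0 × ℝ≥0 => (p.2.1 : ℝ) := by fun_prop
  have m3 : Measurable fun p : ℝ≥0 × ℝ≥0 × ℝ≥0 => (p.2.2 : ℝ) := by fun_prop
  have mc : ∀ c : ℝ, Measurable fun _ : ℝ≥0 × ℝ≥0 × ℝ≥0 => c := fun c => measurable_const
  refine Measurable.ite (measurableSet_lt (mc 0) (((hx.mul m1).mul m2).mul m3)) ?_
    (Measurable.ite ?_ ?_ (Measurable.ite ?_ ?_ (Measurable.ite ?_ ?_ (mc 0))))
  · exact ((mc 1).div (((m1.mul m2).mul m3).sqrt.const_mul _)).mul hsc.ennreal_toReal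
  · exact (measurableSet_eq_fun m1 (mc 0)).inter
      ((measurableSet_lt (mc 0) m2).inter (measurableSet_lt (mc 0) m3))
  · exact ((mc 1).div (m2.mul m3).sqrt).mul (hΦ (m2.const_mul 2) (m3.const_mul 2))
  · exact (measurableSet_eq_fun m2 (mc 0)).inter
      ((measurableSet_lt (mc 0) m1).inter (measurableSet_lt m1 m3))
  · exact ((mc 1).div (m1.mul m3).sqrt).mul (hΦ (m1.const_mul 2) ((m3.sub m1).const_mul 2))
  · exact (measurableSet_eq_fun m3 (mc 0)).inter
      ((measurableSet_lt (mc 0) m1).inter (measurableSet_lt m1 m2))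
  · exact ((mc 1).div (m1.mul m2).sqrt).mul (hΦ ((m2.sub m1).const_mul 2) (m1.const_mul 2))

/-! ### Bounds for the weight -/

theorem KernelAssumption.scatter_le (hB : KernelAssumption B Φ b₀ η) (x y z : ℝ) :
    scatter Φ x y z ≤ ENNReal.ofReal (2 * Real.pi * (sMax x y z - sMin x y z)) := by
  have hpi := Real.pi_pos
  unfold scatter
  calc _ ≤ ∫⁻ _ in Ioc (sMin x y z) (sMax x y z), ∫⁻ _ in Ioc 0 (2 * Real.pi), 1 := by
        refine setLIntegral_mono' measurableSet_Ioc fun s hs => lintegral_mono fun θ => ?_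
        have : 0 < s := lt_of_le_of_lt (sMin_nonneg x y z) hs.1
        rw [ENNReal.ofReal_le_one]
        exact hB.upper _ _ (by positivity) (mul_nonneg (by positivity) (YStar_nonneg ..))
    _ = _ := by
        simp only [lintegral_const, one_mul, Measure.restrict_apply_univ, Real.volume_Ioc, sub_zero]
        rw [← ENNReal.ofReal_mul (by positivity)]

theorem KernelAssumption.W_mul_sqrt_le (hB : KernelAssumption B Φ b₀ η) {x y z : ℝ}
    (hx : 0 ≤ x) (hy : 0 ≤ y) (hz : 0 ≤ z) :
    W Φ x y z * (Real.sqrt y * Real.sqrt z) ≤ 1 ∧ W Φ x y z * (Real.sqrt x * Real.sqrt z) ≤ 1 ∧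
      W Φ x y z * (Real.sqrt x * Real.sqrt y) ≤ 1 := by
  have hup : ∀ r ρ, Φ (Real.sqrt r) (Real.sqrt ρ) ≤ 1 := fun r ρ =>
    hB.upper _ _ (Real.sqrt_nonneg _) (Real.sqrt_nonneg _)
  have one : ∀ u v k : ℝ, 0 < u → 0 < v → k ≤ 1 →
      1 / Real.sqrt (u * v) * k * (Real.sqrt u * Real.sqrt v) ≤ 1 := by
    intro u v k hu hv hk
    rw [Real.sqrt_mul hu.le]
    have h1 := Real.sqrt_pos.2 hu
    have h2 := Real.sqrt_pos.2 hv
    have : 1 / (Real.sqrt u * Real.sqrt v) * k * (Real.sqrt u * Real.sqrt v) = k := by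
      field_simp
    linarith
  rcases hB.W_cases hx hy hz with h | h | h | h | h
  · obtain ⟨hx, hy, hz, hst, hW⟩ := h
    have hpi := Real.pi_pos
    have h1 := Real.sqrt_pos.2 hx
    have h2 := Real.sqrt_pos.2 hy
    have h3 := Real.sqrt_pos.2 hz
    have hs : (scatter Φ x y z).toReal ≤ 2 * Real.pi * (sMax x y z - sMin x y z) :=
      ENNReal.toReal_le_of_le_ofReal
        (mul_nonneg (by positivity) (sub_nonneg.2 (sMin_le_sMax hx.le hy.le hz.le hst)))
        (hB.scatter_le x y z)
    obtain ⟨k1, k2, k3⟩ := sMax_sub_sMin_le (x := x) (y := y) (z := z)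
    rw [hW, Real.sqrt_mul (by positivity), Real.sqrt_mul (by positivity)]
    have key : ∀ u v w : ℝ, 0 < u → 0 < v → 0 < w → sMax x y z - sMin x y z ≤ 2 * u →
        1 / (4 * Real.pi * (u * v * w)) * (scatter Φ x y z).toReal * (v * w) ≤ 1 := by
      intro u v w hu hv hw hk
      have : 1 / (4 * Real.pi * (u * v * w)) * (scatter Φ x y z).toReal * (v * w) =
        (scatter Φ x y z).toReal / (4 * Real.pi * u) := by field_simp
      rw [this, div_le_one (by positivity)]
      nlinarith
    refine ⟨key _ _ _ h1 h2 h3 k1, ?_, ?_⟩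
    · rw [mul_comm (Real.sqrt x) (Real.sqrt y)]
      exact key _ _ _ h2 h1 h3 k2
    · rw [show Real.sqrt x * Real.sqrt y * Real.sqrt z = Real.sqrt z * Real.sqrt x * Real.sqrt y by
        ring]
      exact key _ _ _ h3 h1 h2 k3
  · obtain ⟨rfl, h1, h2, h3⟩ := h
    rw [h3]
    refine ⟨one _ _ _ h1 h2 (hup _ _), by simp, by simp⟩
  · obtain ⟨rfl, h1, h2, h3⟩ := h
    rw [h3]
    refine ⟨by simp, one _ _ _ h1 (h1.trans h2) (hup _ _), by simp⟩
  · obtain ⟨rfl, h1, h2, h3⟩ := h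
    rw [h3]
    refine ⟨by simp, by simp, one _ _ _ h1 (h1.trans h2) (hup _ _)⟩
  · rw [h.1]; simp

theorem KernelAssumption.scatter_ne_top (hB : KernelAssumption B Φ b₀ η) (x y z : ℝ) :
    scatter Φ x y z ≠ ⊤ := ne_top_of_le_ne_top ENNReal.ofReal_ne_top (hB.scatter_le x y z)

/-- For ordered energies the range of the first momentum transfer depends only on the two least ones
and does not change when these are exchanged. -/
theorem sMin_sMax_of_le {a b c : ℝ} (ha : 0 ≤ a) (hab : a ≤ b) (hbc : b ≤ c) :
    sMin a b c = Real.sqrt b - Real.sqrt a ∧ sMax a b c = Real.sqrt b + Real.sqrt a ∧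
    sMin b a c = Real.sqrt b - Real.sqrt a ∧ sMax b a c = Real.sqrt b + Real.sqrt a := by
  have hb := ha.trans hab
  have hc := hb.trans hbc
  have e1 : xStar a b c = b + c - a := by unfold xStar; exact max_eq_left (by linarith)
  have e2 : xStar b a c = a + c - b := by unfold xStar; exact max_eq_left (by linarith)
  have hA := Real.sqrt_nonneg a
  have hAB := Real.sqrt_le_sqrt hab
  have hBC := Real.sqrt_le_sqrt hbc
  have sa := Real.sq_sqrt ha
  have sb := Real.sq_sqrt hb
  have sc := Real.sq_sqrt hc
  have k1 : Real.sqrt b ≤ Real.sqrt (b + c - a) := Real.sqrt_le_sqrt (by linarith)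
  have k1' : Real.sqrt c ≤ Real.sqrt (b + c - a) := Real.sqrt_le_sqrt (by linarith)
  have k2 : Real.sqrt a ≤ Real.sqrt (a + c - b) := Real.sqrt_le_sqrt (by linarith)
  have k2' : Real.sqrt (a + c - b) ≤ Real.sqrt c := Real.sqrt_le_sqrt (by linarith)
  have k3 : Real.sqrt (b + c - a) ≤ Real.sqrt c + Real.sqrt b - Real.sqrt a := by
    rw [Real.sqrt_le_iff]
    refine ⟨by linarith, ?_⟩
    nlinarith [mul_nonneg (sub_nonneg.2 (hAB.trans hBC)) (sub_nonneg.2 hAB)]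
  have k4 : Real.sqrt c - Real.sqrt b + Real.sqrt a ≤ Real.sqrt (a + c - b) := by
    refine Real.le_sqrt_of_sq_le ?_
    nlinarith [mul_nonneg (sub_nonneg.2 hBC) (sub_nonneg.2 hAB)]
  unfold sMin sMax
  rw [e1, e2, abs_sub_comm (Real.sqrt a), abs_of_nonneg (sub_nonneg.2 hAB),
    abs_of_nonneg (sub_nonneg.2 k1'), abs_of_nonpos (sub_nonpos.2 k2')]
  refine ⟨max_eq_left (by linarith), ?_, max_eq_left (by linarith), min_eq_left (by linarith)⟩
  rw [add_comm]
  exact min_eq_left (by linarith)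

/-- For `a ≤ b ≤ c` exchanging `b` and `a` in the first two arguments lengthens the second momentum
transfer and keeps the range of the first. -/
theorem YStar_le_YStar {a b c s θ : ℝ} (hab : a ≤ b) (hbc : b ≤ c) :
    YStar b a c s θ ≤ YStar a b c s θ := by
  by_cases hs : 0 < s
  swap
  · unfold YStar; rw [if_neg hs, if_neg hs]
  have e : b - alongSq b a s = a - alongSq a b s := by
    unfold alongSq; field_simp; ring
  rw [YStar_eq hs, YStar_eq hs, e]
  have h1 : c - alongSq b a s ≤ c - alongSq a b s := by linarith
  have h2 : a - alongSq a b s ≤ c - alongSq b a s := by linarith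
  refine Real.sqrt_le_sqrt ?_
  have k1 := Real.sqrt_le_sqrt (max_le_max_right 0 h1)
  have k2 := Real.sqrt_le_sqrt (max_le_max_right 0 h2)
  have k3 := Real.sqrt_nonneg (max (a - alongSq a b s) 0)
  revert k1 k2 k3
  generalize Real.sqrt (max (a - alongSq a b s) 0) = u
  generalize Real.sqrt (max (c - alongSq b a s) 0) = v
  generalize Real.sqrt (max (c - alongSq a b s) 0) = w
  intro k1 k2 k3
  have hcos := Real.neg_one_le_cos θ
  have : 0 ≤ (w - v) * (w + v + 2 * u * Real.cos θ) :=
    mul_nonneg (by linarith) (by nlinarith)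
  nlinarith

/-- The least energy as first argument gives a larger weight than the middle one. -/
theorem KernelAssumption.W_swap_le (hB : KernelAssumption B Φ b₀ η) {a b c : ℝ}
    (ha : 0 ≤ a) (hab : a ≤ b) (hbc : b ≤ c) : W Φ b a c ≤ W Φ a b c := by
  rcases hab.eq_or_lt with rfl | hab'
  · exact le_rfl
  have hb : 0 < b := lt_of_le_of_lt ha hab'
  have hc : 0 < c := hb.trans_le hbc
  rcases ha.eq_or_lt with rfl | ha'
  · rcases hbc.eq_or_lt with rfl | hbc'
    · have : W Φ b 0 b = 0 := by simp [W, hb.ne']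
      rw [this]
      exact hB.W_nonneg le_rfl hb.le hb.le
    · have h1 : W Φ b 0 c =
          1 / Real.sqrt (b * c) * Φ (Real.sqrt (2 * b)) (Real.sqrt (2 * (c - b))) := by
        simp [W, hb, hb.ne', hbc']
      have h2 : W Φ 0 b c = 1 / Real.sqrt (b * c) * Φ (Real.sqrt (2 * b)) (Real.sqrt (2 * c)) := by
        simp [W, hb, hc]
      rw [h1, h2]
      refine mul_le_mul_of_nonneg_left ?_ (by positivity)
      exact hB.mono _ _ _ (Real.sqrt_nonneg _) (Real.sqrt_nonneg _)
        (Real.sqrt_le_sqrt (by linarith))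
  · rw [hB.W_of_pos hb ha' hc (lt_max_of_lt_left (by linarith)),
      hB.W_of_pos ha' hb hc (lt_max_of_lt_left (by linarith)), mul_comm b a]
    have hpi := Real.pi_pos
    refine mul_le_mul_of_nonneg_left ?_ (by positivity)
    refine ENNReal.toReal_mono (hB.scatter_ne_top _ _ _) ?_
    obtain ⟨e1, e2, e3, e4⟩ := sMin_sMax_of_le ha hab hbc
    unfold scatter
    rw [e1, e2, e3, e4]
    refine setLIntegral_mono' measurableSet_Ioc fun s hs => lintegral_mono fun θ => ?_
    have hs' : 0 < s := lt_of_le_of_lt (sub_nonneg.2 (Real.sqrt_le_sqrt hab)) hs.1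
    refine ENNReal.ofReal_le_ofReal (hB.mono _ _ _ (by positivity)
      (mul_nonneg (by positivity) (YStar_nonneg ..)) ?_)
    exact mul_le_mul_of_nonneg_left (YStar_le_YStar hab hbc) (by positivity)

/-- The lower bound for `Φ` at the least admissible momentum transfer `√2 (√b - √a)`. -/
theorem KernelAssumption.le_W (hB : KernelAssumption B Φ b₀ η) {a b c : ℝ}
    (ha : 0 ≤ a) (hab : a ≤ b) (hbc : b ≤ c) (hb : 0 < b) :
    b₀ * min 1 ((2 * (Real.sqrt b - Real.sqrt a) ^ 2) ^ η) / Real.sqrt (b * c) ≤ W Φ a b c := by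
  have hc : 0 < c := hb.trans_le hbc
  have hlow : ∀ r ρ, 0 ≤ r → 0 ≤ ρ → Real.sqrt 2 * (Real.sqrt b - Real.sqrt a) ≤ r →
      b₀ * min 1 ((2 * (Real.sqrt b - Real.sqrt a) ^ 2) ^ η) ≤ Φ r ρ := by
    intro r ρ hr hρ h
    refine le_trans (mul_le_mul_of_nonneg_left (min_le_min le_rfl ?_) hB.b₀_pos.le)
      (hB.lower r ρ hr hρ)
    refine Real.rpow_le_rpow (by positivity) ?_ hB.η_nonneg
    have h0 : 0 ≤ Real.sqrt 2 * (Real.sqrt b - Real.sqrt a) :=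
      mul_nonneg (by positivity) (sub_nonneg.2 (Real.sqrt_le_sqrt hab))
    have := pow_le_pow_left₀ h0 h 2
    rw [mul_pow, Real.sq_sqrt (by norm_num)] at this
    nlinarith [sq_nonneg ρ]
  rcases ha.eq_or_lt with rfl | ha'
  · have h2 : W Φ 0 b c = 1 / Real.sqrt (b * c) * Φ (Real.sqrt (2 * b)) (Real.sqrt (2 * c)) := by
      simp [W, hb, hc]
    rw [h2, div_eq_inv_mul, one_div]
    refine mul_le_mul_of_nonneg_left ?_ (by positivity)
    refine hlow _ _ (Real.sqrt_nonneg _) (Real.sqrt_nonneg _) ?_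
    rw [Real.sqrt_zero, sub_zero, Real.sqrt_mul (by norm_num)]
  · rw [hB.W_of_pos ha' hb hc (lt_max_of_lt_left (by linarith))]
    obtain ⟨e1, e2, -, -⟩ := sMin_sMax_of_le ha hab hbc
    have hpi := Real.pi_pos
    have hsa := Real.sqrt_pos.2 ha'
    set k := b₀ * min 1 ((2 * (Real.sqrt b - Real.sqrt a) ^ 2) ^ η) with hk
    have hk0 : 0 ≤ k := mul_nonneg hB.b₀_pos.le (by positivity)
    have h1 : ENNReal.ofReal (k * (4 * Real.pi * Real.sqrt a)) ≤ scatter Φ a b c := by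
      unfold scatter
      rw [e1, e2]
      calc _ = ∫⁻ _ in Ioc (Real.sqrt b - Real.sqrt a) (Real.sqrt b + Real.sqrt a),
            ∫⁻ _ in Ioc 0 (2 * Real.pi), ENNReal.ofReal k := by
            simp only [lintegral_const, Measure.restrict_apply_univ, Real.volume_Ioc, sub_zero]
            rw [← ENNReal.ofReal_mul hk0, ← ENNReal.ofReal_mul (by positivity)]
            congr 1; ring
        _ ≤ _ := by
            refine setLIntegral_mono' measurableSet_Ioc fun s hs => lintegral_mono fun θ => ?_
            have hs' : 0 < s := lt_of_le_of_lt (sub_nonneg.2 (Real.sqrt_le_sqrt hab)) hs.1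
            refine ENNReal.ofReal_le_ofReal (hlow _ _ (by positivity)
              (mul_nonneg (by positivity) (YStar_nonneg ..)) ?_)
            exact mul_le_mul_of_nonneg_left hs.1.le (by positivity)
    have h2 := (ENNReal.ofReal_le_iff_le_toReal (hB.scatter_ne_top _ _ _)).1 h1
    rw [mul_assoc a, Real.sqrt_mul ha]
    have hbc' := Real.sqrt_pos.2 (mul_pos hb hc)
    calc k / Real.sqrt (b * c) = 1 / (4 * Real.pi * (Real.sqrt a * Real.sqrt (b * c))) *
          (k * (4 * Real.pi * Real.sqrt a)) := by field_simp
      _ ≤ _ := mul_le_mul_of_nonneg_left h2 (by positivity)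

/-! ### Truncated cubics, convexity, and positivity of the cubic collision term -/

theorem hasDerivAt_max_zero_pow (n : ℕ) (x : ℝ) :
    HasDerivAt (fun x : ℝ => max x 0 ^ (n + 2)) ((n + 2) * max x 0 ^ (n + 1)) x := by
  have hl : ∀ x : ℝ, x ≤ 0 → HasDerivWithinAt (fun x : ℝ => max x 0 ^ (n + 2))
      ((n + 2) * max x 0 ^ (n + 1)) (Iic 0) x := by
    intro x hx
    have : HasDerivWithinAt (fun _ : ℝ => (0 : ℝ)) 0 (Iic 0) x := hasDerivWithinAt_const _ _ _
    rw [max_eq_right hx]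
    simp only [ne_eq, Nat.add_eq_zero_iff, one_ne_zero, and_false, not_false_eq_true, zero_pow,
      mul_zero]
    refine this.congr (fun y hy => ?_) ?_
    · rw [max_eq_right hy]; simp
    · rw [max_eq_right hx]; simp
  have hr : ∀ x : ℝ, 0 ≤ x → HasDerivWithinAt (fun x : ℝ => max x 0 ^ (n + 2))
      ((n + 2) * max x 0 ^ (n + 1)) (Ici 0) x := by
    intro x hx
    have := (hasDerivAt_pow (n + 2) x).hasDerivWithinAt (s := Ici 0)
    rw [max_eq_left hx]
    push_cast at this
    exact this.congr (fun y hy => by rw [max_eq_left hy]) (by rw [max_eq_left hx])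
  rcases lt_trichotomy x 0 with h | h | h
  · exact (hl x h.le).hasDerivAt (Iic_mem_nhds h)
  · have := (hl x h.le).union (hr x h.ge)
    rwa [Iic_union_Ici, hasDerivWithinAt_univ] at this
  · exact (hr x h.le).hasDerivAt (Ici_mem_nhds h)

theorem contDiff_max_zero_cube : ContDiff ℝ 2 fun x : ℝ => max x 0 ^ 3 := by
  rw [show (2 : WithTop ℕ∞) = 1 + 1 from rfl, contDiff_succ_iff_deriv]
  have h1 : ∀ x : ℝ, HasDerivAt (fun x : ℝ => max x 0 ^ 3) (3 * max x 0 ^ 2) x := by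
    intro x
    have := hasDerivAt_max_zero_pow 1 x
    norm_num at this
    exact this
  have h2 : ∀ x : ℝ, HasDerivAt (fun x : ℝ => max x 0 ^ 2) (2 * max x 0) x := by
    intro x
    have := hasDerivAt_max_zero_pow 0 x
    norm_num at this
    exact this
  refine ⟨fun x => (h1 x).differentiableAt, by simp, ?_⟩
  have e1 : deriv (fun x : ℝ => max x 0 ^ 3) = fun x => 3 * max x 0 ^ 2 :=
    funext fun x => (h1 x).deriv
  rw [e1, contDiff_one_iff_deriv]
  have e2 : deriv (fun x : ℝ => 3 * max x 0 ^ 2) = fun x => 3 * (2 * max x 0) :=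
    funext fun x => ((h2 x).const_mul 3).deriv
  refine ⟨fun x => ((h2 x).const_mul 3).differentiableAt, ?_⟩
  rw [e2]
  fun_prop

theorem isTestFunction_of_contDiff {φ : ℝ → ℝ} (hφ : ContDiff ℝ 2 φ) {R : ℝ}
    (hR : ∀ x, R ≤ x → φ x = 0) : IsTestFunction φ := by
  refine ⟨hφ.contDiffOn, fun k hk => ?_⟩
  have hcont : ContinuousOn (iteratedDerivWithin k φ (Ici 0)) (Ici 0) :=
    hφ.contDiffOn.continuousOn_iteratedDerivWithin (by exact_mod_cast hk) (uniqueDiffOn_Ici 0)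
  obtain ⟨C, hC⟩ := (isCompact_Icc (a := (0 : ℝ)) (b := R)).exists_bound_of_continuousOn
    (hcont.mono Icc_subset_Ici_self)
  refine ⟨max C 0, fun x hx => ?_⟩
  by_cases h : x ≤ R
  · exact le_max_of_le_left (hC x ⟨hx, h⟩)
  · have h' : φ =ᶠ[nhdsWithin x (Ici 0)] fun _ => 0 := by
      refine Filter.Eventually.filter_mono nhdsWithin_le_nhds ?_
      filter_upwards [Ioi_mem_nhds (not_le.1 h)] with y hy using hR y (le_of_lt hy)
    rw [h'.iteratedDerivWithin_eq (hR x (not_le.1 h).le), iteratedDerivWithin_const]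
    simp

/-- The truncated cubic `(1 - x/ε)₊³`: a decreasing convex test function supported in `[0, ε]`,
equal to `1` at the origin. -/
def cap (ε x : ℝ) : ℝ := max (1 - x / ε) 0 ^ 3

theorem cap_nonneg (ε x : ℝ) : 0 ≤ cap ε x := pow_nonneg (le_max_right _ _) 3

theorem cap_zero (ε : ℝ) : cap ε 0 = 1 := by simp [cap]

theorem cap_eq_zero {ε x : ℝ} (hε : 0 < ε) (hx : ε ≤ x) : cap ε x = 0 := by
  have : 1 - x / ε ≤ 0 := by
    rw [sub_nonpos, le_div_iff₀ hε]; linarith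
  simp [cap, max_eq_right this]

theorem cap_anti {ε x y : ℝ} (hε : 0 < ε) (hxy : x ≤ y) : cap ε y ≤ cap ε x := by
  unfold cap
  gcongr

theorem cap_le_one {ε x : ℝ} (hε : 0 < ε) (hx : 0 ≤ x) : cap ε x ≤ 1 := by
  rw [← cap_zero ε]; exact cap_anti hε hx

theorem continuous_cap (ε : ℝ) : Continuous (cap ε) := by unfold cap; fun_prop

theorem isTestFunction_cap {ε : ℝ} (hε : 0 < ε) : IsTestFunction (cap ε) := by
  refine isTestFunction_of_contDiff (R := ε) ?_ fun x hx => cap_eq_zero hε hx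
  exact contDiff_max_zero_cube.comp (by fun_prop : ContDiff ℝ 2 fun x : ℝ => 1 - x / ε)

theorem convexOn_cap (ε : ℝ) : ConvexOn ℝ (Ici 0) (cap ε) := by
  have h : ConvexOn ℝ (Ici (0 : ℝ)) fun x : ℝ => 1 - x / ε := by
    refine ⟨convex_Ici 0, fun x _ y _ a b _ _ hab => le_of_eq ?_⟩
    simp only [smul_eq_mul]
    linear_combination (1 : ℝ) * (-hab)
  have h2 : ConvexOn ℝ (Ici (0 : ℝ)) fun x : ℝ => max (1 - x / ε) 0 :=
    h.sup (convexOn_const 0 (convex_Ici 0))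
  exact h2.pow (fun x _ => le_max_right _ _) 3

theorem hasDerivAt_cap {ε : ℝ} (x : ℝ) :
    HasDerivAt (cap ε) (-(3 / ε) * max (1 - x / ε) 0 ^ 2) x := by
  have h1 : HasDerivAt (fun x : ℝ => 1 - x / ε) (-(1 / ε)) x :=
    ((hasDerivAt_id x).div_const ε).const_sub 1
  have h2 := (hasDerivAt_max_zero_pow 1 (1 - x / ε)).comp x h1
  refine h2.congr_deriv ?_
  norm_num
  ring

/-- The second derivative of `cap ε` on `[0, ∞)` is at most `6 / ε²`. -/
theorem convexOn_sq_sub_cap {ε : ℝ} (hε : 0 < ε) :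
    ConvexOn ℝ (Ici 0) fun x => 6 / ε ^ 2 / 2 * x ^ 2 - cap ε x := by
  have h1 : ∀ x : ℝ, HasDerivAt (fun x => 6 / ε ^ 2 / 2 * x ^ 2 - cap ε x)
      (6 / ε ^ 2 * x + 3 / ε * max (1 - x / ε) 0 ^ 2) x := by
    intro x
    refine (((hasDerivAt_pow 2 x).const_mul _).sub (hasDerivAt_cap x)).congr_deriv ?_
    norm_num
    ring
  have h2 : ∀ x : ℝ, HasDerivAt (fun x => 6 / ε ^ 2 * x + 3 / ε * max (1 - x / ε) 0 ^ 2)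
      (6 / ε ^ 2 * (1 - max (1 - x / ε) 0)) x := by
    intro x
    have k1 : HasDerivAt (fun x : ℝ => 1 - x / ε) (-(1 / ε)) x :=
      ((hasDerivAt_id x).div_const ε).const_sub 1
    have k2 := ((hasDerivAt_max_zero_pow 0 (1 - x / ε)).comp x k1).const_mul (3 / ε)
    refine (((hasDerivAt_id x).const_mul (6 / ε ^ 2)).add k2).congr_deriv ?_
    norm_num
    field_simp
    ring
  have e1 := funext fun x => (h1 x).deriv
  have e2 := funext fun x => (h2 x).deriv
  refine convexOn_of_deriv2_nonneg' (convex_Ici 0)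
    (fun x _ => (h1 x).differentiableAt.differentiableWithinAt) ?_ fun x hx => ?_
  · rw [e1]
    exact fun x _ => (h2 x).differentiableAt.differentiableWithinAt
  · simp only [Function.iterate_succ, Function.iterate_zero, Function.comp_apply, id_eq]
    rw [e1, e2]
    have hx : (0 : ℝ) ≤ x := hx
    refine mul_nonneg (by positivity) (sub_nonneg.2 (max_le ?_ zero_le_one))
    linarith [div_nonneg hx hε.le]

theorem convexOn_add_le_add {s : Set ℝ} {f : ℝ → ℝ} (hf : ConvexOn ℝ s f) {p q u v : ℝ}
    (hp : p ∈ s) (hq : q ∈ s) (hpu : p ≤ u) (huq : u ≤ q) (h : u + v = p + q) :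
    f u + f v ≤ f p + f q := by
  rcases (hpu.trans huq).eq_or_lt with rfl | hpq
  · obtain rfl : p = u := le_antisymm hpu huq
    obtain rfl : p = v := by linarith
    exact le_rfl
  have hd : 0 < q - p := sub_pos.2 hpq
  have a0 : 0 ≤ (q - u) / (q - p) := div_nonneg (by linarith) hd.le
  have b0 : 0 ≤ (u - p) / (q - p) := div_nonneg (by linarith) hd.le
  have ab : (q - u) / (q - p) + (u - p) / (q - p) = 1 := by field_simp; ring
  have k1 := hf.2 hp hq a0 b0 ab
  have k2 := hf.2 hp hq b0 a0 (by rw [add_comm]; exact ab)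
  simp only [smul_eq_mul] at k1 k2
  have e1 : (q - u) / (q - p) * p + (u - p) / (q - p) * q = u := by field_simp; ring
  have e2 : (u - p) / (q - p) * p + (q - u) / (q - p) * q = v := by
    obtain rfl : v = p + q - u := by linarith
    field_simp; ring
  rw [e1] at k1
  rw [e2] at k2
  linear_combination k1 + k2 + (f p + f q) * ab

theorem xStar_of_le {x y z : ℝ} (h : x ≤ y + z) : xStar x y z = y + z - x :=
  max_eq_left (by linarith)

theorem Delta_nonneg_of_convex {f : ℝ → ℝ} (hf : ConvexOn ℝ (Ici 0) f) {x y z : ℝ}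
    (hx : 0 ≤ x) (h : x ≤ y + z) (hout : 0 ≤ (x - y) * (x - z)) :
    0 ≤ Delta f x y z := by
  unfold Delta
  rw [xStar_of_le h]
  have hs : (0 : ℝ) ≤ y + z - x := by linarith
  rcases mul_nonneg_iff.1 hout with ⟨h1, h2⟩ | ⟨h1, h2⟩
  · have := convexOn_add_le_add hf (p := y + z - x) (q := x) (u := y) (v := z) hs hx
      (by linarith) (by linarith) (by ring)
    linarith
  · have := convexOn_add_le_add hf (p := x) (q := y + z - x) (u := y) (v := z) hx hs
      (by linarith) (by linarith) (by ring)
    linarith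

theorem Delta_nonpos_of_convex {f : ℝ → ℝ} (hf : ConvexOn ℝ (Ici 0) f) {x y z : ℝ}
    (hy : 0 ≤ y) (hz : 0 ≤ z) (hin : (x - y) * (x - z) ≤ 0) :
    x ≤ y + z ∧ Delta f x y z ≤ 0 := by
  have h : x ≤ y + z := by nlinarith
  refine ⟨h, ?_⟩
  unfold Delta
  rw [xStar_of_le h]
  rcases mul_nonpos_iff.1 hin with ⟨h1, h2⟩ | ⟨h1, h2⟩
  · have := convexOn_add_le_add hf (p := y) (q := z) (u := x) (v := y + z - x) hy hz
      (by linarith) (by linarith) (by ring)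
    linarith
  · have := convexOn_add_le_add hf (p := z) (q := y) (u := x) (v := y + z - x) hz hy
      (by linarith) (by linarith) (by ring)
    linarith

/-- Both `cap ε` and `3x²/ε² - cap ε` are convex, and `Delta` of `x²` is `2(x - y)(x - z)`. -/
theorem abs_Delta_cap_le {ε x y z : ℝ} (hε : 0 < ε) (hx : 0 ≤ x) (hy : 0 ≤ y) (hz : 0 ≤ z)
    (h : x ≤ y + z) : |Delta (cap ε) x y z| ≤ 6 / ε ^ 2 * |(x - y) * (x - z)| := by
  have hc := convexOn_cap ε
  have hs := convexOn_sq_sub_cap hε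
  have e : Delta (fun x => 6 / ε ^ 2 / 2 * x ^ 2 - cap ε x) x y z =
      6 / ε ^ 2 * ((x - y) * (x - z)) - Delta (cap ε) x y z := by
    unfold Delta
    rw [xStar_of_le h]
    ring
  rcases le_total 0 ((x - y) * (x - z)) with h0 | h0
  · have k1 := Delta_nonneg_of_convex hc hx h h0
    have k2 := Delta_nonneg_of_convex hs hx h h0
    rw [e] at k2
    rw [abs_of_nonneg k1, abs_of_nonneg h0]
    linarith
  · have k1 := (Delta_nonpos_of_convex hc hy hz h0).2
    have k2 := (Delta_nonpos_of_convex hs hy hz h0).2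
    rw [e] at k2
    rw [abs_of_nonpos k1, abs_of_nonpos h0]
    linarith

theorem IsCollisionKernel.le_add_of_W_ne_zero (hB : IsCollisionKernel B Φ) {x y z : ℝ}
    (hx : 0 ≤ x) (hy : 0 ≤ y) (hz : 0 ≤ z) (h : W Φ x y z ≠ 0) : x ≤ y + z := by
  rcases hB.W_cases hx hy hz with h' | h' | h' | h' | h'
  · rcases lt_max_iff.1 h'.2.2.2.1 with h | h
    · linarith
    · exact absurd h (lt_irrefl _)
  all_goals try linarith [h'.1, h'.2.1, h'.2.2.1]
  exact absurd h'.1 h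

theorem IsCollisionKernel.opK_nonneg (hB : IsCollisionKernel B Φ) {f : ℝ → ℝ}
    (hf : ConvexOn ℝ (Ici 0) f) {x y z : ℝ}
    (hx : 0 ≤ x) (hy : 0 ≤ y) (hz : 0 ≤ z) (hout : 0 ≤ (x - y) * (x - z)) :
    0 ≤ opK Φ f x y z := by
  unfold opK
  by_cases h : W Φ x y z = 0
  · rw [h, zero_mul]
  · exact mul_nonneg (hB.W_nonneg hx hy hz)
      (Delta_nonneg_of_convex hf hx (hB.le_add_of_W_ne_zero hx hy hz h) hout)

/-- The factor `|(x - y)(x - z)|`, which bounds `Delta` of a smooth function, compensates the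
singularity of `W` at small energies. -/
theorem KernelAssumption.W_sq_mul_le (hB : KernelAssumption B Φ b₀ η) {x y z : ℝ}
    (hx : 0 ≤ x) (hy : 0 ≤ y) (hz : 0 ≤ z) :
    W Φ x y z ^ 2 * |(x - y) * (x - z)| ≤ 1 := by
  by_cases hW : W Φ x y z = 0
  · rw [hW]; simp
  have h := hB.le_add_of_W_ne_zero hx hy hz hW
  have hW0 := hB.W_nonneg hx hy hz
  have sq : ∀ u v : ℝ, 0 ≤ u → 0 ≤ v → W Φ x y z * (Real.sqrt u * Real.sqrt v) ≤ 1 →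
      W Φ x y z ^ 2 * (u * v) ≤ 1 := by
    intro u v hu hv h
    have := pow_le_one₀ (n := 2) (by positivity) h
    rwa [mul_pow, mul_pow, Real.sq_sqrt hu, Real.sq_sqrt hv] at this
  obtain ⟨h1, h2, h3⟩ := hB.W_mul_sqrt_le hx hy hz
  have k1 := sq _ _ hy hz h1
  have k2 := sq _ _ hx hz h2
  have k3 := sq _ _ hx hy h3
  -- one of `yz`, `xz`, `xy` dominates `|(x - y)(x - z)| = |yz - x(y + z - x)|`
  have : |(x - y) * (x - z)| ≤ y * z ∨ |(x - y) * (x - z)| ≤ x * z ∨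
      |(x - y) * (x - z)| ≤ x * y := by
    rcases le_total x y with a | a <;> rcases le_total x z with b | b
    · left
      rw [abs_of_nonneg (mul_nonneg_of_nonpos_of_nonpos (by linarith) (by linarith))]
      nlinarith
    · right; right
      rw [abs_of_nonpos (mul_nonpos_of_nonpos_of_nonneg (by linarith) (by linarith))]
      nlinarith
    · right; left
      rw [abs_of_nonpos (mul_nonpos_of_nonneg_of_nonpos (by linarith) (by linarith))]
      nlinarith
    · left
      rw [abs_of_nonneg (mul_nonneg (by linarith) (by linarith))]
      nlinarith
  rcases this with h | h | h
  · exact (mul_le_mul_of_nonneg_left h (sq_nonneg _)).trans k1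
  · exact (mul_le_mul_of_nonneg_left h (sq_nonneg _)).trans k2
  · exact (mul_le_mul_of_nonneg_left h (sq_nonneg _)).trans k3

theorem KernelAssumption.abs_opK_cap_le (hB : KernelAssumption B Φ b₀ η) {ε x y z : ℝ}
    (hε : 0 < ε) (hx : 0 ≤ x) (hy : 0 ≤ y) (hz : 0 ≤ z) :
    |opK Φ (cap ε) x y z| ≤ 12 / ε ^ 2 + 1 := by
  have hL : 0 ≤ 12 / ε ^ 2 := by positivity
  unfold opK
  by_cases hW : W Φ x y z = 0
  · rw [hW, zero_mul, abs_zero]; linarith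
  have h := hB.le_add_of_W_ne_zero hx hy hz hW
  have hs : 0 ≤ xStar x y z := le_max_right _ _
  have h2 : |Delta (cap ε) x y z| ≤ 2 := by
    unfold Delta
    rw [abs_le]
    have := cap_nonneg ε x
    have := cap_nonneg ε y
    have := cap_nonneg ε z
    have := cap_nonneg ε (xStar x y z)
    have := cap_le_one hε hx
    have := cap_le_one hε hy
    have := cap_le_one hε hz
    have := cap_le_one hε hs
    constructor <;> linarith
  have hW0 := hB.W_nonneg hx hy hz
  refine abs_le.2 (abs_le_of_sq_le_sq' ?_ (by linarith))
  calc (W Φ x y z * Delta (cap ε) x y z) ^ 2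
      = W Φ x y z ^ 2 * (|Delta (cap ε) x y z| * |Delta (cap ε) x y z|) := by
        rw [abs_mul_abs_self]; ring
    _ ≤ W Φ x y z ^ 2 * (2 * (6 / ε ^ 2 * |(x - y) * (x - z)|)) := by
        refine mul_le_mul_of_nonneg_left ?_ (sq_nonneg _)
        exact mul_le_mul h2 (abs_Delta_cap_le hε hx hy hz h) (abs_nonneg _) (by norm_num)
    _ = 12 / ε ^ 2 * (W Φ x y z ^ 2 * |(x - y) * (x - z)|) := by ring
    _ ≤ 12 / ε ^ 2 * 1 := mul_le_mul_of_nonneg_left (hB.W_sq_mul_le hx hy hz) hL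
    _ ≤ (12 / ε ^ 2 + 1) ^ 2 := by nlinarith

/-- The cubic collision term summed over the cyclic choices of the first argument. -/
def symK (Φ : ℝ → ℝ → ℝ) (f : ℝ → ℝ) (x y z : ℝ) : ℝ :=
  opK Φ f x y z + opK Φ f y x z + opK Φ f z x y

theorem IsCollisionKernel.opK_symm (hB : IsCollisionKernel B Φ) (f : ℝ → ℝ) {x y z : ℝ}
    (hx : 0 ≤ x) (hy : 0 ≤ y) (hz : 0 ≤ z) : opK Φ f x y z = opK Φ f x z y := by
  unfold opK Delta
  rw [hB.W_symm hx hy hz, xStar_symm]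
  ring

theorem IsCollisionKernel.symK_swap_left (hB : IsCollisionKernel B Φ) (f : ℝ → ℝ) {x y z : ℝ}
    (hx : 0 ≤ x) (hy : 0 ≤ y) (hz : 0 ≤ z) : symK Φ f x y z = symK Φ f y x z := by
  unfold symK
  rw [hB.opK_symm f hz hx hy]
  ring

theorem IsCollisionKernel.symK_swap_right (hB : IsCollisionKernel B Φ) (f : ℝ → ℝ) {x y z : ℝ}
    (hx : 0 ≤ x) (hy : 0 ≤ y) (hz : 0 ≤ z) : symK Φ f x y z = symK Φ f x z y := by
  unfold symK
  rw [hB.opK_symm f hx hy hz]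
  ring

/-- The only negative contribution comes from the middle energy; it is dominated by that of the
least energy, and the difference is a second difference of `f` about the largest energy. -/
theorem KernelAssumption.le_symK (hB : KernelAssumption B Φ b₀ η) {f : ℝ → ℝ}
    (hf : ConvexOn ℝ (Ici 0) f) {a b c : ℝ} (ha : 0 ≤ a) (hab : a ≤ b) (hbc : b ≤ c) :
    W Φ a b c * (f (c + (b - a)) + f (c - (b - a)) - 2 * f c) ≤ symK Φ f a b c := by
  have hb := ha.trans hab
  have hc := hb.trans hbc
  have h1 := hB.opK_nonneg hf hc ha hb (mul_nonneg (by linarith) (by linarith))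
  have h2 := (Delta_nonpos_of_convex hf (x := b) ha hc
    (mul_nonpos_of_nonneg_of_nonpos (by linarith) (by linarith))).2
  have h3 := mul_le_mul_of_nonpos_right (hB.W_swap_le ha hab hbc) h2
  have e : Delta f a b c + Delta f b a c = f (c + (b - a)) + f (c - (b - a)) - 2 * f c := by
    unfold Delta
    rw [xStar_of_le (by linarith), xStar_of_le (by linarith),
      show b + c - a = c + (b - a) by ring, show a + c - b = c - (b - a) by ring]
    ring
  rw [← e, mul_add]
  unfold symK opK at *
  linarith

theorem KernelAssumption.symK_nonneg_of_le (hB : KernelAssumption B Φ b₀ η) {f : ℝ → ℝ}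
    (hf : ConvexOn ℝ (Ici 0) f) {a b c : ℝ} (ha : 0 ≤ a) (hab : a ≤ b) (hbc : b ≤ c) :
    0 ≤ symK Φ f a b c := by
  have hb := ha.trans hab
  have hc := hb.trans hbc
  refine le_trans (mul_nonneg (hB.W_nonneg ha hb hc) ?_) (hB.le_symK hf ha hab hbc)
  have := convexOn_add_le_add hf (p := c - (b - a)) (q := c + (b - a)) (u := c) (v := c)
    (show (0 : ℝ) ≤ _ by linarith) (show (0 : ℝ) ≤ _ by linarith) (by linarith) (by linarith)
    (by ring)
  linarith

theorem KernelAssumption.symK_nonneg (hB : KernelAssumption B Φ b₀ η) {f : ℝ → ℝ}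
    (hf : ConvexOn ℝ (Ici 0) f) {x y z : ℝ} (hx : 0 ≤ x) (hy : 0 ≤ y) (hz : 0 ≤ z) :
    0 ≤ symK Φ f x y z := by
  have two : ∀ x y z : ℝ, 0 ≤ x → 0 ≤ y → 0 ≤ z → x ≤ y → x ≤ z → 0 ≤ symK Φ f x y z := by
    intro x y z hx hy hz h1 h2
    rcases le_total y z with h | h
    · exact hB.symK_nonneg_of_le hf hx h1 h
    · rw [hB.symK_swap_right f hx hy hz]
      exact hB.symK_nonneg_of_le hf hx h2 h
  rcases le_total x y with h1 | h1 <;> rcases le_total x z with h2 | h2 <;>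
    rcases le_total y z with h3 | h3
  all_goals first
    | exact two x y z hx hy hz (by linarith) (by linarith)
    | (rw [hB.symK_swap_left f hx hy hz]
       exact two y x z hy hx hz (by linarith) (by linarith))
    | (rw [hB.symK_swap_right f hx hy hz, hB.symK_swap_left f hx hz hy]
       exact two z x y hz hx hy (by linarith) (by linarith))

/-- Coefficient in the lower bound for the rate at which mass in `(ε/2, ε]` is driven towards the
origin by mass in `[0, ε/8]`. -/
def gainRate (b₀ η ε : ℝ) : ℝ := 27 / 512 * (b₀ * ((ε / 4) ^ η / ε))

/-- At `c ≤ ε` the second difference of `cap ε` with step `h` is at least `(h/ε)³`, also when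
`c + h` lies beyond the support. -/
theorem cap_second_difference {ε c h : ℝ} (hε : 0 < ε) (hc : c ≤ ε) (hh : 0 ≤ h) :
    (h / ε) ^ 3 ≤ cap ε (c + h) + cap ε (c - h) - 2 * cap ε c := by
  have hu : 0 ≤ 1 - c / ε := by rw [sub_nonneg, div_le_one hε]; exact hc
  have hk : 0 ≤ h / ε := div_nonneg hh hε.le
  unfold cap
  rw [add_div, sub_div]
  revert hu hk
  generalize h / ε = k
  intro hu hk
  obtain ⟨u, hcu⟩ : ∃ u, c / ε = 1 - u := ⟨1 - c / ε, by ring⟩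
  rw [hcu]
  have e1 : 1 - (1 - u + k) = u - k := by ring
  have e2 : 1 - (1 - u - k) = u + k := by ring
  have e3 : 1 - (1 - u) = u := by ring
  rw [hcu, e3] at hu
  rw [e1, e2, e3, max_eq_left hu, max_eq_left (by linarith : 0 ≤ u + k)]
  rcases le_total u k with h | h
  · rw [max_eq_right (by linarith)]
    nlinarith [mul_nonneg hu (mul_nonneg hu (sub_nonneg.2 h)), mul_nonneg hu (mul_nonneg hk hk),
      mul_nonneg hu (mul_nonneg hu hk)]
  · rw [max_eq_left (by linarith)]
    nlinarith [mul_nonneg (mul_nonneg hk hk) (sub_nonneg.2 h), pow_nonneg hk 3]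

theorem KernelAssumption.gainRate_nonneg (hB : KernelAssumption B Φ b₀ η) {ε : ℝ} (hε : 0 < ε) :
    0 ≤ gainRate b₀ η ε := by
  have := hB.b₀_pos
  unfold gainRate
  positivity

theorem KernelAssumption.gainRate_le_symK (hB : KernelAssumption B Φ b₀ η) {ε a b c : ℝ}
    (hε : 0 < ε) (hε1 : ε ≤ 1) (ha : 0 ≤ a) (haε : a ≤ ε / 8) (hb : ε / 2 < b) (hbε : b ≤ ε)
    (hc : ε / 2 < c) (hcε : c ≤ ε) : gainRate b₀ η ε ≤ symK Φ (cap ε) a b c := by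
  wlog hbc : b ≤ c generalizing b c
  · rw [hB.symK_swap_right _ ha (by linarith) (by linarith)]
    exact this hc hcε hb hbε (by linarith)
  have hb0 : 0 < b := by linarith
  have hc0 : 0 < c := by linarith
  refine le_trans ?_ (hB.le_symK (convexOn_cap ε) ha (by linarith) hbc)
  have h1 := cap_second_difference (h := b - a) hε hcε (by linarith)
  have h2 : (27 / 512 : ℝ) ≤ ((b - a) / ε) ^ 3 := by
    have : (3 / 8 : ℝ) ≤ (b - a) / ε := by rw [le_div_iff₀ hε]; linarith
    calc (27 / 512 : ℝ) = (3 / 8) ^ 3 := by norm_num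
      _ ≤ _ := pow_le_pow_left₀ (by norm_num) this 3
  have h3 := hB.le_W ha (by linarith : a ≤ b) hbc hb0
  have h4 : (ε / 4) ^ η ≤ min 1 ((2 * (Real.sqrt b - Real.sqrt a) ^ 2) ^ η) := by
    refine le_min (Real.rpow_le_one (by positivity) (by linarith) hB.η_nonneg)
      (Real.rpow_le_rpow (by positivity) ?_ hB.η_nonneg)
    -- `√b ≥ 2 √(ε/8)` and `√a ≤ √(ε/8)`
    have k1 : Real.sqrt a ≤ Real.sqrt (ε / 8) := Real.sqrt_le_sqrt haε
    have k2 : 2 * Real.sqrt (ε / 8) ≤ Real.sqrt b := by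
      refine Real.le_sqrt_of_sq_le ?_
      rw [mul_pow, Real.sq_sqrt (by positivity)]
      linarith
    have k3 := pow_le_pow_left₀ (Real.sqrt_nonneg (ε / 8))
      (by linarith : Real.sqrt (ε / 8) ≤ Real.sqrt b - Real.sqrt a) 2
    rw [Real.sq_sqrt (by positivity)] at k3
    linarith
  have h5 : Real.sqrt (b * c) ≤ ε := by
    rw [Real.sqrt_le_left hε.le]
    nlinarith
  have h6 : b₀ * ((ε / 4) ^ η / ε) ≤ W Φ a b c := by
    refine le_trans ?_ h3
    rw [← mul_div_assoc]
    have := hB.b₀_pos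
    exact div_le_div₀ (by positivity) (mul_le_mul_of_nonneg_left h4 this.le)
      (Real.sqrt_pos.2 (mul_pos hb0 hc0)) h5
  unfold gainRate
  rw [mul_comm]
  have := hB.b₀_pos
  exact mul_le_mul h6 (h2.trans h1) (by norm_num) (le_trans (by positivity) h6)

/-! ### The quadratic collision term -/

/-- No integrability of `f` is needed: the Bochner integral of a non-integrable function is `0`. -/
theorem integral_le_integral_of_nonpos {α : Type*} [MeasurableSpace α] {μ : Measure α} {f g : α → ℝ}
    (hg : Integrable g μ) (h : g ≤ᵐ[μ] f) (h0 : ∫ x, g x ∂μ ≤ 0) : ∫ x, g x ∂μ ≤ ∫ x, f x ∂μ := by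
  by_cases hf : Integrable f μ
  · exact integral_mono_ae hg hf h
  · rwa [integral_undef hf]

theorem IsCollisionKernel.opJ_symm (hB : IsCollisionKernel B Φ) (f : ℝ → ℝ) {y z : ℝ}
    (hy : 0 ≤ y) (hz : 0 ≤ z) : opJ Φ f y z = opJ Φ f z y := by
  unfold opJ
  rw [add_comm z y, intervalIntegral.integral_of_le (by linarith),
    intervalIntegral.integral_of_le (by linarith)]
  congr 1
  refine setIntegral_congr_fun measurableSet_Ioc fun x hx => ?_
  rw [hB.opK_symm f hx.1.le hy hz]

/-- Only the energies `x` between `y` and `z` contribute negatively; there `Delta` is at least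
`-cap ε y` and `W √x ≤ 1/√z`. -/
theorem KernelAssumption.le_opJ_of_le (hB : KernelAssumption B Φ b₀ η) {ε y z : ℝ} (hε : 0 < ε)
    (hy : 0 ≤ y) (hyz : y ≤ z) : -(1 / 2 * (cap ε y * Real.sqrt z)) ≤ opJ Φ (cap ε) y z := by
  have hz := hy.trans hyz
  unfold opJ
  rcases hz.eq_or_lt with rfl | hz0
  · obtain rfl : y = 0 := le_antisymm hyz hy
    simp
  rw [intervalIntegral.integral_of_le (by linarith)]
  set C := cap ε y / Real.sqrt z with hC
  have hC0 : 0 ≤ C := div_nonneg (cap_nonneg _ _) (Real.sqrt_nonneg _)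
  set g : ℝ → ℝ := (Icc y z).indicator fun _ => -C with hg
  have hgi : Integrable g (volume.restrict (Ioc 0 (y + z))) :=
    ((integrable_const _).indicator measurableSet_Icc)
  have hgval : ∫ x in Ioc 0 (y + z), g x = -(volume.real (Ioc 0 (y + z) ∩ Icc y z) * C) := by
    rw [hg, setIntegral_indicator measurableSet_Icc, setIntegral_const, smul_eq_mul, mul_neg]
  have hvol : volume.real (Ioc 0 (y + z) ∩ Icc y z) ≤ z := by
    calc _ ≤ volume.real (Icc y z) := measureReal_mono inter_subset_right (by simp)
      _ = z - y := by rw [Real.volume_real_Icc_of_le hyz]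
      _ ≤ z := by linarith
  have hvol0 : 0 ≤ volume.real (Ioc 0 (y + z) ∩ Icc y z) := measureReal_nonneg
  have hle : g ≤ᵐ[volume.restrict (Ioc 0 (y + z))]
      fun x => opK Φ (cap ε) x y z * Real.sqrt x := by
    rw [Filter.EventuallyLE, ae_restrict_iff' measurableSet_Ioc]
    refine Filter.Eventually.of_forall fun x hx => ?_
    have hx0 : 0 ≤ x := hx.1.le
    by_cases h : x ∈ Icc y z
    · rw [hg, indicator_of_mem h]
      have hD : -cap ε y ≤ Delta (cap ε) x y z := by
        unfold Delta
        have := cap_anti hε h.2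
        have := cap_nonneg ε (xStar x y z)
        linarith
      have hW := hB.W_nonneg hx0 hy hz
      have h2 := (hB.W_mul_sqrt_le hx0 hy hz).2.1
      have hsz := Real.sqrt_pos.2 hz0
      have h3 : W Φ x y z * Real.sqrt x ≤ 1 / Real.sqrt z := by
        rw [le_div_iff₀ hsz, mul_assoc]; exact h2
      calc -C = -(cap ε y * (1 / Real.sqrt z)) := by rw [hC]; ring
        _ ≤ -(cap ε y * (W Φ x y z * Real.sqrt x)) :=
            neg_le_neg (mul_le_mul_of_nonneg_left h3 (cap_nonneg _ _))
        _ = (W Φ x y z * Real.sqrt x) * -cap ε y := by ring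
        _ ≤ (W Φ x y z * Real.sqrt x) * Delta (cap ε) x y z :=
            mul_le_mul_of_nonneg_left hD (mul_nonneg hW (Real.sqrt_nonneg _))
        _ = _ := by unfold opK; ring
    · rw [hg, indicator_of_notMem h]
      refine mul_nonneg (hB.opK_nonneg (convexOn_cap ε) hx0 hy hz ?_) (Real.sqrt_nonneg _)
      rw [mem_Icc, not_and_or, not_le, not_le] at h
      rcases h with h | h
      · exact mul_nonneg_of_nonpos_of_nonpos (by linarith) (by linarith)
      · exact mul_nonneg (by linarith) (by linarith)
  have := integral_le_integral_of_nonpos hgi hle (by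
    rw [hgval, neg_nonpos]; exact mul_nonneg hvol0 hC0)
  rw [hgval] at this
  have h4 : volume.real (Ioc 0 (y + z) ∩ Icc y z) * C ≤ cap ε y * Real.sqrt z := by
    calc _ ≤ z * C := mul_le_mul_of_nonneg_right hvol hC0
      _ = cap ε y * (z / Real.sqrt z) := by rw [hC]; ring
      _ = _ := by rw [Real.div_sqrt]
  linarith

theorem KernelAssumption.le_opJ (hB : KernelAssumption B Φ b₀ η) {ε y z : ℝ} (hε : 0 < ε)
    (hy : 0 ≤ y) (hz : 0 ≤ z) :
    -(1 / 2 * (cap ε y * Real.sqrt z + cap ε z * Real.sqrt y)) ≤ opJ Φ (cap ε) y z := by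
  have h1 := mul_nonneg (cap_nonneg ε y) (Real.sqrt_nonneg z)
  have h2 := mul_nonneg (cap_nonneg ε z) (Real.sqrt_nonneg y)
  rcases le_total y z with h | h
  · have := hB.le_opJ_of_le hε hy h
    linarith
  · have := hB.le_opJ_of_le hε hz h
    rw [hB.opJ_symm _ hz hy] at this
    linarith

theorem MemB1.isFiniteMeasure {F : Measure ℝ≥0} (hF : MemB1 F) : IsFiniteMeasure F := by
  refine ⟨lt_of_le_of_lt ?_ hF⟩
  rw [← setLIntegral_one, Measure.restrict_univ]
  exact lintegral_mono fun x => le_self_add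

theorem MemB1.integrable_coe {F : Measure ℝ≥0} (hF : MemB1 F) :
    Integrable (fun x : ℝ≥0 => (x : ℝ)) F := by
  refine ⟨(by fun_prop : Measurable fun x : ℝ≥0 => (x : ℝ)).aestronglyMeasurable, ?_⟩
  refine lt_of_le_of_lt (lintegral_mono fun x => ?_) hF
  simp

theorem integrable_cap (F : Measure ℝ≥0) [IsFiniteMeasure F] {ε : ℝ} (hε : 0 < ε) :
    Integrable (fun x : ℝ≥0 => cap ε x) F := by
  refine Integrable.of_bound (C := 1)
    ((continuous_cap ε).measurable.comp measurable_coe_nnreal_real).aestronglyMeasurable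
    (Filter.Eventually.of_forall fun x => ?_)
  rw [Real.norm_of_nonneg (cap_nonneg _ _)]
  exact cap_le_one hε x.2

theorem MemB1.integral_sqrt_le {F : Measure ℝ≥0} (hF : MemB1 F) (hN : 0 < mass F)
    (hE : 0 < energy F) : Integrable (fun x : ℝ≥0 => Real.sqrt x) F ∧
      ∫ x : ℝ≥0, Real.sqrt x ∂F ≤ Real.sqrt (mass F * energy F) := by
  have := hF.isFiniteMeasure
  have hx := hF.integrable_coe
  have hm : Measurable fun x : ℝ≥0 => Real.sqrt x := by fun_prop
  have hi : Integrable (fun x : ℝ≥0 => Real.sqrt x) F := by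
    refine ((integrable_const (1 : ℝ)).add hx).mono' hm.aestronglyMeasurable
      (Filter.Eventually.of_forall fun x => ?_)
    rw [Real.norm_of_nonneg (Real.sqrt_nonneg _), Pi.add_apply, Real.sqrt_le_left (by positivity)]
    nlinarith [x.2, sq_nonneg (x : ℝ)]
  refine ⟨hi, ?_⟩
  -- `√x ≤ (l + x/l)/2`, with equality for `x = l²` the mean energy
  set l := Real.sqrt (energy F / mass F) with hl
  have hl0 : 0 < l := Real.sqrt_pos.2 (div_pos hE hN)
  have hl2 : l ^ 2 = energy F / mass F := Real.sq_sqrt (div_pos hE hN).le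
  have h1 : ∫ x : ℝ≥0, Real.sqrt x ∂F ≤ ∫ x : ℝ≥0, (l / 2 + (1 / (2 * l)) * x) ∂F := by
    refine integral_mono hi ((integrable_const _).add (hx.const_mul _)) fun x => ?_
    have e := Real.sq_sqrt x.2
    have : l / 2 + 1 / (2 * l) * (x : ℝ) - Real.sqrt x = (Real.sqrt x - l) ^ 2 / (2 * l) := by
      rw [show ((x : ℝ≥0) : ℝ) = Real.sqrt x ^ 2 from e.symm, Real.sqrt_sq (Real.sqrt_nonneg _)]
      field_simp
      ring
    have h0 : 0 ≤ (Real.sqrt x - l) ^ 2 / (2 * l) := by positivity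
    simp only
    linarith
  rw [integral_add (integrable_const _) (hx.const_mul _), integral_const, integral_const_mul,
    smul_eq_mul] at h1
  change _ ≤ mass F * (l / 2) + 1 / (2 * l) * energy F at h1
  refine h1.trans (Real.le_sqrt_of_sq_le (le_of_eq ?_))
  have : energy F = mass F * l ^ 2 := by rw [hl2]; field_simp
  rw [this]
  field_simp
  ring

theorem KernelAssumption.le_integral_opJ (hB : KernelAssumption B Φ b₀ η) {F : Measure ℝ≥0}
    (hF : MemB1 F) (hN : 0 < mass F) (hE : 0 < energy F) {ε : ℝ} (hε : 0 < ε) :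
    -(Real.sqrt (mass F * energy F) * ∫ x : ℝ≥0, cap ε x ∂F) ≤
      ∫ q : ℝ≥0 × ℝ≥0, opJ Φ (cap ε) q.1 q.2 ∂(F.prod F) := by
  have := hF.isFiniteMeasure
  obtain ⟨hs, hs'⟩ := hF.integral_sqrt_le hN hE
  have hc := integrable_cap F hε
  have i1 := hc.mul_prod hs
  have i2 := hs.mul_prod hc
  have hcap0 : 0 ≤ ∫ x : ℝ≥0, cap ε x ∂F := integral_nonneg fun x => cap_nonneg _ _
  have hs0 : 0 ≤ ∫ x : ℝ≥0, Real.sqrt x ∂F := integral_nonneg fun x => Real.sqrt_nonneg _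
  have hg := ((i1.add i2).const_mul (1 / 2 : ℝ)).neg
  have hval : ∫ q : ℝ≥0 × ℝ≥0, -(1 / 2 * (cap ε q.1 * Real.sqrt q.2 + Real.sqrt q.1 * cap ε q.2))
      ∂(F.prod F) = -((∫ x : ℝ≥0, Real.sqrt x ∂F) * ∫ x : ℝ≥0, cap ε x ∂F) := by
    rw [integral_neg, integral_const_mul, integral_add i1 i2,
      integral_prod_mul (fun x : ℝ≥0 => cap ε x) (fun x : ℝ≥0 => Real.sqrt x),
      integral_prod_mul (fun x : ℝ≥0 => Real.sqrt x) (fun x : ℝ≥0 => cap ε x)]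
    ring
  have h1 := integral_le_integral_of_nonpos (f := fun q : ℝ≥0 × ℝ≥0 => opJ Φ (cap ε) q.1 q.2) hg
    (Filter.Eventually.of_forall fun q => ?_) ?_
  · refine le_trans ?_ h1
    change _ ≤ ∫ q : ℝ≥0 × ℝ≥0,
      -(1 / 2 * (cap ε q.1 * Real.sqrt q.2 + Real.sqrt q.1 * cap ε q.2)) ∂(F.prod F)
    rw [hval]
    exact neg_le_neg (mul_le_mul_of_nonneg_right hs' hcap0)
  · have := hB.le_opJ hε q.1.2 q.2.2
    change -(1 / 2 * (cap ε q.1 * Real.sqrt q.2 + Real.sqrt q.1 * cap ε q.2)) ≤ _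
    rw [mul_comm (Real.sqrt q.1)]
    exact this
  · change ∫ q : ℝ≥0 × ℝ≥0,
      -(1 / 2 * (cap ε q.1 * Real.sqrt q.2 + Real.sqrt q.1 * cap ε q.2)) ∂(F.prod F) ≤ 0
    rw [hval, neg_nonpos]
    exact mul_nonneg hs0 hcap0

/-! ### The differential inequality -/

/-- Energies in `[0, ε]`. -/
def low (ε : ℝ) : Set ℝ≥0 := {x : ℝ≥0 | (x : ℝ) ≤ ε}

/-- Energies in the dyadic band `(ε/2, ε]`. -/
def band (ε : ℝ) : Set ℝ≥0 := {x : ℝ≥0 | ε / 2 < (x : ℝ) ∧ (x : ℝ) ≤ ε}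

theorem measurableSet_low (ε : ℝ) : MeasurableSet (low ε) :=
  measurableSet_le (by fun_prop) measurable_const

theorem measurableSet_band (ε : ℝ) : MeasurableSet (band ε) :=
  (measurableSet_lt measurable_const measurable_coe_nnreal_real).inter
    (measurableSet_le measurable_coe_nnreal_real measurable_const)

theorem IsCollisionKernel.measurable_opK_cap (hB : IsCollisionKernel B Φ) (ε : ℝ) :
    Measurable fun p : ℝ≥0 × ℝ≥0 × ℝ≥0 => opK Φ (cap ε) p.1 p.2.1 p.2.2 := by
  have hc := (continuous_cap ε).measurable
  have hx : Measurable fun p : ℝ≥0 × ℝ≥0 × ℝ≥0 => xStar p.1 p.2.1 p.2.2 := by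
    unfold xStar; fun_prop
  unfold opK Delta
  refine hB.measurable_W.mul (((Measurable.add ?_ (hc.comp hx)).sub ?_).sub ?_)
  · exact hc.comp (by fun_prop : Measurable fun p : ℝ≥0 × ℝ≥0 × ℝ≥0 => (p.1 : ℝ))
  · exact hc.comp (by fun_prop : Measurable fun p : ℝ≥0 × ℝ≥0 × ℝ≥0 => (p.2.1 : ℝ))
  · exact hc.comp (by fun_prop : Measurable fun p : ℝ≥0 × ℝ≥0 × ℝ≥0 => (p.2.2 : ℝ))

/-- The sum over the three positions of the low-energy particle. -/
theorem KernelAssumption.indicator_le_symK (hB : KernelAssumption B Φ b₀ η) {ε : ℝ} (hε : 0 < ε)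
    (hε1 : ε ≤ 1) (x y z : ℝ≥0) :
    gainRate b₀ η ε *
      ((low (ε / 8)).indicator 1 x * ((band ε).indicator 1 y * (band ε).indicator 1 z) +
        (band ε).indicator 1 x * ((low (ε / 8)).indicator 1 y * (band ε).indicator 1 z) +
        (band ε).indicator 1 x * ((band ε).indicator 1 y * (low (ε / 8)).indicator 1 z)) ≤
      symK Φ (cap ε) x y z := by
  have h0 := hB.symK_nonneg (convexOn_cap ε) x.2 y.2 z.2
  have tri : ∀ w : ℝ≥0, (w ∈ low (ε / 8) ∧ w ∉ band ε) ∨ (w ∉ low (ε / 8) ∧ w ∈ band ε) ∨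
      (w ∉ low (ε / 8) ∧ w ∉ band ε) := by
    intro w
    by_cases h1 : w ∈ low (ε / 8) <;> by_cases h2 : w ∈ band ε
    · exfalso
      have a1 : (w : ℝ) ≤ ε / 8 := h1
      have a2 : ε / 2 < (w : ℝ) := h2.1
      linarith
    all_goals tauto
  have h1 : ∀ a b c : ℝ≥0, a ∈ low (ε / 8) → b ∈ band ε → c ∈ band ε →
      gainRate b₀ η ε ≤ symK Φ (cap ε) a b c := fun a b c ha hb hc =>
    hB.gainRate_le_symK hε hε1 a.2 ha hb.1 hb.2 hc.1 hc.2
  rcases tri x with ⟨hx, hx'⟩ | ⟨hx, hx'⟩ | ⟨hx, hx'⟩ <;>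
  rcases tri y with ⟨hy, hy'⟩ | ⟨hy, hy'⟩ | ⟨hy, hy'⟩ <;>
  rcases tri z with ⟨hz, hz'⟩ | ⟨hz, hz'⟩ | ⟨hz, hz'⟩ <;>
  simp only [indicator_of_mem, indicator_of_notMem, hx, hx', hy, hy', hz, hz', not_false_eq_true,
    Pi.one_apply, mul_one, mul_zero, add_zero, zero_add] <;>
  try exact h0
  · exact h1 x y z hx hy' hz'
  · rw [hB.symK_swap_left _ x.coe_nonneg y.coe_nonneg z.coe_nonneg]
    exact h1 y x z hy hx' hz'
  · rw [hB.symK_swap_right _ x.coe_nonneg y.coe_nonneg z.coe_nonneg, hB.symK_swap_left _ x.coe_nonneg z.coe_nonneg y.coe_nonneg]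
    exact h1 z x y hz hx' hy'

/-- The product measure is invariant under permutations, so the cubic term is a third of the
integral of `symK`; it is integrable because `opK Φ (cap ε)` is bounded. -/
theorem KernelAssumption.le_integral_opK (hB : KernelAssumption B Φ b₀ η) (F : Measure ℝ≥0)
    [IsFiniteMeasure F] {ε : ℝ} (hε : 0 < ε) (hε1 : ε ≤ 1) :
    gainRate b₀ η ε * (F.real (low (ε / 8)) * F.real (band ε) ^ 2) ≤
      ∫ q : ℝ≥0 × ℝ≥0 × ℝ≥0, opK Φ (cap ε) q.1 q.2.1 q.2.2 ∂(F.prod (F.prod F)) := by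
  set ν := F.prod (F.prod F) with hν
  set k : ℝ≥0 × ℝ≥0 × ℝ≥0 → ℝ := fun q => opK Φ (cap ε) q.1 q.2.1 q.2.2 with hk
  have hkm : Measurable k := hB.measurable_opK_cap ε
  have hki : Integrable k ν := Integrable.of_bound hkm.aestronglyMeasurable (12 / ε ^ 2 + 1)
    (Filter.Eventually.of_forall fun q => hB.abs_opK_cap_le hε q.1.2 q.2.1.2 q.2.2.2)
  have hσ : MeasurePreserving (fun q : ℝ≥0 × ℝ≥0 × ℝ≥0 => (q.2.1, q.1, q.2.2)) ν ν :=
    (measurePreserving_prodAssoc F F F).comp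
      ((Measure.measurePreserving_swap.prod (MeasurePreserving.id F)).comp
        (measurePreserving_prodAssoc F F F).symm)
  have hτ : MeasurePreserving (fun q : ℝ≥0 × ℝ≥0 × ℝ≥0 => (q.2.2, q.1, q.2.1)) ν ν :=
    (Measure.measurePreserving_swap (μ := F.prod F) (ν := F)).comp
      (measurePreserving_prodAssoc F F F).symm
  have hinv : ∀ σ : ℝ≥0 × ℝ≥0 × ℝ≥0 → ℝ≥0 × ℝ≥0 × ℝ≥0, MeasurePreserving σ ν ν →
      Integrable (fun q => k (σ q)) ν ∧ ∫ q, k (σ q) ∂ν = ∫ q, k q ∂ν := by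
    intro σ hσ
    have hm : AEStronglyMeasurable k (Measure.map σ ν) := hkm.aestronglyMeasurable
    refine ⟨hσ.integrable_comp_of_integrable hki, ?_⟩
    rw [← integral_map hσ.measurable.aemeasurable hm, hσ.map_eq]
  obtain ⟨iσ, eσ⟩ := hinv _ hσ
  obtain ⟨iτ, eτ⟩ := hinv _ hτ
  have hsym : ∫ q : ℝ≥0 × ℝ≥0 × ℝ≥0, symK Φ (cap ε) q.1 q.2.1 q.2.2 ∂ν = 3 * ∫ q, k q ∂ν := by
    have : (fun q : ℝ≥0 × ℝ≥0 × ℝ≥0 => symK Φ (cap ε) q.1 q.2.1 q.2.2) =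
        fun q => k q + k (q.2.1, q.1, q.2.2) + k (q.2.2, q.1, q.2.1) := rfl
    have i₂ : Integrable (fun q => k q + k (q.2.1, q.1, q.2.2)) ν := hki.add iσ
    rw [this, integral_add i₂ iτ, integral_add hki iσ, eσ, eτ]
    ring
  have hsymi : Integrable (fun q : ℝ≥0 × ℝ≥0 × ℝ≥0 => symK Φ (cap ε) q.1 q.2.1 q.2.2) ν :=
    (hki.add iσ).add iτ
  have hA : Integrable ((low (ε / 8)).indicator (1 : ℝ≥0 → ℝ)) F :=
    (integrable_const (1 : ℝ)).indicator (measurableSet_low _)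
  have hM : Integrable ((band ε).indicator (1 : ℝ≥0 → ℝ)) F :=
    (integrable_const (1 : ℝ)).indicator (measurableSet_band _)
  have vA : ∫ x, (low (ε / 8)).indicator (1 : ℝ≥0 → ℝ) x ∂F = F.real (low (ε / 8)) :=
    integral_indicator_one (measurableSet_low _)
  have vM : ∫ x, (band ε).indicator (1 : ℝ≥0 → ℝ) x ∂F = F.real (band ε) :=
    integral_indicator_one (measurableSet_band _)
  have prod3 : ∀ f g h : ℝ≥0 → ℝ, Integrable f F → Integrable g F → Integrable h F →
      Integrable (fun q : ℝ≥0 × ℝ≥0 × ℝ≥0 => f q.1 * (g q.2.1 * h q.2.2)) ν ∧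
      ∫ q : ℝ≥0 × ℝ≥0 × ℝ≥0, f q.1 * (g q.2.1 * h q.2.2) ∂ν =
        (∫ x, f x ∂F) * ((∫ x, g x ∂F) * ∫ x, h x ∂F) := by
    intro f g h hf hg hh
    refine ⟨hf.mul_prod (hg.mul_prod hh), ?_⟩
    rw [hν, integral_prod_mul f (fun p : ℝ≥0 × ℝ≥0 => g p.1 * h p.2), integral_prod_mul g h]
  obtain ⟨i1, v1⟩ := prod3 _ _ _ hA hM hM
  obtain ⟨i2, v2⟩ := prod3 _ _ _ hM hA hM
  obtain ⟨i3, v3⟩ := prod3 _ _ _ hM hM hA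
  have key := integral_mono (((i1.add i2).add i3).const_mul (gainRate b₀ η ε)) hsymi
    fun q => hB.indicator_le_symK hε hε1 q.1 q.2.1 q.2.2
  rw [hsym, integral_const_mul] at key
  have e : ∫ q : ℝ≥0 × ℝ≥0 × ℝ≥0,
      ((low (ε / 8)).indicator (1 : ℝ≥0 → ℝ) q.1 *
          ((band ε).indicator (1 : ℝ≥0 → ℝ) q.2.1 * (band ε).indicator (1 : ℝ≥0 → ℝ) q.2.2) +
        (band ε).indicator (1 : ℝ≥0 → ℝ) q.1 *
          ((low (ε / 8)).indicator (1 : ℝ≥0 → ℝ) q.2.1 * (band ε).indicator (1 : ℝ≥0 → ℝ) q.2.2) +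
        (band ε).indicator (1 : ℝ≥0 → ℝ) q.1 *
          ((band ε).indicator (1 : ℝ≥0 → ℝ) q.2.1 * (low (ε / 8)).indicator (1 : ℝ≥0 → ℝ) q.2.2)) ∂ν
      = 3 * (F.real (low (ε / 8)) * F.real (band ε) ^ 2) := by
    refine (integral_add (i1.add i2) i3).trans ?_
    simp only [Pi.add_apply]
    rw [integral_add i1 i2, v1, v2, v3, vA, vM]
    ring
  have key' : gainRate b₀ η ε * (3 * (F.real (low (ε / 8)) * F.real (band ε) ^ 2)) ≤
      3 * ∫ q, k q ∂ν := by
    rw [← e]; exact key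
  linarith

variable {F₀ : Measure ℝ≥0} {F : ℝ → Measure ℝ≥0}

/-- The exponential rate at which concentration near the origin can be lost. -/
def lossRate (F₀ : Measure ℝ≥0) : ℝ := Real.sqrt (mass F₀ * energy F₀)

theorem IsConservativeSolution.exists_hasDerivWithinAt (hF : IsConservativeSolution Φ F₀ F)
    (hB : KernelAssumption B Φ b₀ η) (hN : 0 < mass F₀) (hE : 0 < energy F₀) {ε : ℝ} (hε : 0 < ε)
    (hε1 : ε ≤ 1) {t : ℝ} (ht : 0 ≤ t) :
    ∃ d, HasDerivWithinAt (fun τ => ∫ x : ℝ≥0, cap ε x ∂(F τ)) d (Ici 0) t ∧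
      -(lossRate F₀ * ∫ x : ℝ≥0, cap ε x ∂(F t)) +
        gainRate b₀ η ε * ((F t).real (low (ε / 8)) * (F t).real (band ε) ^ 2) ≤ d := by
  have := (hF.memB1 t ht).isFiniteMeasure
  refine ⟨_, hF.weak_eq _ (isTestFunction_cap hε) t ht, add_le_add ?_ ?_⟩
  · have := hB.le_integral_opJ (hF.memB1 t ht) (by rwa [hF.mass_eq t ht])
      (by rwa [hF.energy_eq t ht]) hε
    rwa [hF.mass_eq t ht, hF.energy_eq t ht] at this
  · exact hB.le_integral_opK (F t) hε hε1

/-- Integrated form of the differential inequality, for a nonnegative combination of truncated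
cubics at several scales. -/
theorem IsConservativeSolution.mul_sub_le (hF : IsConservativeSolution Φ F₀ F)
    (hB : KernelAssumption B Φ b₀ η) (hN : 0 < mass F₀) (hE : 0 < energy F₀) {ι : Type*}
    (K : Finset ι) (w ε : ι → ℝ) (hw : ∀ k ∈ K, 0 ≤ w k) (hε : ∀ k ∈ K, 0 < ε k)
    (hε1 : ∀ k ∈ K, ε k ≤ 1) {s T m : ℝ} (hs : 0 ≤ s) (hsT : s ≤ T) (hm : 0 ≤ m)
    (h : ∀ t ∈ Icc s T, m ≤ ∑ k ∈ K, w k * (gainRate b₀ η (ε k) *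
      ((F t).real (low (ε k / 8)) * (F t).real (band (ε k)) ^ 2))) :
    m * (T - s) ≤ Real.exp (lossRate F₀ * (T - s)) *
        (∑ k ∈ K, w k * ∫ x : ℝ≥0, cap (ε k) x ∂(F T)) -
      ∑ k ∈ K, w k * ∫ x : ℝ≥0, cap (ε k) x ∂(F s) := by
  set c := lossRate F₀ with hc
  have hd : ∀ k ∈ K, ∀ t : ℝ, 0 ≤ t → ∃ d,
      HasDerivWithinAt (fun τ => ∫ x : ℝ≥0, cap (ε k) x ∂(F τ)) d (Ici 0) t ∧
      -(c * ∫ x : ℝ≥0, cap (ε k) x ∂(F t)) + gainRate b₀ η (ε k) *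
        ((F t).real (low (ε k / 8)) * (F t).real (band (ε k)) ^ 2) ≤ d :=
    fun k hk t ht => hF.exists_hasDerivWithinAt hB hN hE (hε k hk) (hε1 k hk) ht
  set u : ι → ℝ → ℝ := fun k τ => ∫ x : ℝ≥0, cap (ε k) x ∂(F τ) with hu
  set g : ℝ → ℝ := fun τ => Real.exp (c * (τ - s)) * ∑ k ∈ K, w k * u k τ with hg
  have hgd : ∀ t ∈ Icc s T, ∃ e, HasDerivWithinAt g e (Ici 0) t ∧ m ≤ e := by
    intro t ht
    have ht0 : 0 ≤ t := hs.trans ht.1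
    choose! d hd1 hd2 using fun k hk => hd k hk t ht0
    have h1 : HasDerivWithinAt (fun τ => ∑ k ∈ K, w k * u k τ) (∑ k ∈ K, w k * d k) (Ici 0) t :=
      HasDerivWithinAt.fun_sum fun k hk => (hd1 k hk).const_mul (w k)
    have h2 : HasDerivAt (fun τ => Real.exp (c * (τ - s))) (Real.exp (c * (t - s)) * c) t := by
      have : HasDerivAt (fun τ => c * (τ - s)) c t := by
        simpa using ((hasDerivAt_id t).sub_const s).const_mul c
      exact this.exp
    refine ⟨_, h2.hasDerivWithinAt.mul h1, ?_⟩
    have h3 : m ≤ ∑ k ∈ K, w k * (c * u k t + d k) := by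
      refine (h t ht).trans (Finset.sum_le_sum fun k hk => ?_)
      refine mul_le_mul_of_nonneg_left ?_ (hw k hk)
      have := hd2 k hk
      simp only [hu]
      linarith
    have hexp : 1 ≤ Real.exp (c * (t - s)) :=
      Real.one_le_exp (mul_nonneg (Real.sqrt_nonneg _) (sub_nonneg.2 ht.1))
    have e : Real.exp (c * (t - s)) * c * ∑ k ∈ K, w k * u k t +
        Real.exp (c * (t - s)) * ∑ k ∈ K, w k * d k =
        Real.exp (c * (t - s)) * ∑ k ∈ K, w k * (c * u k t + d k) := by
      simp only [mul_add, Finset.sum_add_distrib, ← mul_assoc, Finset.mul_sum]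
      congr 1
      refine Finset.sum_congr rfl fun k _ => by ring
    rw [e]
    nlinarith
  have hsub : Icc s T ⊆ Ici 0 := fun t ht => hs.trans ht.1
  have hcont : ContinuousOn g (Icc s T) := fun t ht => by
    obtain ⟨e, he, -⟩ := hgd t ht
    exact he.continuousWithinAt.mono hsub
  have hint : ∀ t ∈ interior (Icc s T), ∃ e, HasDerivAt g e t ∧ m ≤ e := by
    intro t ht
    rw [interior_Icc] at ht
    obtain ⟨e, he, hme⟩ := hgd t (Ioo_subset_Icc_self ht)
    exact ⟨e, he.hasDerivAt (Ici_mem_nhds (lt_of_le_of_lt hs ht.1)), hme⟩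
  have := (convex_Icc s T).mul_sub_le_image_sub_of_le_deriv hcont
    (fun t ht => by
      obtain ⟨e, he, -⟩ := hint t ht
      exact he.differentiableAt.differentiableWithinAt)
    (fun t ht => by
      obtain ⟨e, he, hme⟩ := hint t ht
      rwa [he.deriv])
    s (left_mem_Icc.2 hsT) T (right_mem_Icc.2 hsT) hsT
  simpa [hg] using this

/-- `exp (c t) ∫ cap ε dF_t` is non-decreasing in `t`, where `c = lossRate F₀`. -/
theorem IsConservativeSolution.integral_cap_le (hF : IsConservativeSolution Φ F₀ F)
    (hB : KernelAssumption B Φ b₀ η) (hN : 0 < mass F₀) (hE : 0 < energy F₀) {ε : ℝ} (hε : 0 < ε)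
    (hε1 : ε ≤ 1) {s T : ℝ} (hs : 0 ≤ s) (hsT : s ≤ T) :
    ∫ x : ℝ≥0, cap ε x ∂(F s) ≤
      Real.exp (lossRate F₀ * (T - s)) * ∫ x : ℝ≥0, cap ε x ∂(F T) := by
  have := hF.mul_sub_le hB hN hE ({()} : Finset Unit) (fun _ => 1) (fun _ => ε)
    (fun _ _ => zero_le_one) (fun _ _ => hε) (fun _ _ => hε1) hs hsT le_rfl (fun t _ => by
      have := hB.gainRate_nonneg hε
      simp only [Finset.sum_singleton, one_mul]
      positivity)
  simpa using this

/-! ### Dyadic descent to the origin -/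

theorem integral_cap_le_real_low (μ : Measure ℝ≥0) [IsFiniteMeasure μ] {δ : ℝ} (hδ : 0 < δ) :
    ∫ x : ℝ≥0, cap δ x ∂μ ≤ μ.real (low δ) := by
  rw [← integral_indicator_one (measurableSet_low δ)]
  refine integral_mono (integrable_cap μ hδ)
    ((integrable_const (1 : ℝ)).indicator (measurableSet_low _)) fun x => ?_
  by_cases h : x ∈ low δ
  · rw [indicator_of_mem h]
    exact cap_le_one hδ x.coe_nonneg
  · rw [indicator_of_notMem h]
    exact (cap_eq_zero hδ (not_le.1 h).le).le

theorem mul_real_low_le_integral_cap (μ : Measure ℝ≥0) [IsFiniteMeasure μ] {δ θ : ℝ} (hδ : 0 < δ)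
    (hθ : θ ≤ 1) : (1 - θ) ^ 3 * μ.real (low (θ * δ)) ≤ ∫ x : ℝ≥0, cap δ x ∂μ := by
  rw [← integral_indicator_one (measurableSet_low (θ * δ)), ← integral_const_mul]
  refine integral_mono (((integrable_const (1 : ℝ)).indicator (measurableSet_low _)).const_mul _)
    (integrable_cap μ hδ) fun x => ?_
  simp only
  by_cases h : x ∈ low (θ * δ)
  · rw [indicator_of_mem h, Pi.one_apply, mul_one]
    have h' : (x : ℝ) / δ ≤ θ := by rw [div_le_iff₀ hδ]; exact h
    exact pow_le_pow_left₀ (by linarith) (le_max_of_le_left (by linarith)) 3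
  · rw [indicator_of_notMem h, mul_zero]
    exact cap_nonneg _ _

theorem low_zero : low 0 = {0} := by
  ext x
  rw [mem_singleton_iff, ← NNReal.coe_eq_zero]
  exact ⟨fun h => le_antisymm h x.coe_nonneg, fun h => le_of_eq h⟩

theorem real_singleton_zero_le_integral_cap (μ : Measure ℝ≥0) [IsFiniteMeasure μ] {δ : ℝ}
    (hδ : 0 < δ) : μ.real {0} ≤ ∫ x : ℝ≥0, cap δ x ∂μ := by
  have := mul_real_low_le_integral_cap μ hδ zero_le_one
  rwa [zero_mul, low_zero, sub_zero, one_pow, one_mul] at this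

theorem le_real_singleton_zero (μ : Measure ℝ≥0) [IsFiniteMeasure μ] {m : ℝ}
    (h : ∀ δ : ℝ, 0 < δ → δ ≤ 1 → m ≤ ∫ x : ℝ≥0, cap δ x ∂μ) : m ≤ μ.real {0} := by
  have hlim : Filter.Tendsto (fun n : ℕ => ∫ x : ℝ≥0, cap (1 / ((n : ℝ) + 1)) x ∂μ) Filter.atTop
      (nhds (∫ x : ℝ≥0, ({0} : Set ℝ≥0).indicator (1 : ℝ≥0 → ℝ) x ∂μ)) := by
    refine tendsto_integral_of_dominated_convergence (fun _ => 1)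
      (fun n => (integrable_cap μ (by positivity)).aestronglyMeasurable) (integrable_const _)
      (fun n => Filter.Eventually.of_forall fun x => ?_) (Filter.Eventually.of_forall fun x => ?_)
    · rw [Real.norm_of_nonneg (cap_nonneg _ _)]
      exact cap_le_one (by positivity) x.coe_nonneg
    · by_cases hx : x = 0
      · subst hx
        simp [cap_zero]
      · rw [indicator_of_notMem (show x ∉ ({0} : Set ℝ≥0) from hx)]
        have hx' : (0 : ℝ) < x := NNReal.coe_pos.2 (pos_iff_ne_zero.2 hx)
        refine tendsto_const_nhds.congr' ?_
        filter_upwards [(tendsto_one_div_add_atTop_nhds_zero_nat (𝕜 := ℝ)).eventually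
          (gt_mem_nhds hx')] with n hn
        exact (cap_eq_zero (by positivity) hn.le).symm
  rw [integral_indicator_one (measurableSet_singleton 0)] at hlim
  refine ge_of_tendsto' hlim fun n => h _ (by positivity) ?_
  rw [div_le_one (by positivity)]
  linarith [n.cast_nonneg (α := ℝ)]

/-- Chebyshev's inequality. -/
theorem MemB1.le_real_low {F : Measure ℝ≥0} (hF : MemB1 F) {ε : ℝ} (hε : 0 < ε) :
    mass F - energy F / ε ≤ F.real (low ε) := by
  have := hF.isFiniteMeasure
  have hx := hF.integrable_coe
  have h1 : ∫ x : ℝ≥0, (1 - 1 / ε * (x : ℝ)) ∂F ≤ F.real (low ε) := by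
    rw [← integral_indicator_one (measurableSet_low ε)]
    refine integral_mono ((integrable_const _).sub (hx.const_mul _))
      ((integrable_const (1 : ℝ)).indicator (measurableSet_low _)) fun x => ?_
    have h0 : (x : ℝ) / ε = 1 / ε * x := by ring
    by_cases h : x ∈ low ε
    · rw [indicator_of_mem h]
      have : 0 ≤ (x : ℝ) / ε := div_nonneg x.coe_nonneg hε.le
      simp only [Pi.one_apply]
      linarith
    · rw [indicator_of_notMem h]
      have : 1 ≤ (x : ℝ) / ε := by rw [one_le_div hε]; exact (not_le.1 h).le
      simp only
      linarith
  rw [integral_sub (integrable_const _) (hx.const_mul _), integral_const, integral_const_mul,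
    smul_eq_mul, mul_one] at h1
  change mass F - 1 / ε * energy F ≤ _ at h1
  rwa [one_div_mul_eq_div] at h1

theorem real_low_eq (μ : Measure ℝ≥0) [IsFiniteMeasure μ] {ε : ℝ} (hε : 0 < ε) (K : ℕ) :
    μ.real (low ε) = μ.real (low (ε / 2 ^ K)) +
      ∑ k ∈ Finset.range K, μ.real (band (ε / 2 ^ k)) := by
  induction K with
  | zero => simp
  | succ K ih =>
    rw [ih, Finset.sum_range_succ]
    have hpos : 0 < ε / 2 ^ K := by positivity
    have e : ε / 2 ^ (K + 1) = ε / 2 ^ K / 2 := by rw [pow_succ]; field_simp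
    have hu : low (ε / 2 ^ K) = low (ε / 2 ^ (K + 1)) ∪ band (ε / 2 ^ K) := by
      rw [e]
      generalize ε / 2 ^ K = d at hpos
      ext x
      simp only [low, band, mem_ofPred_eq, mem_union]
      constructor
      · intro h
        rcases le_or_gt (x : ℝ) (d / 2) with h' | h'
        · exact Or.inl h'
        · exact Or.inr ⟨h', h⟩
      · rintro (h | h)
        · linarith
        · exact h.2
    have hd : Disjoint (low (ε / 2 ^ (K + 1))) (band (ε / 2 ^ K)) := by
      rw [e, Set.disjoint_left]
      intro x h1 h2
      exact absurd h1 (not_le.2 h2.1)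
    rw [hu, measureReal_union hd (measurableSet_band _)]
    ring

/-- The gain at scale `ε 2^(-k)` grows like `2^(2βk)`, because `η - 1 + α = -2β`. -/
theorem gainRate_mul_rpow_scale {b₀ η α β ε : ℝ} (hε : 0 < ε) (hβ : β = (1 - η - α) / 2) (k : ℕ) :
    gainRate b₀ η (ε / 2 ^ k) * (ε / 2 ^ k / 8) ^ α =
      gainRate b₀ η ε * (ε / 8) ^ α * ((2 : ℝ) ^ (-β))⁻¹ ^ k * ((2 : ℝ) ^ (-β))⁻¹ ^ k := by
  have h2 : (0 : ℝ) < 2 ^ k := by positivity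
  have key : (((2 : ℝ) ^ k) ^ η)⁻¹ * (2 : ℝ) ^ k * (((2 : ℝ) ^ k) ^ α)⁻¹ =
      ((2 : ℝ) ^ (-β))⁻¹ ^ k * ((2 : ℝ) ^ (-β))⁻¹ ^ k := by
    rw [Real.rpow_neg (by norm_num) β, inv_inv, ← Real.rpow_natCast ((2 : ℝ) ^ β),
      ← Real.rpow_natCast 2 k, ← Real.rpow_mul (by norm_num), ← Real.rpow_mul (by norm_num),
      ← Real.rpow_mul (by norm_num), ← Real.rpow_neg (by norm_num), ← Real.rpow_neg (by norm_num),
      ← Real.rpow_add (by norm_num), ← Real.rpow_add (by norm_num), ← Real.rpow_add (by norm_num)]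
    congr 1
    rw [hβ]; ring
  unfold gainRate
  rw [show ε / 2 ^ k / 4 = ε / 4 / 2 ^ k by ring, show ε / 2 ^ k / 8 = ε / 8 / 2 ^ k by ring,
    Real.div_rpow (by positivity) h2.le, Real.div_rpow (by positivity) h2.le]
  rw [mul_assoc (27 / 512 * (b₀ * ((ε / 4) ^ η / ε)) * (ε / 8) ^ α), ← key]
  field_simp

/-- While the mass near the origin satisfies a local lower bound, not all the mass can stay in the
dyadic bands: it is driven towards the origin at a rate that blows up as the scale decreases. -/
theorem IsConservativeSolution.exists_sum_band_le (hF : IsConservativeSolution Φ F₀ F)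
    (hB : KernelAssumption B Φ b₀ η) (hN : 0 < mass F₀) (hE : 0 < energy F₀) {α β ε D s τ : ℝ}
    (hβ : β = (1 - η - α) / 2) (hβ0 : 0 < β) (hε : 0 < ε) (hε1 : ε ≤ 1) (hD : 0 ≤ D)
    (hs : 0 ≤ s) (hτ : 0 < τ)
    (hlow : ∀ t ∈ Icc s (s + τ), ∀ δ : ℝ, 0 < δ → δ ≤ ε / 8 → D * δ ^ α ≤ (F t).real (low δ))
    (hnum : Real.exp (lossRate F₀ * τ) * mass F₀ <
      gainRate b₀ η ε * (ε / 8) ^ α * D * (1 - (2 : ℝ) ^ (-β)) ^ 2 * (mass F₀ / 2) ^ 2 * τ)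
    (K : ℕ) :
    ∃ t ∈ Icc s (s + τ), ∑ k ∈ Finset.range K, (F t).real (band (ε / 2 ^ k)) ≤ mass F₀ / 2 := by
  by_contra! hcon
  set r : ℝ := (2 : ℝ) ^ (-β) with hr
  have hr0 : 0 < r := by positivity
  have hr1 : r < 1 := Real.rpow_lt_one_of_one_lt_of_neg (by norm_num) (by linarith)
  set Λ := gainRate b₀ η ε * (ε / 8) ^ α * D with hΛ
  have hΛ0 : 0 ≤ Λ :=
    mul_nonneg (mul_nonneg (hB.gainRate_nonneg hε) (by positivity)) hD
  have hgeom : ∑ k ∈ Finset.range K, r ^ k ≤ 1 / (1 - r) := by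
    rw [geom_sum_eq hr1.ne, ← neg_div_neg_eq, neg_sub, neg_sub]
    exact div_le_div_of_nonneg_right (by linarith [pow_pos hr0 K]) (by linarith)
  have hεk : ∀ k : ℕ, 0 < ε / 2 ^ k ∧ ε / 2 ^ k ≤ ε := fun k =>
    ⟨by positivity, div_le_self hε.le (one_le_pow₀ (by norm_num))⟩
  have hm := hF.mul_sub_le hB hN hE (Finset.range K) (fun k => r ^ k) (fun k => ε / 2 ^ k)
    (fun k _ => by positivity) (fun k _ => (hεk k).1) (fun k _ => (hεk k).2.trans hε1)
    (m := Λ * (1 - r) * (mass F₀ / 2) ^ 2) hs (by linarith : s ≤ s + τ)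
    (mul_nonneg (mul_nonneg hΛ0 (by linarith)) (sq_nonneg _)) ?_
  · rw [add_sub_cancel_left] at hm
    have h1 : ∑ k ∈ Finset.range K, r ^ k * ∫ x : ℝ≥0, cap (ε / 2 ^ k) x ∂(F (s + τ)) ≤
        1 / (1 - r) * mass F₀ := by
      refine le_trans ?_ (mul_le_mul_of_nonneg_right hgeom hN.le)
      rw [Finset.sum_mul]
      refine Finset.sum_le_sum fun k _ => mul_le_mul_of_nonneg_left ?_ (by positivity)
      have := (hF.memB1 (s + τ) (by linarith)).isFiniteMeasure
      refine (integral_cap_le_real_low _ (hεk k).1).trans ?_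
      rw [← hF.mass_eq (s + τ) (by linarith)]
      exact measureReal_mono (subset_univ _)
    have h2 : 0 ≤ ∑ k ∈ Finset.range K, r ^ k * ∫ x : ℝ≥0, cap (ε / 2 ^ k) x ∂(F s) :=
      Finset.sum_nonneg fun k _ => mul_nonneg (by positivity)
        (integral_nonneg fun x => cap_nonneg _ _)
    have h3 : Λ * (1 - r) * (mass F₀ / 2) ^ 2 * τ ≤
        Real.exp (lossRate F₀ * τ) * (1 / (1 - r) * mass F₀) := by
      have := mul_le_mul_of_nonneg_left h1 (Real.exp_pos (lossRate F₀ * τ)).le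
      linarith
    have h4 : 0 < 1 - r := by linarith
    have h5 := mul_le_mul_of_nonneg_left h3 h4.le
    have e : (1 - r) * (Real.exp (lossRate F₀ * τ) * (1 / (1 - r) * mass F₀)) =
        Real.exp (lossRate F₀ * τ) * mass F₀ := by field_simp
    rw [e] at h5
    linarith
  · intro t ht
    have hfin := (hF.memB1 t (hs.trans ht.1)).isFiniteMeasure
    set M : ℕ → ℝ := fun k => (F t).real (band (ε / 2 ^ k)) with hM
    have hcs : (∑ k ∈ Finset.range K, M k) ^ 2 ≤
        (∑ k ∈ Finset.range K, r ^ k) * ∑ k ∈ Finset.range K, r⁻¹ ^ k * M k ^ 2 := by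
      refine Finset.sum_sq_le_sum_mul_sum_of_sq_le_mul _ (fun k _ => by positivity)
        (fun k _ => by positivity) fun k _ => le_of_eq ?_
      rw [← mul_assoc, ← mul_pow, mul_inv_cancel₀ hr0.ne', one_pow, one_mul]
    have hS0 : 0 ≤ ∑ k ∈ Finset.range K, r⁻¹ ^ k * M k ^ 2 :=
      Finset.sum_nonneg fun k _ => by positivity
    have h1 : (1 - r) * (mass F₀ / 2) ^ 2 ≤ ∑ k ∈ Finset.range K, r⁻¹ ^ k * M k ^ 2 := by
      have a1 : (mass F₀ / 2) ^ 2 ≤ (∑ k ∈ Finset.range K, M k) ^ 2 :=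
        pow_le_pow_left₀ (by positivity) (hcon t ht).le 2
      have a2 := (a1.trans hcs).trans (mul_le_mul_of_nonneg_right hgeom hS0)
      have a3 := mul_le_mul_of_nonneg_left a2 (by linarith : 0 ≤ 1 - r)
      rwa [← mul_assoc, mul_one_div_cancel (by linarith : (1 - r) ≠ 0), one_mul] at a3
    calc Λ * (1 - r) * (mass F₀ / 2) ^ 2
        ≤ Λ * ∑ k ∈ Finset.range K, r⁻¹ ^ k * M k ^ 2 := by
          rw [mul_assoc]; exact mul_le_mul_of_nonneg_left h1 hΛ0
      _ ≤ _ := by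
          rw [Finset.mul_sum]
          refine Finset.sum_le_sum fun k _ => ?_
          have h2 := hlow t ht (ε / 2 ^ k / 8) (by positivity) (by linarith [(hεk k).2])
          have h3 := gainRate_mul_rpow_scale (b₀ := b₀) hε hβ k
          rw [← hr] at h3
          have h4 := hB.gainRate_nonneg (hεk k).1
          calc Λ * (r⁻¹ ^ k * M k ^ 2) = r ^ k * (gainRate b₀ η (ε / 2 ^ k) *
                (D * (ε / 2 ^ k / 8) ^ α * M k ^ 2)) := by
                have : r ^ k * r⁻¹ ^ k = 1 := by
                  rw [← mul_pow, mul_inv_cancel₀ hr0.ne', one_pow]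
                rw [show r ^ k * (gainRate b₀ η (ε / 2 ^ k) *
                  (D * (ε / 2 ^ k / 8) ^ α * M k ^ 2)) =
                  r ^ k * (gainRate b₀ η (ε / 2 ^ k) * (ε / 2 ^ k / 8) ^ α) * D * M k ^ 2 by ring,
                  h3, hΛ]
                linear_combination -(gainRate b₀ η ε * (ε / 8) ^ α * D * r⁻¹ ^ k * M k ^ 2) * this
            _ ≤ _ := by gcongr

/-- At the end of a window on which the local lower bound holds, a definite part of the mass is at
the origin. -/
theorem IsConservativeSolution.le_real_singleton_zero (hF : IsConservativeSolution Φ F₀ F)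
    (hB : KernelAssumption B Φ b₀ η) (hN : 0 < mass F₀) (hE : 0 < energy F₀) {α β ε D s τ : ℝ}
    (hβ : β = (1 - η - α) / 2) (hβ0 : 0 < β) (hε : 0 < ε) (hε1 : ε ≤ 1) (hD : 0 ≤ D)
    (hs : 0 ≤ s) (hτ : 0 < τ)
    (hlow : ∀ t ∈ Icc s (s + τ), ∀ δ : ℝ, 0 < δ → δ ≤ ε / 8 → D * δ ^ α ≤ (F t).real (low δ))
    (hnum : Real.exp (lossRate F₀ * τ) * mass F₀ <
      gainRate b₀ η ε * (ε / 8) ^ α * D * (1 - (2 : ℝ) ^ (-β)) ^ 2 * (mass F₀ / 2) ^ 2 * τ)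
    (hEε : energy F₀ / ε ≤ mass F₀ / 6) :
    mass F₀ / 3 ≤ Real.exp (lossRate F₀ * τ) * (F (s + τ)).real {0} := by
  have hfin := (hF.memB1 (s + τ) (by linarith)).isFiniteMeasure
  have hexp := Real.exp_pos (lossRate F₀ * τ)
  rw [mul_comm, ← div_le_iff₀ hexp]
  refine BoseBoltzmann.le_real_singleton_zero _ fun δ hδ hδ1 => ?_
  rw [div_le_iff₀ hexp, mul_comm]
  -- `θ` is the ratio between the scale that the mass has reached and that of the test function
  have hθ : ∀ θ ∈ Ioo (0 : ℝ) 1, (1 - θ) ^ 3 * (mass F₀ / 3) ≤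
      Real.exp (lossRate F₀ * τ) * ∫ x : ℝ≥0, cap δ x ∂(F (s + τ)) := by
    intro θ hθ
    obtain ⟨K, hK⟩ := exists_pow_lt_of_lt_one (show 0 < θ * δ / ε from
      div_pos (mul_pos hθ.1 hδ) hε) (by norm_num : (1 / 2 : ℝ) < 1)
    have hK' : ε / 2 ^ K ≤ θ * δ := by
      rw [lt_div_iff₀ hε, one_div, inv_pow] at hK
      rw [div_eq_inv_mul]
      exact hK.le
    obtain ⟨t, ht, hsum⟩ := hF.exists_sum_band_le hB hN hE hβ hβ0 hε hε1 hD hs hτ hlow hnum K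
    have ht0 : 0 ≤ t := hs.trans ht.1
    have hft := (hF.memB1 t ht0).isFiniteMeasure
    have h1 := (hF.memB1 t ht0).le_real_low hε
    rw [hF.mass_eq t ht0, hF.energy_eq t ht0, real_low_eq (F t) hε K] at h1
    have h2 : (F t).real (low (ε / 2 ^ K)) ≤ (F t).real (low (θ * δ)) :=
      measureReal_mono fun x hx => le_trans hx hK'
    have h3 : mass F₀ / 3 ≤ (F t).real (low (θ * δ)) := by linarith
    have h4 := mul_real_low_le_integral_cap (F t) hδ hθ.2.le
    have h5 := hF.integral_cap_le hB hN hE hδ hδ1 ht0 ht.2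
    calc (1 - θ) ^ 3 * (mass F₀ / 3) ≤ (1 - θ) ^ 3 * (F t).real (low (θ * δ)) :=
          mul_le_mul_of_nonneg_left h3 (pow_nonneg (by linarith [hθ.2]) 3)
      _ ≤ _ := h4.trans (h5.trans ?_)
    refine mul_le_mul_of_nonneg_right (Real.exp_le_exp.2 ?_)
      (integral_nonneg fun x => cap_nonneg _ _)
    exact mul_le_mul_of_nonneg_left (by linarith [ht.1]) (Real.sqrt_nonneg _)
  have hlim : Filter.Tendsto (fun θ : ℝ => (1 - θ) ^ 3 * (mass F₀ / 3)) (nhdsWithin 0 (Ioi 0))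
      (nhds (mass F₀ / 3)) := by
    have hc : Continuous fun θ : ℝ => (1 - θ) ^ 3 * (mass F₀ / 3) := by fun_prop
    have := (hc.tendsto 0).mono_left (nhdsWithin_le_nhds (s := Ioi (0 : ℝ)))
    simpa using this
  refine le_of_tendsto hlim ?_
  filter_upwards [Ioo_mem_nhdsGT (zero_lt_one (α := ℝ))] with θ h using hθ θ h

theorem IsConservativeSolution.real_singleton_zero_mono (hF : IsConservativeSolution Φ F₀ F)
    (hB : KernelAssumption B Φ b₀ η) (hN : 0 < mass F₀) (hE : 0 < energy F₀) {s T : ℝ}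
    (hs : 0 ≤ s) (hsT : s ≤ T) :
    (F s).real {0} ≤ Real.exp (lossRate F₀ * (T - s)) * (F T).real {0} := by
  have h1 := (hF.memB1 s hs).isFiniteMeasure
  have h2 := (hF.memB1 T (hs.trans hsT)).isFiniteMeasure
  have hexp := Real.exp_pos (lossRate F₀ * (T - s))
  rw [mul_comm, ← div_le_iff₀ hexp]
  refine BoseBoltzmann.le_real_singleton_zero _ fun δ hδ hδ1 => ?_
  rw [div_le_iff₀ hexp, mul_comm]
  exact (real_singleton_zero_le_integral_cap (F s) hδ).trans
    (hF.integral_cap_le hB hN hE hδ hδ1 hs hsT)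

/-- Once the local lower bound holds on two consecutive time windows it holds forever: at the end
of every window a third of the mass, up to a factor `√2`, sits at the origin. -/
theorem IsConservativeSolution.le_real_singleton_zero_of_window
    (hF : IsConservativeSolution Φ F₀ F)
    (hB : KernelAssumption B Φ b₀ η) (hN : 0 < mass F₀) (hE : 0 < energy F₀) {α β ε D τ : ℝ}
    (hβ : β = (1 - η - α) / 2) (hβ0 : 0 < β) (hε : 0 < ε) (hε1 : ε ≤ 1) (hD : 0 ≤ D)
    (hτ : 0 < τ) (hτe : Real.exp (lossRate F₀ * τ) = Real.sqrt 2)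
    (hlow : ∀ t ∈ Icc 0 (2 * τ), ∀ δ : ℝ, 0 < δ → δ ≤ ε / 8 → D * δ ^ α ≤ (F t).real (low δ))
    (hDN : ∀ δ : ℝ, 0 < δ → δ ≤ ε / 8 → D * δ ^ α ≤ mass F₀ / 6)
    (hnum : Real.exp (lossRate F₀ * τ) * mass F₀ <
      gainRate b₀ η ε * (ε / 8) ^ α * D * (1 - (2 : ℝ) ^ (-β)) ^ 2 * (mass F₀ / 2) ^ 2 * τ)
    (hEε : energy F₀ / ε ≤ mass F₀ / 6) {t : ℝ} (ht : τ ≤ t) :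
    mass F₀ / 3 ≤ Real.sqrt 2 * (F t).real {0} := by
  have hstep : ∀ R : ℝ, (∀ t ∈ Icc 0 R, ∀ δ : ℝ, 0 < δ → δ ≤ ε / 8 →
      D * δ ^ α ≤ (F t).real (low δ)) → ∀ t ∈ Icc τ R,
      mass F₀ / 3 ≤ Real.sqrt 2 * (F t).real {0} := by
    intro R hR t ht
    have := hF.le_real_singleton_zero hB hN hE (s := t - τ) hβ hβ0 hε hε1 hD
      (by linarith [ht.1]) hτ (fun t' ht' => hR t' ⟨by linarith [ht.1, ht'.1], by
        linarith [ht.2, ht'.2]⟩) hnum hEε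
    rwa [hτe, sub_add_cancel] at this
  have hall : ∀ n : ℕ, ∀ t ∈ Icc 0 ((n + 2) * τ), ∀ δ : ℝ, 0 < δ → δ ≤ ε / 8 →
      D * δ ^ α ≤ (F t).real (low δ) := by
    intro n
    induction n with
    | zero => simpa using hlow
    | succ n ih =>
      intro t ht δ hδ hδε
      by_cases h : t ≤ (n + 2) * τ
      · exact ih t ⟨ht.1, h⟩ δ hδ hδε
      push Not at h
      have hfin := (hF.memB1 t ht.1).isFiniteMeasure
      have hn : (0 : ℝ) ≤ n := n.cast_nonneg
      have hnτ : 0 ≤ (n : ℝ) * τ := mul_nonneg hn hτ.le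
      have h1 := hstep _ ih ((n + 2) * τ) ⟨by linarith, le_rfl⟩
      have h2 := hF.real_singleton_zero_mono hB hN hE (s := (n + 2) * τ) (by linarith) h.le
      have h3 : Real.exp (lossRate F₀ * (t - (n + 2) * τ)) ≤ Real.sqrt 2 := by
        rw [← hτe]
        refine Real.exp_le_exp.2 (mul_le_mul_of_nonneg_left ?_ (Real.sqrt_nonneg _))
        have := ht.2
        push_cast at this
        linarith
      have h4 : (F t).real {0} ≤ (F t).real (low δ) := by
        rw [← low_zero]
        exact measureReal_mono fun x hx => le_trans hx hδ.le
      have h5 : (F ((n + 2) * τ)).real {0} ≤ Real.sqrt 2 * (F t).real {0} :=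
        h2.trans (mul_le_mul_of_nonneg_right h3 measureReal_nonneg)
      have h6 := mul_le_mul_of_nonneg_left h5 (Real.sqrt_nonneg 2)
      rw [← mul_assoc, Real.mul_self_sqrt (by norm_num)] at h6
      linarith [hDN δ hδ hδε]
  obtain ⟨n, hn⟩ := exists_nat_ge (t / τ)
  rw [div_le_iff₀ hτ] at hn
  exact hstep _ (hall n) t ⟨ht, by nlinarith⟩

/-! ### The constants -/

theorem rpow_neg_three_halves {x : ℝ} (hx : 0 < x) : x ^ (-(3 / 2) : ℝ) = 1 / (x * Real.sqrt x) := by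
  rw [Real.rpow_neg hx.le, Real.sqrt_eq_rpow, show (3 / 2 : ℝ) = 1 + 1 / 2 by norm_num,
    Real.rpow_add hx, Real.rpow_one, one_div (x * _)]

theorem rpow_neg_five_halves {x : ℝ} (hx : 0 < x) :
    x ^ (-(5 / 2) : ℝ) = 1 / (x ^ 2 * Real.sqrt x) := by
  rw [Real.rpow_neg hx.le, Real.sqrt_eq_rpow, show (5 / 2 : ℝ) = (2 : ℕ) + 1 / 2 by norm_num,
    Real.rpow_add hx, Real.rpow_natCast, one_div (x ^ 2 * _)]

/-- The midpoint rule for the convex function `x ↦ x^{-3/2}` on `[x - 1/2, x + 1/2]`. -/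
theorem rpow_neg_three_halves_le {x : ℝ} (hx : 1 ≤ x) :
    x ^ (-(3 / 2) : ℝ) ≤ 2 / Real.sqrt (x - 1 / 2) - 2 / Real.sqrt (x + 1 / 2) := by
  rw [rpow_neg_three_halves (by linarith)]
  set a := Real.sqrt (x - 1 / 2) with ha
  set b := Real.sqrt (x + 1 / 2) with hb
  set c := Real.sqrt x with hc
  have ha2 : a ^ 2 = x - 1 / 2 := Real.sq_sqrt (by linarith)
  have hb2 : b ^ 2 = x + 1 / 2 := Real.sq_sqrt (by linarith)
  have hc2 : c ^ 2 = x := Real.sq_sqrt (by linarith)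
  have ha0 : 0 < a := Real.sqrt_pos.2 (by linarith)
  have hb0 : 0 < b := Real.sqrt_pos.2 (by linarith)
  have hc0 : 0 < c := Real.sqrt_pos.2 (by linarith)
  have h1 : a * b ≤ x := by nlinarith [sq_nonneg (a - b)]
  have h2 : a + b ≤ 2 * c := by
    refine le_of_sq_le_sq ?_ (by positivity)
    nlinarith
  have e : 2 / a - 2 / b = 2 / (a * b * (a + b)) := by
    have : (b - a) * (a + b) = 1 := by linear_combination hb2 - ha2
    field_simp
    linear_combination this
  rw [e, div_le_div_iff₀ (by positivity) (by positivity), one_mul]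
  calc a * b * (a + b) ≤ x * (2 * c) := mul_le_mul h1 h2 (by positivity) (by linarith)
    _ = 2 * (x * c) := by ring

theorem zetaReal_three_halves_le : zetaReal (3 / 2) ≤ 2.6331 := by
  have hpart : ∀ n : ℕ, ∑ i ∈ Finset.range (n + 1), ((i : ℝ) + 1) ^ (-(3 / 2) : ℝ) ≤
      1 + 2 / Real.sqrt (3 / 2) - 2 / Real.sqrt ((n : ℝ) + 3 / 2) := by
    intro n
    induction n with
    | zero => norm_num
    | succ n ih =>
      rw [Finset.sum_range_succ]
      have h := rpow_neg_three_halves_le (x := (n : ℝ) + 2) (by linarith [n.cast_nonneg (α := ℝ)])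
      have e1 : (n : ℝ) + 2 - 1 / 2 = n + 3 / 2 := by ring
      have e2 : (n : ℝ) + 2 + 1 / 2 = n + 1 + 3 / 2 := by ring
      have e3 : (n : ℝ) + 1 + 1 = n + 2 := by ring
      rw [e1, e2] at h
      push_cast
      rw [e3]
      linarith
  have hs : (1.2247 : ℝ) ≤ Real.sqrt (3 / 2) := Real.le_sqrt_of_sq_le (by norm_num)
  have h2 : 2 / Real.sqrt (3 / 2) ≤ 1.6331 := by
    rw [div_le_iff₀ (by positivity)]
    linarith
  unfold zetaReal
  refine Real.tsum_le_of_sum_range_le (fun n => by positivity) fun n => ?_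
  have h3 := hpart n
  rw [Finset.sum_range_succ] at h3
  have h4 : (0 : ℝ) ≤ ((n : ℝ) + 1) ^ (-(3 / 2) : ℝ) := by positivity
  have h5 : 0 ≤ 2 / Real.sqrt ((n : ℝ) + 3 / 2) := by positivity
  linarith

theorem le_zetaReal_five_halves : 1.272 ≤ zetaReal (5 / 2) := by
  have hsum : Summable fun n : ℕ => ((n : ℝ) + 1) ^ (-(5 / 2) : ℝ) := by
    have h := (Real.summable_nat_rpow (p := -(5 / 2))).2 (by norm_num)
    have := (summable_nat_add_iff 1).2 h
    simpa using this
  have h := hsum.sum_le_tsum (Finset.range 4) fun n _ => by positivity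
  have h2 : (1.272 : ℝ) ≤ ∑ n ∈ Finset.range 4, ((n : ℝ) + 1) ^ (-(5 / 2) : ℝ) := by
    simp only [Finset.sum_range_succ, Finset.sum_range_zero]
    norm_num only [Nat.cast_zero, Nat.cast_one, Nat.cast_ofNat]
    have e2 := rpow_neg_five_halves (x := 2) (by norm_num)
    have e3 := rpow_neg_five_halves (x := 3) (by norm_num)
    have s2 : Real.sqrt 2 ≤ 1.4143 := by rw [Real.sqrt_le_left (by norm_num)]; norm_num
    have s3 : Real.sqrt 3 ≤ 1.7321 := by rw [Real.sqrt_le_left (by norm_num)]; norm_num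
    have k2 : (0.1767 : ℝ) ≤ 1 / (2 ^ 2 * Real.sqrt 2) := by
      rw [le_div_iff₀ (by positivity)]; linarith
    have k3 : (0.0641 : ℝ) ≤ 1 / (3 ^ 2 * Real.sqrt 3) := by
      rw [le_div_iff₀ (by positivity)]; linarith
    norm_num only at e2 e3 ⊢
    rw [e2, e3]
    norm_num only at k2 k3 ⊢
    linarith
  exact h2.trans h

/-- Bernoulli's inequality for `(5/7)^(2β)`, as `1/√2 ≤ 5/7`. -/
theorem four_sevenths_mul_le {β : ℝ} (h0 : 0 ≤ β) (h1 : β ≤ 1 / 2) :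
    4 / 7 * β ≤ 1 - (2 : ℝ) ^ (-β) := by
  have e : (2 : ℝ) ^ (-β) = (1 / Real.sqrt 2) ^ (2 * β) := by
    rw [Real.sqrt_eq_rpow, one_div, ← Real.rpow_neg (by norm_num), ← Real.rpow_mul (by norm_num)]
    congr 1; ring
  have h2 : 1 / Real.sqrt 2 ≤ 1 + (-(2 / 7)) := by
    rw [div_le_iff₀ (by positivity)]
    have : (1.4 : ℝ) ≤ Real.sqrt 2 := Real.le_sqrt_of_sq_le (by norm_num)
    linarith
  have h3 := Real.rpow_le_rpow (by positivity) h2 (by linarith : 0 ≤ 2 * β)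
  have h4 := rpow_one_add_le_one_add_mul_self (s := -(2 / 7 : ℝ)) (by norm_num)
    (by linarith : 0 ≤ 2 * β) (by linarith)
  rw [e]
  linarith

/-- From `eˣ ≥ e x` at `x = β log 16`. -/
theorem mul_le_sixteen_rpow (β : ℝ) (h0 : 0 ≤ β) : 7.5 * β ≤ (16 : ℝ) ^ β := by
  have hl : Real.log 16 = 4 * Real.log 2 := by
    rw [show (16 : ℝ) = 2 ^ 4 by norm_num, Real.log_pow]; norm_num
  rw [Real.rpow_def_of_pos (by norm_num), hl]
  have h1 := Real.add_one_le_exp (4 * Real.log 2 * β - 1)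
  have h2 : Real.exp (4 * Real.log 2 * β) = Real.exp 1 * Real.exp (4 * Real.log 2 * β - 1) := by
    rw [← Real.exp_add]; congr 1; ring
  have h3 := Real.log_two_gt_d9
  have h4 := Real.exp_one_gt_d9
  rw [h2]
  calc 7.5 * β ≤ 2.718 * (4 * 0.693 * β) := by linarith
    _ ≤ Real.exp 1 * Real.exp (4 * Real.log 2 * β - 1) := by
      refine mul_le_mul (by linarith) ?_ (by positivity) (by positivity)
      refine le_trans ?_ h1
      have := mul_le_mul_of_nonneg_right (by linarith : (4 * 0.693 : ℝ) ≤ 4 * Real.log 2) h0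
      linarith

/-- The constant in the local condition is large enough for all admissible exponents. As
`p/β ≥ 3/(2β) ≥ 3`, the factor `(p/β)^(2α)` absorbs `4^α`, and `(p/β)³` absorbs the factor of
order `β²` lost in summing over scales. -/
theorem one_lt_of_exponents {α β η p : ℝ} (hα : 0 ≤ α) (hη : 0 ≤ η) (hβ : β = (1 - η - α) / 2)
    (hβ0 : 0 < β) (hp : p = 3 / 2 + α) :
    1 < 9 / 16 * ((4 : ℝ) ^ η)⁻¹ * ((16 : ℝ) ^ α)⁻¹ * (p / β) ^ (2 * p) *
      (1 - (2 : ℝ) ^ (-β)) ^ 2 := by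
  have hβ1 : β ≤ 1 / 2 := by linarith
  have h1 := four_sevenths_mul_le hβ0.le hβ1
  have h2 := mul_le_sixteen_rpow β hβ0.le
  have hpβ : 3 / 2 / β ≤ p / β := div_le_div_of_nonneg_right (by linarith) hβ0.le
  have h3 : 3 ≤ 3 / 2 / β := by rw [le_div_iff₀ hβ0]; linarith
  have hpos : 0 < p / β := by linarith
  have h4 : (3 / 2 / β) ^ 3 * (4 : ℝ) ^ α ≤ (p / β) ^ (2 * p) := by
    have e : (p / β) ^ (2 * p) = (p / β) ^ 3 * ((p / β) ^ 2) ^ α := by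
      rw [← Real.rpow_natCast (p / β) 3, ← Real.rpow_natCast (p / β) 2, ← Real.rpow_mul hpos.le,
        ← Real.rpow_add hpos]
      congr 1
      rw [hp]; push_cast; ring
    rw [e]
    refine mul_le_mul (pow_le_pow_left₀ (by positivity) hpβ 3) ?_ (by positivity) (by positivity)
    exact Real.rpow_le_rpow (by norm_num) (by nlinarith) hα
  have e : ((4 : ℝ) ^ η)⁻¹ * ((16 : ℝ) ^ α)⁻¹ * (4 : ℝ) ^ α = (16 : ℝ) ^ β / 4 := by
    have e16 : (16 : ℝ) = (4 : ℝ) ^ (2 : ℝ) := by norm_num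
    rw [e16, ← Real.rpow_mul (by norm_num), ← Real.rpow_mul (by norm_num),
      ← Real.rpow_neg (by norm_num), ← Real.rpow_neg (by norm_num), ← Real.rpow_add (by norm_num),
      ← Real.rpow_add (by norm_num)]
    rw [← Real.rpow_sub_one (by norm_num)]
    congr 1
    rw [hβ]; ring
  calc (1 : ℝ) < 9 / 16 * (7.5 * β / 4) * (3 / 2 / β) ^ 3 * (4 / 7 * β) ^ 2 := by
        have : 9 / 16 * (7.5 * β / 4) * (3 / 2 / β) ^ 3 * (4 / 7 * β) ^ 2 =
            9 / 16 * (7.5 / 4) * (3 / 2) ^ 3 * (4 / 7) ^ 2 := by field_simp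
        rw [this]; norm_num
    _ ≤ 9 / 16 * ((16 : ℝ) ^ β / 4) * (3 / 2 / β) ^ 3 * (1 - (2 : ℝ) ^ (-β)) ^ 2 := by
        gcongr
    _ = 9 / 16 * ((4 : ℝ) ^ η)⁻¹ * ((16 : ℝ) ^ α)⁻¹ * ((3 / 2 / β) ^ 3 * (4 : ℝ) ^ α) *
        (1 - (2 : ℝ) ^ (-β)) ^ 2 := by rw [← e]; ring
    _ ≤ _ := by gcongr

/-- The constant in the local condition, as a function of the specific energy `e = E/N`. -/
def localConst (b₀ α β p e : ℝ) : ℝ :=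
  (2 : ℝ) ^ (9.5 + α) * (4 * p) ^ (2 * β) / (Real.log 2 * b₀) * (p / β) ^ (2 * p) *
    e ^ (1 / 2 + 2 * β)

theorem localConst_eq {b₀ α β p e : ℝ} (hp : 0 < p) (he : 0 < e) :
    localConst b₀ α β p e = 512 * Real.sqrt 2 * (2 : ℝ) ^ α * (4 * p * e) ^ (2 * β) * Real.sqrt e *
      (p / β) ^ (2 * p) / (Real.log 2 * b₀) := by
  unfold localConst
  rw [Real.rpow_add he, Real.mul_rpow (by positivity) he.le, Real.sqrt_eq_rpow e,
    Real.rpow_add (by norm_num), show (9.5 : ℝ) = (9 : ℕ) + 1 / 2 by norm_num,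
    Real.rpow_add (by norm_num), Real.rpow_natCast, ← Real.sqrt_eq_rpow]
  ring

theorem LocalCondition.mul_rpow_le {b₀ η α : ℝ} {F₀ : Measure ℝ≥0}
    (h : LocalCondition b₀ η α F₀) {ε : ℝ} (hε : 0 < ε) (hε1 : ε ≤ 1 / 2) :
    localConst b₀ α ((1 - η - α) / 2) (3 / 2 + α) (energy F₀ / mass F₀) * ε ^ α ≤
      F₀.real (low ε) := by
  have h1 : localConst b₀ α ((1 - η - α) / 2) (3 / 2 + α) (energy F₀ / mass F₀) ≤
      ⨅ ε : Set.Ioc (0 : ℝ) (1 / 2), F₀.real {x : ℝ≥0 | (x : ℝ) ≤ ε} / (ε : ℝ) ^ α := h.2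
  have h2 := h1.trans (ciInf_le ⟨0, by
    rintro _ ⟨ε, rfl⟩
    exact div_nonneg measureReal_nonneg (Real.rpow_nonneg ε.2.1.le _)⟩ ⟨ε, hε, hε1⟩)
  exact (le_div_iff₀ (Real.rpow_pos_of_pos hε α)).1 h2

/-- All powers of the scale `ε = 4pE/N` and of `E/N` cancel, which leaves `one_lt_of_exponents`. -/
theorem gain_dominates {b₀ η α β p e N : ℝ} (hb₀ : 0 < b₀) (hα : 0 ≤ α) (hη : 0 ≤ η)
    (hβ : β = (1 - η - α) / 2) (hβ0 : 0 < β) (hp : p = 3 / 2 + α) (he : 0 < e) (hN : 0 < N) :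
    Real.sqrt 2 * N < gainRate b₀ η (4 * p * e) * (4 * p * e / 8) ^ α *
      (localConst b₀ α β p e / (6 * (4 : ℝ) ^ α)) * (1 - (2 : ℝ) ^ (-β)) ^ 2 * (N / 2) ^ 2 *
      (Real.log 2 / (2 * (N * Real.sqrt e))) := by
  have key := one_lt_of_exponents hα hη hβ hβ0 hp
  have hp0 : 0 < p := by linarith
  have hl := Real.log_pos (one_lt_two (α := ℝ))
  have hs := Real.sqrt_pos.2 he
  rw [localConst_eq hp0 he]
  unfold gainRate
  have hε : 0 < 4 * p * e := by positivity
  revert hε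
  generalize 4 * p * e = ε
  intro hε
  rw [Real.div_rpow hε.le (by norm_num), Real.div_rpow hε.le (by norm_num)]
  have e1 : ε ^ η / ε * ε ^ α * ε ^ (2 * β) = 1 := by
    nth_rewrite 2 [← Real.rpow_one ε]
    rw [← Real.rpow_sub hε, ← Real.rpow_add hε, ← Real.rpow_add hε, hβ]
    rw [show η - 1 + α + 2 * ((1 - η - α) / 2) = 0 by ring, Real.rpow_zero]
  have e2 : (8 : ℝ) ^ α * (4 : ℝ) ^ α = (2 : ℝ) ^ α * (16 : ℝ) ^ α := by
    rw [← Real.mul_rpow (by norm_num) (by norm_num), ← Real.mul_rpow (by norm_num) (by norm_num)]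
    norm_num
  have h2 : (0 : ℝ) < 2 ^ α := by positivity
  have h4 : (0 : ℝ) < 4 ^ α := by positivity
  have h8 : (0 : ℝ) < 8 ^ α := by positivity
  have h16 : (0 : ℝ) < 16 ^ α := by positivity
  have h4η : (0 : ℝ) < 4 ^ η := by positivity
  generalize (p / β) ^ (2 * p) = P at *
  generalize (1 - (2 : ℝ) ^ (-β)) ^ 2 = Q at *
  have e3 : 27 / 512 * (b₀ * (ε ^ η / 4 ^ η / ε)) * (ε ^ α / 8 ^ α) *
      (512 * Real.sqrt 2 * 2 ^ α * ε ^ (2 * β) * Real.sqrt e * P / (Real.log 2 * b₀) /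
        (6 * 4 ^ α)) * Q * (N / 2) ^ 2 * (Real.log 2 / (2 * (N * Real.sqrt e))) =
      Real.sqrt 2 * N * (9 / 16 * ((4 : ℝ) ^ η)⁻¹ * ((16 : ℝ) ^ α)⁻¹ * P * Q) *
        (ε ^ η / ε * ε ^ α * ε ^ (2 * β)) := by
    have e4 : ((16 : ℝ) ^ α)⁻¹ = 2 ^ α / (8 ^ α * 4 ^ α) := by
      rw [e2]; field_simp
    rw [e4]
    field_simp
    ring
  rw [e3, e1, mul_one]
  exact lt_mul_of_one_lt_right (by positivity) key

/-! ### Temperature and condensation -/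

theorem LocalCondition.le_mass {b₀ η α : ℝ} (h : LocalCondition b₀ η α F₀) (hF₀ : MemB1 F₀) :
    localConst b₀ α ((1 - η - α) / 2) (3 / 2 + α) (energy F₀ / mass F₀) * (1 / 2) ^ α ≤
      mass F₀ := by
  have := hF₀.isFiniteMeasure
  exact (h.mul_rpow_le (by norm_num) le_rfl).trans (measureReal_mono (subset_univ _))

/-- The lower bound on the mass that the local condition forces, squared so as to be polynomial
in the specific energy. -/
theorem LocalCondition.mass_sq_ge {α : ℝ} (h : LocalCondition b₀ η α F₀) (hF₀ : MemB1 F₀)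
    (hb₀ : 0 < b₀) (hη : 0 ≤ η) (hα : 0 ≤ α) (hα₁ : α < 1 - η)
    (hN : 0 < mass F₀) (hE : 0 < energy F₀) :
    2 ^ 19 * 36 * 729 / Real.log 2 ^ 2 * (energy F₀ / mass F₀) ^ 3 ≤
      b₀ ^ 2 * (1 - η) ^ 6 * mass F₀ ^ 2 := by
  have h1 := h.le_mass hF₀
  have h0 := h.1
  set e := energy F₀ / mass F₀ with he
  have he0 : 0 < e := div_pos hE hN
  set β := (1 - η - α) / 2 with hβ
  set p := 3 / 2 + α with hp
  have hp0 : 0 < p := by linarith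
  have hβ0 : 0 < β := by rw [hβ]; linarith
  have hl := Real.log_pos (one_lt_two (α := ℝ))
  have hη1 : 0 < 1 - η := by linarith
  change e ≤ 1 / (4 * p) at h0
  rw [le_div_iff₀ (by positivity)] at h0
  rw [localConst_eq hp0 he0] at h1
  have h2 : (6 * e) ≤ (4 * p * e) ^ (2 * β) := by
    calc 6 * e ≤ 4 * p * e := by nlinarith
      _ = (4 * p * e) ^ (1 : ℝ) := (Real.rpow_one _).symm
      _ ≤ _ := Real.rpow_le_rpow_of_exponent_ge (by positivity) (by linarith)
        (by rw [hβ]; linarith)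
  have h3 : (3 / (1 - η)) ^ 3 ≤ (p / β) ^ (2 * p) := by
    have a1 : 3 / (1 - η) ≤ p / β := by
      rw [div_le_div_iff₀ hη1 hβ0, hβ, hp]
      nlinarith
    have a2 : 1 ≤ p / β := by
      rw [one_le_div hβ0, hβ, hp]; linarith
    calc (3 / (1 - η)) ^ 3 ≤ (p / β) ^ 3 := pow_le_pow_left₀ (by positivity) a1 3
      _ = (p / β) ^ (3 : ℝ) := by norm_cast
      _ ≤ _ := Real.rpow_le_rpow_of_exponent_le a2 (by rw [hp]; linarith)
  have e2 : (2 : ℝ) ^ α * (1 / 2) ^ α = 1 := by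
    rw [← Real.mul_rpow (by norm_num) (by norm_num)]; norm_num
  have h4 : 512 * Real.sqrt 2 * (6 * e) * Real.sqrt e * (3 / (1 - η)) ^ 3 / (Real.log 2 * b₀) ≤
      mass F₀ := by
    refine le_trans ?_ h1
    rw [show ∀ a b c d f g : ℝ, a * b * c * d * f / g * (1 / 2) ^ α =
      a * (b * (1 / 2) ^ α) * c * d * f / g by intros; ring, e2, mul_one]
    gcongr
  have h5 := pow_le_pow_left₀ (by positivity) h4 2
  have e5 : (512 * Real.sqrt 2 * (6 * e) * Real.sqrt e * (3 / (1 - η)) ^ 3 /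
      (Real.log 2 * b₀)) ^ 2 = 2 ^ 19 * 36 * 729 / Real.log 2 ^ 2 * e ^ 3 /
        (b₀ ^ 2 * (1 - η) ^ 6) := by
    have s2 : Real.sqrt 2 ^ 2 = 2 := Real.sq_sqrt (by norm_num)
    have se : Real.sqrt e ^ 2 = e := Real.sq_sqrt he0.le
    rw [div_pow, mul_pow, mul_pow, mul_pow, mul_pow, s2, se]
    field_simp
    ring
  rw [e5, div_le_iff₀ (by positivity)] at h5
  linarith

theorem LocalCondition.kineticTemp_div_lt {α : ℝ} (h : LocalCondition b₀ η α F₀) (hF₀ : MemB1 F₀)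
    (hb₀ : 0 < b₀) (hη : 0 ≤ η) (hα : 0 ≤ α) (hα₁ : α < 1 - η)
    (hN : 0 < mass F₀) (hE : 0 < energy F₀) {m kB : ℝ} (hm : 0 < m) (hkB : 0 < kB) :
    kineticTemp m kB F₀ / criticalTemp m kB F₀ <
        8 * (10 : ℝ) ^ (-4 : ℤ) * b₀ ^ (2 / 3 : ℝ) * (1 - η) ^ 2 := by
  have h1 := h.mass_sq_ge hF₀ hb₀ hη hα hα₁ hN hE
  have hη1 : 0 < 1 - η := by linarith
  have hpi := Real.pi_pos
  set e := energy F₀ / mass F₀ with he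
  have he0 : 0 < e := div_pos hE hN
  set N := mass F₀ with hNdef
  have hz3 := zetaReal_three_halves_le
  have hz5 := le_zetaReal_five_halves
  have hz30 : 0 ≤ zetaReal (3 / 2) := tsum_nonneg fun n => by positivity
  set A := zetaReal (3 / 2) with hA
  set C := zetaReal (5 / 2) with hC
  have hC0 : 0 < C := by linarith
  have cube : ∀ x : ℝ, 0 ≤ x → ∀ y : ℝ, (x ^ y) ^ 3 = x ^ (y * 3) := fun x hx y => by
    rw [← Real.rpow_natCast, ← Real.rpow_mul hx]; norm_num
  have hL : kineticTemp m kB F₀ / criticalTemp m kB F₀ =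
      e * ((2 * Real.pi) ^ (1 / 3 : ℝ) * A ^ (5 / 3 : ℝ)) / (3 * C * N ^ (2 / 3 : ℝ)) := by
    unfold kineticTemp criticalTemp
    rw [← hNdef, ← he, ← hA, ← hC]
    rw [show C / ((2 * Real.pi) ^ (1 / 3 : ℝ) * A ^ (5 / 3 : ℝ)) * (2 * m / kB) * N ^ (2 / 3 : ℝ) =
      (2 * m / kB) * (C * N ^ (2 / 3 : ℝ) / ((2 * Real.pi) ^ (1 / 3 : ℝ) * A ^ (5 / 3 : ℝ))) by ring,
      show 2 * m / (3 * kB) * e = (2 * m / kB) * (e / 3) by ring,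
      mul_div_mul_left _ _ (by positivity), div_div_eq_mul_div, ← mul_div_right_comm, div_div]
    congr 1
    ring
  rw [hL]
  -- cubing removes the fractional powers
  refine lt_of_pow_lt_pow_left₀ 3 (by positivity) ?_
  rw [div_pow, mul_pow, mul_pow, mul_pow, mul_pow, mul_pow, mul_pow, mul_pow,
    cube _ (by positivity), cube _ hz30, cube _ hN.le, cube _ hb₀.le]
  norm_num only
  rw [Real.rpow_one, div_lt_iff₀ (by positivity)]
  have n2 : N ^ (2 : ℝ) = N ^ 2 := by norm_cast
  have b2 : b₀ ^ (2 : ℝ) = b₀ ^ 2 := by norm_cast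
  have a5 : A ^ (5 : ℝ) = A ^ 5 := by norm_cast
  rw [n2, b2, a5]
  have hA5 : A ^ 5 ≤ 2.6331 ^ 5 := pow_le_pow_left₀ hz30 hz3 5
  have hC3 : 1.272 ^ 3 ≤ C ^ 3 := pow_le_pow_left₀ (by norm_num) hz5 3
  have hl := Real.log_pos (one_lt_two (α := ℝ))
  have hl2 : Real.log 2 ^ 2 ≤ 0.69315 ^ 2 :=
    pow_le_pow_left₀ hl.le (by linarith [Real.log_two_lt_d9]) 2
  have hpi2 := Real.pi_lt_d4
  have hfinal : 2 * Real.pi * A ^ 5 < 27 * C ^ 3 * (512 / 1000000000000) *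
      (2 ^ 19 * 36 * 729 / Real.log 2 ^ 2) := by
    calc 2 * Real.pi * A ^ 5 ≤ 2 * 3.1416 * 2.6331 ^ 5 := by gcongr
      _ < 27 * 1.272 ^ 3 * (512 / 1000000000000) * (2 ^ 19 * 36 * 729 / 0.69315 ^ 2) := by norm_num
      _ ≤ _ := by gcongr
  have h2 := mul_lt_mul_of_pos_right hfinal (by positivity : 0 < e ^ 3)
  have h3 := mul_le_mul_of_nonneg_left h1 (by positivity : 0 ≤ 27 * C ^ 3 * (512 / 1000000000000))
  norm_num at h2 h3 ⊢
  linarith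

theorem exp_half_log_two : Real.exp (Real.log 2 / 2) = Real.sqrt 2 := by
  rw [Real.sqrt_eq_rpow, Real.rpow_def_of_pos (by norm_num)]
  congr 1
  ring

theorem IsConservativeSolution.mass_div_eight_le (hF : IsConservativeSolution Φ F₀ F)
    (hB : KernelAssumption B Φ b₀ η) {α : ℝ} (h : LocalCondition b₀ η α F₀) (hF₀ : MemB1 F₀)
    (hα : 0 ≤ α) (hα₁ : α < 1 - η) (hN : 0 < mass F₀) (hE : 0 < energy F₀) {t : ℝ}
    (ht : Real.log 2 / (2 * lossRate F₀) ≤ t) : mass F₀ / 8 ≤ (F t).real {0} := by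
  have hloc := fun ε hε hε1 => h.mul_rpow_le (ε := ε) hε hε1
  have hmass := h.le_mass hF₀
  have h0 := h.1
  have hη := hB.η_nonneg
  have hb₀ := hB.b₀_pos
  have hEN : energy F₀ = energy F₀ / mass F₀ * mass F₀ := by field_simp
  set e := energy F₀ / mass F₀ with he
  have he0 : 0 < e := div_pos hE hN
  set β := (1 - η - α) / 2 with hβ
  set p := 3 / 2 + α with hp
  have hp0 : 0 < p := by linarith
  have hβ0 : 0 < β := by rw [hβ]; linarith
  have hl := Real.log_pos (one_lt_two (α := ℝ))
  change e ≤ 1 / (4 * p) at h0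
  rw [le_div_iff₀ (by positivity)] at h0
  set N := mass F₀ with hNdef
  set C := localConst b₀ α β p e with hC
  have hC0 : 0 ≤ C := by
    rw [hC, localConst_eq hp0 he0]
    have : 0 ≤ (p / β) ^ (2 * p) := by positivity
    positivity
  have hc : lossRate F₀ = N * Real.sqrt e := by
    unfold lossRate
    rw [hEN, ← hNdef, show N * (e * N) = N ^ 2 * e by ring, Real.sqrt_mul (sq_nonneg _),
      Real.sqrt_sq hN.le]
  have hc0 : 0 < lossRate F₀ := by rw [hc]; positivity
  set τ := Real.log 2 / (2 * lossRate F₀) with hτ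
  have hτ0 : 0 < τ := by positivity
  have hcτ : lossRate F₀ * τ = Real.log 2 / 2 := by rw [hτ]; field_simp
  have hexp : Real.exp (lossRate F₀ * τ) = Real.sqrt 2 := by rw [hcτ, exp_half_log_two]
  have hε0 : 0 < 4 * p * e := by positivity
  have hε1 : 4 * p * e ≤ 1 := by linarith
  have h4 : (0 : ℝ) < 4 ^ α := by positivity
  have hD : ∀ δ : ℝ, 0 < δ → C / (6 * (4 : ℝ) ^ α) * δ ^ α = C * (δ / 4) ^ α / 6 := by
    intro δ hδ
    rw [Real.div_rpow hδ.le (by norm_num)]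
    field_simp
  -- the factor `6 · 4^α`: up to time `2τ` the mass of `[0, δ]` is at least `(3/4)³ / 2 > 1/6` times
  -- the initial mass of `[0, δ/4]`
  have key := hF.le_real_singleton_zero_of_window hB hN hE (α := α) (β := β) (ε := 4 * p * e)
    (D := C / (6 * (4 : ℝ) ^ α)) (τ := τ) hβ hβ0 hε0 hε1 (by positivity) hτ0 hexp ?_ ?_ ?_ ?_ ht
  · have h1 := Real.sq_sqrt (show (0 : ℝ) ≤ 2 by norm_num)
    have h2 : Real.sqrt 2 ≤ 2 := by rw [Real.sqrt_le_left (by norm_num)]; norm_num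
    have h3 : (0 : ℝ) ≤ (F t).real {0} := measureReal_nonneg
    nlinarith
  · intro t ht δ hδ hδε
    rw [hD δ hδ]
    have hfin := (hF.memB1 t ht.1).isFiniteMeasure
    have hfin0 := hF₀.isFiniteMeasure
    have a1 := hloc (δ / 4) (by positivity) (by linarith)
    have a2 := mul_real_low_le_integral_cap F₀ (θ := 1 / 4) hδ (by norm_num)
    have a3 := hF.integral_cap_le hB hN hE hδ (by linarith) le_rfl ht.1
    have a4 := integral_cap_le_real_low (F t) hδ
    rw [hF.initial, sub_zero] at a3
    have a5 : Real.exp (lossRate F₀ * t) ≤ 2 := by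
      rw [← Real.exp_log (show (0 : ℝ) < 2 by norm_num)]
      refine Real.exp_le_exp.2 ?_
      calc lossRate F₀ * t ≤ lossRate F₀ * (2 * τ) := mul_le_mul_of_nonneg_left ht.2 hc0.le
        _ = Real.log 2 := by linarith
    rw [one_div_mul_eq_div] at a2
    have a6 : Real.exp (lossRate F₀ * t) * ∫ x : ℝ≥0, cap δ x ∂(F t) ≤
        2 * (F t).real (low δ) :=
      mul_le_mul a5 a4 (integral_nonneg fun x => cap_nonneg _ _) (by norm_num)
    have a7 : 0 ≤ C * (δ / 4) ^ α := by positivity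
    norm_num at a2
    linarith
  · intro δ hδ hδε
    rw [hD δ hδ]
    refine div_le_div_of_nonneg_right (le_trans ?_ hmass) (by norm_num)
    refine mul_le_mul_of_nonneg_left ?_ hC0
    exact Real.rpow_le_rpow (by positivity) (by linarith) hα
  · rw [hexp, hτ, hc]
    exact gain_dominates hb₀ hα hη hβ hβ0 hp he0 hN
  · rw [hEN, div_le_div_iff₀ hε0 (by norm_num)]
    have : 0 < e * N := mul_pos he0 hN
    nlinarith

end BoseBoltzmann

end

theorem lemma3p4
    (B : BoseBoltzmann.Vel → BoseBoltzmann.Vel → ℝ) (Φ : ℝ → ℝ → ℝ) (b₀ η : ℝ)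
    (hB : BoseBoltzmann.KernelAssumption B Φ b₀ η) (hη₀ : 0 ≤ η) (hη₁ : η < 1)
    (F₀ : MeasureTheory.Measure ℝ≥0) (hF₀ : BoseBoltzmann.MemB1 F₀)
    (hN : 0 < BoseBoltzmann.mass F₀) (hE : 0 < BoseBoltzmann.energy F₀)
    (α : ℝ) (hα₀ : 0 ≤ α) (hα₁ : α < 1 - η)
    (hloc : BoseBoltzmann.LocalCondition b₀ η α F₀)
    (m kB : ℝ) (hm : 0 < m) (hkB : 0 < kB) :
    BoseBoltzmann.kineticTemp m kB F₀ / BoseBoltzmann.criticalTemp m kB F₀ <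
        8 * (10 : ℝ) ^ (-4 : ℤ) * b₀ ^ (2 / 3 : ℝ) * (1 - η) ^ 2 ∧
      ∀ F : ℝ → MeasureTheory.Measure ℝ≥0, BoseBoltzmann.IsConservativeSolution Φ F₀ F →
        ∀ t : ℝ,
          Real.log 2 / (2 * Real.sqrt (BoseBoltzmann.mass F₀ * BoseBoltzmann.energy F₀)) ≤ t →
          BoseBoltzmann.mass F₀ / 8 ≤ (F t).real {0} := by
  refine ⟨hloc.kineticTemp_div_lt hF₀ hB.b₀_pos hη₀ hα₀ hα₁ hN hE hm hkB, fun F hF t ht => ?_⟩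
  exact hF.mass_div_eight_le hB hloc hF₀ hα₀ hα₁ hN hE ht
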